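/- **Setting.** A *block* $\Lambda$ consists of a sequence $\Theta=(\Theta_i)_{i\in\mathbb Z_{>0}}$ of symbols $\times,\circ,\blacklozenge$, almost all equal to $\circ$, and a parity $\overline\epsilon\in\mathbb Z/2$. Put $P=\{i\mid\Theta_i=\blacklozenge\}$ and $p(i)=\#\{j\in P\mid j\le i\}$. A *weight* in $\Lambda$ is a labelling of $\mathbb Z_{>0}$ by $\times,\circ,\vee,\wedge$ with the same $\times$'s and $\circ$'s as $\Theta$, labels $\vee$ or $\wedge$ exactly at $P$, and $\overline{\#\wedge}=\overline\epsilon$. A *cup diagram* (up to isotopy) joins the points of $P$ by disjoint arcs below the number line, each arc being a cup joining two points or a ray going straight down from one point, every point of $P$ lying on exactly one arc; each arc may be dotted or not. It is required to be *admissible*: a dotted arc is never nested inside a cup and never lies to the right of a ray. Reflecting a cup diagram $a$ gives the cap diagram $a^*$. For a weight $\lambda$, $\underline\lambda$ is the unique cup diagram such that undotted cups have labels $\vee\wedge$ (from left to right), dotted cups $\wedge\wedge$, undotted rays $\vee$ and dotted rays $\wedge$ in $\lambda$; and $\overline\lambda=\underline\lambda^*$. A *stacked circle diagram* $D=\underline\lambda(\mathbf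 a)\overline\mu$ of height $h\ge0$ is given by weights $\lambda,\mu\in\Lambda$ and cup diagrams $\mathbf a=(a_1,\dots,a_h)$ on $P$: with $a_0=\underline\lambda$ and $a_{h+1}=\underline\mu$, it has the vertices $(i,l)$, $i\in P$, $0\le l\le h$, the diagram $a_l$ is attached below and $a_{l+1}^*$ above the vertices of level $l$, and for $1\le l\le h$ each ray of $a_l$ at $i$ is glued to its mirror image in $a_l^*$, so that it joins $(i,l-1)$ to $(i,l)$. A connected component meeting the lower or upper boundary (that is, containing a ray of $\underline\lambda$ or of $\overline\mu$) is a *line*, and is *propagating* if it meets both; the other components are *circles*. An *orientation* of $D$ is a sequence $\nu=(\nu_0,\dots,\nu_h)$ of weights in $\Lambda$, $\nu_l$ labelling the vertices of level $l$, such that the labels at the ends of an undotted cup or cap differ, those at the ends of a dotted cup or cap agree, those at the ends of an internal ray agree, and the label at a ray of $\underline\lambda$ or $\overline\mu$ is $\vee$ if the ray is undotted and $\wedge$ if it is dotted. $D$ is *orientable* if it has an orientation. Let $V(D)$ be the complex vector space with basis the orientations of $D$. A *tag* of a circle is a vertex $(i,l)$ on it with $i$ maximal. For orientable $D$ and a vertex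 $x$ on a circle of $D$ let $\mathrm{sign}_D(x)=(-1)^n$, $n$ being the number of undotted cups and caps on a sequence of arcs from $x$ to a tag of its circle (this does not depend on the choices). In an oriented diagram a circle is *clockwise* if its tag is labelled $\vee$ and *anticlockwise* if it is labelled $\wedge$; lines are always anticlockwise. *Surgery.* $D'$ is obtained from $D=\underline\lambda(\mathbf a)\overline\mu$ by a surgery at positions $i<j$ on level $1\le l\le h$ if $D'=\underline\lambda(\mathbf b)\overline\mu$ is a (by definition admissible) stacked circle diagram with $b_s=a_s$ for $s\neq l$ and $b_l$ arises from $a_l$ by replacing one cup (dotted or not) joining $i$ and $j$ by two undotted rays. The *surgery map* $\mathrm{surg}_{D,D'}:V(D)\to V(D')$ is the linear map given on an orientation $\nu$ of $D$ as follows. * *Merge* (the number of components decreases). Let $C_{l-1},C_l$ be the components of $(i,l-1)$, $(i,l)$ in $D$ and $C$ that of $(i,l-1)$ in $D'$. If $C_{l-1},C_l$ are both anticlockwise, then $\nu\mapsto\nu'$; if only $C_{l-1}$ is clockwise, $\nu\mapsto\mathrm{sign}_D(i,l-1)\,\mathrm{sign}_{D'}(i,l-1)\,\nu''$; if only $C_l$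 is clockwise, $\nu\mapsto\mathrm{sign}_D(i,l)\,\mathrm{sign}_{D'}(i,l)\,\nu''$; if both are clockwise, $\nu\mapsto0$. Here $\nu'$ (resp. $\nu''$) is obtained from $\nu$ by changing the labels on $C$ so that $C$ becomes anticlockwise (resp. clockwise). * *Split* (the number of components increases). Let $C$ be the component of $(i,l)$ in $D$ and $C_i,C_j$ those of $(i,l),(j,l)$ in $D'$. If $D'$ is not orientable, $\nu\mapsto0$. Otherwise, if $C$ is anticlockwise, $\nu\mapsto(-1)^{p(i)}\big(\mathrm{sign}_{D'}(j,l)\,\nu'\pm\mathrm{sign}_{D'}(i,l)\,\nu''\big)$ with $+$ if the cup of $a_l$ joining $i$ and $j$ is dotted and $-$ if it is undotted; if $C$ is clockwise, $\nu\mapsto(-1)^{p(i)}\,\mathrm{sign}_D(i,l)\,\mathrm{sign}_{D'}(i,l)\,\mathrm{sign}_{D'}(j,l)\,\nu'''$. Here $\nu',\nu'',\nu'''$ are obtained from $\nu$ by changing the labels on $C_i,C_j$ so that, respectively, only $C_j$, only $C_i$, or both are clockwise. * *Reconnect* (the number of components stays the same). $\nu\mapsto\nu$ if $\nu$ is also an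 orientation of $D'$ and the components of $(i,l-1)$ and $(i,l)$ in $D$ are propagating lines; otherwise $\nu\mapsto0$. Terms in which a line would have to be clockwise are zero. **Theorem.** Let $D$ be a stacked circle diagram, let $E_1$ and $E_2$ be stacked circle diagrams each obtained from $D$ by a surgery, and let $F$ be a stacked circle diagram which is obtained from $E_1$ by a surgery and also from $E_2$ by a surgery. Then $$\mathrm{surg}_{E_1,F}\circ\mathrm{surg}_{D,E_1}=\mathrm{surg}_{E_2,F}\circ\mathrm{surg}_{D,E_2}.$$ -/

import Mathlib

/-! Blocks and weights of type D, decorated cup diagrams, stacked circle diagrams, their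
orientations, and the surgery maps. -/

namespace TypeDKhovanov

/-- The three symbols of a block diagram. -/
inductive BlockSymbol
  | cross
  | nought
  | diamond

/-- The four symbols of a diagrammatic weight; `down` is `∨` and `up` is `∧`. -/
inductive WeightSymbol
  | cross
  | nought
  | down
  | up

/-- A block: a block diagram `Θ` (a sequence of symbols on the positive integers, almost all of
which are noughts) together with a parity. -/
structure Block where
  symb : ℕ+ → BlockSymbol
  finite_support : {i | symb i ≠ BlockSymbol.nought}.Finite
  parity : ZMod 2

/-- The set `P_♦` of positions carrying the symbol `♦`. -/
abbrev Block.Vertex (Λ : Block) : Type := {i : ℕ+ // Λ.symb i = BlockSymbol.diamond}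

instance Block.finite_vertex (Λ : Block) : Finite Λ.Vertex :=
  (Λ.finite_support.subset (fun i (hi : Λ.symb i = BlockSymbol.diamond) => by
    simp [hi])).to_subtype

/-- `p(i) = #{j ∈ P_♦ | j ≤ i}`. -/
noncomputable def Block.pos (Λ : Block) (i : Λ.Vertex) : ℕ := Nat.card {j : Λ.Vertex // j ≤ i}

/-- The weights belonging to the block `Λ`: labels `∨`, `∧` exactly at the positions `♦`, the
crosses and noughts as in the block diagram, and the prescribed parity of the number of `∧`. -/
structure Block.Weight (Λ : Block) where
  label : ℕ+ → WeightSymbol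
  diamond_iff : ∀ i, (label i = WeightSymbol.up ∨ label i = WeightSymbol.down) ↔
    Λ.symb i = BlockSymbol.diamond
  cross_iff : ∀ i, label i = WeightSymbol.cross ↔ Λ.symb i = BlockSymbol.cross
  nought_iff : ∀ i, label i = WeightSymbol.nought ↔ Λ.symb i = BlockSymbol.nought
  parity_eq : (({i | label i = WeightSymbol.up}.ncard : ℕ) : ZMod 2) = Λ.parity

/-- The vertex `i` is labelled `∧`. (A vertex is labelled either `∧` or `∨`, so `¬ λ.Up i` says
that it is labelled `∨`.) -/
def Block.Weight.Up {Λ : Block} (lam : Λ.Weight) (i : Λ.Vertex) : Prop :=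
  lam.label i.1 = WeightSymbol.up

/-- An admissible decorated cup diagram on the vertices `V`, up to isotopy. The vertex
`partner i` is the other end of the cup at `i`; `partner i = i` means that a ray is attached
to `i`. `dotted i` is the decoration of the arc at `i`.

* `noncrossing`: the arcs are disjoint, that is, a vertex enclosed by a cup lies on a cup which is
  enclosed by that cup as well (and does not lie on a ray).
* `admissible`: a dotted arc can be joined to the left boundary, that is, if `i` is the left end
  point of a dotted cup or the end point of a dotted ray, then all vertices to the left of `i` lie
  on cups which end to the left of `i` (the arc is not nested in a cup and there is no ray to the
  left of it). -/
structure CupDiagram (V : Type) [LinearOrder V] where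
  partner : V → V
  dotted : V → Bool
  partner_partner : ∀ i, partner (partner i) = i
  dotted_partner : ∀ i, dotted (partner i) = dotted i
  noncrossing : ∀ i k, i < k → k < partner i →
    partner k ≠ k ∧ i < partner k ∧ partner k < partner i
  admissible : ∀ i k, dotted i = true → i ≤ partner i → k < i →
    partner k ≠ k ∧ partner k < i

theorem CupDiagram.ext {V : Type} [LinearOrder V] {c d : CupDiagram V}
    (hp : c.partner = d.partner) (hd : c.dotted = d.dotted) : c = d := by
  cases c; cases d; cases hp; cases hd; rfl

/-- The labelling with `∧` at the vertices satisfying `up` and `∨` at all other vertices makes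
every cup of `c` an anticlockwise oriented cup (`∨∧` if it is undotted, `∧∧` if it is dotted) and
every ray an oriented ray (`∨` if it is undotted, `∧` if it is dotted): it orients `c` with
degree zero. -/
structure CupDiagram.IsDegreeZero {V : Type} [LinearOrder V] (c : CupDiagram V) (up : V → Prop) :
    Prop where
  undotted_cup : ∀ i, i < c.partner i → c.dotted i = false → ¬ up i ∧ up (c.partner i)
  dotted_cup : ∀ i, i < c.partner i → c.dotted i = true → up i ∧ up (c.partner i)
  undotted_ray : ∀ i, c.partner i = i → c.dotted i = false → ¬ up i
  dotted_ray : ∀ i, c.partner i = i → c.dotted i = true → up i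

theorem CupDiagram.exists_isDegreeZero_aux {V : Type} [LinearOrder V] (up : V → Prop) (n : ℕ) :
    ∀ S : Finset V, S.card = n → ∃ (p : V → V) (d : V → Bool),
      (∀ i ∈ S, p i ∈ S) ∧ (∀ i ∈ S, p (p i) = i) ∧ (∀ i ∈ S, d (p i) = d i) ∧
      (∀ i ∈ S, ∀ k ∈ S, i < k → k < p i → p k ≠ k ∧ i < p k ∧ p k < p i) ∧
      (∀ i ∈ S, ∀ k ∈ S, d i = true → i ≤ p i → k < i → p k ≠ k ∧ p k < i) ∧
      (∀ i ∈ S, i < p i → d i = false → ¬ up i ∧ up (p i)) ∧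
      (∀ i ∈ S, i < p i → d i = true → up i ∧ up (p i)) ∧
      (∀ i ∈ S, p i = i → d i = false → ¬ up i) ∧
      (∀ i ∈ S, p i = i → d i = true → up i) := by
  classical
  induction n using Nat.strong_induction_on with
  | _ n ih =>
    intro S hS
    by_cases hA : ∃ i ∈ S, ∃ j ∈ S, i < j ∧ (∀ k ∈ S, ¬ (i < k ∧ k < j)) ∧
        ((¬ up i ∧ up j) ∨ (up i ∧ up j ∧ ∀ k ∈ S, i ≤ k))
    · obtain ⟨i, hi, j, hj, hij, hbet, hup⟩ := hA
      obtain ⟨p, d, h1, h2, h3, h4, h5, h6, h7, h8, h9⟩ :=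
        ih ((S.erase i).erase j).card (by
          rw [← hS]
          exact Finset.card_lt_card (lt_of_le_of_lt (Finset.erase_subset _ _)
            (Finset.erase_ssubset hi))) _ rfl
      have hmem : ∀ x, x ∈ (S.erase i).erase j ↔ x ≠ j ∧ x ≠ i ∧ x ∈ S := by
        intro x; simp
      simp only [hmem] at h1 h2 h3 h4 h5 h6 h7 h8 h9
      have hji : j ≠ i := hij.ne'
      obtain ⟨P, hPi, hPj, hP⟩ : ∃ P : V → V, P i = j ∧ P j = i ∧
          ∀ x, x ≠ i → x ≠ j → P x = p x :=
        ⟨fun x => if x = i then j else if x = j then i else p x, by simp, by simp [hji],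
          fun x h h' => by simp [h, h']⟩
      obtain ⟨E, hEi, hEj, hE⟩ : ∃ E : V → Bool, E i = decide (up i) ∧ E j = decide (up i) ∧
          ∀ x, x ≠ i → x ≠ j → E x = d x :=
        ⟨fun x => if x = i then decide (up i) else if x = j then decide (up i) else d x,
          by simp, by simp [hji], fun x h h' => by simp [h, h']⟩
      have hout : ∀ k ∈ S, k ≠ i → k ≠ j → k < i ∨ j < k := by
        intro k hk hki hkj
        by_contra hcon
        push Not at hcon
        exact hbet k hk ⟨lt_of_le_of_ne hcon.1 hki.symm, lt_of_le_of_ne hcon.2 hkj⟩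
      refine ⟨P, E, ?_, ?_, ?_, ?_, ?_, ?_, ?_, ?_, ?_⟩
      · intro x hx
        by_cases hxi : x = i
        · subst hxi; rw [hPi]; exact hj
        · by_cases hxj : x = j
          · subst hxj; rw [hPj]; exact hi
          · rw [hP x hxi hxj]; exact (h1 x ⟨hxj, hxi, hx⟩).2.2
      · intro x hx
        by_cases hxi : x = i
        · subst hxi; rw [hPi, hPj]
        · by_cases hxj : x = j
          · subst hxj; rw [hPj, hPi]
          · have := h1 x ⟨hxj, hxi, hx⟩
            rw [hP x hxi hxj, hP _ this.2.1 this.1]; exact h2 x ⟨hxj, hxi, hx⟩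
      · intro x hx
        by_cases hxi : x = i
        · subst hxi; rw [hPi, hEi, hEj]
        · by_cases hxj : x = j
          · subst hxj; rw [hPj, hEi, hEj]
          · have := h1 x ⟨hxj, hxi, hx⟩
            rw [hP x hxi hxj, hE _ this.2.1 this.1, hE x hxi hxj]; exact h3 x ⟨hxj, hxi, hx⟩
      · intro x hx k hk hxk hkx
        by_cases hxi : x = i
        · subst hxi; rw [hPi] at hkx; exact absurd ⟨hxk, hkx⟩ (hbet k hk)
        by_cases hxj : x = j
        · subst hxj; rw [hPj] at hkx; exact absurd (hxk.trans hkx) (not_lt.2 hij.le)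
        have hpx := h1 x ⟨hxj, hxi, hx⟩
        rw [hP x hxi hxj] at hkx ⊢
        by_cases hki : k = i
        · subst hki
          rw [hPi]
          refine ⟨hji, hxk.trans hij, ?_⟩
          rcases hout _ hpx.2.2 hpx.2.1 hpx.1 with h | h
          · exact absurd hkx (not_lt.2 h.le)
          · exact h
        by_cases hkj : k = j
        · subst hkj
          rw [hPj]
          refine ⟨hji.symm, ?_, hij.trans hkx⟩
          rcases hout _ hx hxi hxj with h | h
          · exact h
          · exact absurd hxk (not_lt.2 h.le)
        rw [hP k hki hkj]
        exact h4 x ⟨hxj, hxi, hx⟩ k ⟨hkj, hki, hk⟩ hxk hkx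
      · intro x hx k hk hd hxp hkx
        by_cases hxi : x = i
        · subst hxi
          rw [hEi] at hd
          rcases hup with hu | hu
          · exact absurd (of_decide_eq_true hd) hu.1
          · exact absurd hkx (not_lt.2 (hu.2.2 k hk))
        by_cases hxj : x = j
        · subst hxj; rw [hPj] at hxp; exact absurd hij (not_lt.2 hxp)
        have hpx := h1 x ⟨hxj, hxi, hx⟩
        rw [hP x hxi hxj] at hxp
        rw [hE x hxi hxj] at hd
        by_cases hki : k = i
        · subst hki
          rw [hPi]
          refine ⟨hji, ?_⟩
          rcases hout _ hx hxi hxj with h | h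
          · exact absurd hkx (not_lt.2 h.le)
          · exact h
        by_cases hkj : k = j
        · subst hkj
          rw [hPj]
          exact ⟨hji.symm, hij.trans hkx⟩
        rw [hP k hki hkj]
        exact h5 x ⟨hxj, hxi, hx⟩ k ⟨hkj, hki, hk⟩ hd hxp hkx
      · intro x hx hlt hd
        by_cases hxi : x = i
        · subst hxi
          rw [hEi] at hd
          rw [hPi]
          rcases hup with hu | hu
          · exact hu
          · exact absurd hu.1 (of_decide_eq_false hd)
        by_cases hxj : x = j
        · subst hxj; rw [hPj] at hlt; exact absurd hij (not_lt.2 hlt.le)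
        rw [hP x hxi hxj] at hlt ⊢
        rw [hE x hxi hxj] at hd
        exact h6 x ⟨hxj, hxi, hx⟩ hlt hd
      · intro x hx hlt hd
        by_cases hxi : x = i
        · subst hxi
          rw [hEi] at hd
          rw [hPi]
          rcases hup with hu | hu
          · exact absurd (of_decide_eq_true hd) hu.1
          · exact ⟨hu.1, hu.2.1⟩
        by_cases hxj : x = j
        · subst hxj; rw [hPj] at hlt; exact absurd hij (not_lt.2 hlt.le)
        rw [hP x hxi hxj] at hlt ⊢
        rw [hE x hxi hxj] at hd
        exact h7 x ⟨hxj, hxi, hx⟩ hlt hd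
      · intro x hx heq hd
        by_cases hxi : x = i
        · subst hxi; exact absurd (hPi.symm.trans heq) hji
        by_cases hxj : x = j
        · subst hxj; exact absurd (hPj.symm.trans heq) hji.symm
        rw [hP x hxi hxj] at heq
        rw [hE x hxi hxj] at hd
        exact h8 x ⟨hxj, hxi, hx⟩ heq hd
      · intro x hx heq hd
        by_cases hxi : x = i
        · subst hxi; exact absurd (hPi.symm.trans heq) hji
        by_cases hxj : x = j
        · subst hxj; exact absurd (hPj.symm.trans heq) hji.symm
        rw [hP x hxi hxj] at heq
        rw [hE x hxi hxj] at hd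
        exact h9 x ⟨hxj, hxi, hx⟩ heq hd
    · push Not at hA
      refine ⟨id, fun x => decide (up x), by simp, by simp, by simp, ?_, ?_, ?_, ?_, by simp, by simp⟩
      · intro i _ k _ h1 h2; exact absurd h1 (by simpa using h2.le)
      · intro x hx k hk hdx _ hkx
        exfalso
        have hx' : up x := by simpa using hdx
        have hleft : ∀ y ∈ S, y < x → up y := by
          intro y hy hyx
          by_contra hny
          have hT : (S.filter fun z => z < x ∧ ¬ up z).Nonempty := ⟨y, by simp [hy, hyx, hny]⟩
          set i := (S.filter fun z => z < x ∧ ¬ up z).max' hT with hi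
          have hiT := Finset.max'_mem _ hT
          rw [← hi] at hiT
          simp only [Finset.mem_filter] at hiT
          have hU : (S.filter fun z => i < z).Nonempty := ⟨x, by simp [hx, hiT.2.1]⟩
          set j := (S.filter fun z => i < z).min' hU with hj
          have hjU := Finset.min'_mem _ hU
          rw [← hj] at hjU
          simp only [Finset.mem_filter] at hjU
          have hjx : j ≤ x := Finset.min'_le _ _ (by simp [hx, hiT.2.1])
          have hju : up j := by
            rcases hjx.lt_or_eq with hlt | heq
            · by_contra hnj
              have := Finset.le_max' (S.filter fun z => z < x ∧ ¬ up z) j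
                (by simp [hjU.1, hlt, hnj])
              exact absurd hjU.2 (not_lt.2 (by rw [hi]; exact this))
            · rw [heq]; exact hx'
          refine absurd hju ((hA i hiT.1 j hjU.1 hjU.2 ?_).1 hiT.2.2)
          intro k hk hik
          exact Finset.min'_le _ _ (by simp [hk, hik])
        have hSn : S.Nonempty := ⟨x, hx⟩
        set a := S.min' hSn with ha
        have haS : a ∈ S := Finset.min'_mem _ _
        have hak : a ≤ k := Finset.min'_le _ _ hk
        have hU : (S.filter fun z => a < z).Nonempty := ⟨x, by simp [hx, lt_of_le_of_lt hak hkx]⟩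
        set b := (S.filter fun z => a < z).min' hU with hb
        have hbU := Finset.min'_mem _ hU
        rw [← hb] at hbU
        simp only [Finset.mem_filter] at hbU
        have hbx : b ≤ x := Finset.min'_le _ _ (by simp [hx, lt_of_le_of_lt hak hkx])
        have hub : up b := by
          rcases hbx.lt_or_eq with hlt | heq
          · exact hleft b hbU.1 hlt
          · rw [heq]; exact hx'
        obtain ⟨z, hz, hza⟩ := (hA a haS b hbU.1 hbU.2 (by
          intro k hk hik
          exact Finset.min'_le _ _ (by simp [hk, hik]))).2 (hleft a haS (lt_of_le_of_lt hak hkx)) hub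
        exact absurd hza (not_lt.2 (Finset.min'_le _ _ hz))
      · intro i _ h; exact absurd h (lt_irrefl _)
      · intro i _ h; exact absurd h (lt_irrefl _)

theorem CupDiagram.exists_isDegreeZero {V : Type} [LinearOrder V] [Finite V] (up : V → Prop) :
    ∃ c : CupDiagram V, c.IsDegreeZero up := by
  have := Fintype.ofFinite V
  obtain ⟨p, d, -, h2, h3, h4, h5, h6, h7, h8, h9⟩ := CupDiagram.exists_isDegreeZero_aux up _ (Finset.univ : Finset V) rfl
  simp only [Finset.mem_univ, true_imp_iff] at h2 h3 h4 h5 h6 h7 h8 h9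
  exact ⟨⟨p, d, h2, h3, h4, h5⟩, ⟨h6, h7, h8, h9⟩⟩

theorem CupDiagram.IsDegreeZero.up_of_dotted {V : Type} [LinearOrder V] {c : CupDiagram V}
    {up : V → Prop} (h : c.IsDegreeZero up) {k : V} (hk : c.dotted k = true) : up k := by
  rcases lt_trichotomy k (c.partner k) with hlt | heq | hgt
  · exact (h.dotted_cup k hlt hk).1
  · exact h.dotted_ray k heq.symm hk
  · have := (h.dotted_cup (c.partner k) (by rwa [c.partner_partner])
      (by rwa [c.dotted_partner])).2
    rwa [c.partner_partner] at this

theorem CupDiagram.IsDegreeZero.undotted_cup_unique {V : Type} [LinearOrder V] [Finite V]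
    {c c' : CupDiagram V} {up : V → Prop} (h : c.IsDegreeZero up) (h' : c'.IsDegreeZero up)
    (n : ℕ) : ∀ i, {k | i < k ∧ k < c.partner i}.ncard = n → i < c.partner i →
      c.dotted i = false → c'.partner i = c.partner i ∧ c'.dotted i = false := by
  induction n using Nat.strong_induction_on with
  | _ n ih =>
    intro i hn hij hd
    obtain ⟨hui, huj⟩ := h.undotted_cup i hij hd
    have hundot : ∀ m, i < m → m < c.partner i → m ≤ c.partner m → c.dotted m = false := by
      intro m him hmj hmp
      by_contra hm
      have := (c.admissible m i (by simpa using hm) hmp him).2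
      exact absurd this (not_lt.2 hmj.le)
    have hleft : ∀ m, i < m → m < c.partner i → m < c.partner m →
        c'.partner m = c.partner m := by
      intro m him hmj hmp
      refine (ih _ ?_ m rfl hmp (hundot m him hmj hmp.le)).1
      rw [← hn]
      refine Set.ncard_lt_ncard ⟨?_, ?_⟩ (Set.toFinite _)
      · rintro k ⟨h1, h2⟩
        exact ⟨him.trans h1, h2.trans (c.noncrossing i m him hmj).2.2⟩
      · intro hsub
        exact absurd (hsub ⟨him, hmj⟩).1 (lt_irrefl _)
    have hin : ∀ m, i < m → m < c.partner i →
        i < c'.partner m ∧ c'.partner m < c.partner i := by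
      intro m him hmj
      obtain ⟨h1, h2, h3⟩ := c.noncrossing i m him hmj
      rcases lt_or_gt_of_ne h1 with hlt | hgt
      · have := hleft _ h2 h3 (by rwa [c.partner_partner])
        rw [c.partner_partner] at this
        have := congrArg c'.partner this
        rw [c'.partner_partner] at this
        rw [← this]
        exact ⟨h2, h3⟩
      · rw [hleft m him hmj hgt]; exact ⟨h2, h3⟩
    have hd' : c'.dotted i = false := by
      by_contra hcon
      exact hui (h'.up_of_dotted (by simpa using hcon))
    refine ⟨?_, hd'⟩
    have hnot : ¬ (i < c'.partner i ∧ c'.partner i < c.partner i) := by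
      rintro ⟨h1, h2⟩
      have := (hin _ h1 h2).1
      rw [c'.partner_partner] at this
      exact lt_irrefl _ this
    have hjd : c.partner i ≤ c'.partner (c.partner i) → c'.dotted (c.partner i) = true := by
      intro hle
      by_contra hcon
      have hcon : c'.dotted (c.partner i) = false := by simpa using hcon
      rcases hle.lt_or_eq with hlt | heq
      · exact (h'.undotted_cup _ hlt hcon).1 huj
      · exact h'.undotted_ray _ heq.symm hcon huj
    have hjle : ¬ c.partner i ≤ c'.partner (c.partner i) ∨
        (c'.partner i ≠ i ∧ c'.partner i < c.partner i) := by
      by_cases hle : c.partner i ≤ c'.partner (c.partner i)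
      · exact Or.inr (c'.admissible _ i (hjd hle) hle hij)
      · exact Or.inl hle
    rcases lt_trichotomy (c'.partner i) i with hlt | heq | hgt
    · exfalso
      have hlt' : c'.partner i < c'.partner (c'.partner i) := by rwa [c'.partner_partner]
      have := (h'.undotted_cup _ hlt' (by rwa [c'.dotted_partner])).2
      rw [c'.partner_partner] at this
      exact hui this
    · exfalso
      have hlt : c'.partner (c.partner i) < c.partner i := by
        rcases hjle with h1 | h1
        · exact not_le.1 h1
        · exact absurd heq h1.1
      rcases lt_trichotomy (c'.partner (c.partner i)) i with h1 | h1 | h1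
      · exact (c'.noncrossing (c'.partner (c.partner i)) i h1
          (by rwa [c'.partner_partner])).1 heq
      · have : c'.partner (c'.partner (c.partner i)) = c'.partner i := by rw [h1]
        rw [c'.partner_partner, heq] at this
        exact absurd this hij.ne'
      · have := (hin _ h1 hlt).2
        rw [c'.partner_partner] at this
        exact lt_irrefl _ this
    · rcases lt_trichotomy (c'.partner i) (c.partner i) with h1 | h1 | h1
      · exact absurd ⟨hgt, h1⟩ hnot
      · exact h1
      · exfalso
        obtain ⟨h2, h3, h4⟩ := c'.noncrossing i _ hij h1
        have hlt : c'.partner (c.partner i) < c.partner i := by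
          rcases hjle with h5 | h5
          · exact not_le.1 h5
          · exact absurd h5.2 (not_lt.2 h1.le)
        have := (hin _ h3 hlt).2
        rw [c'.partner_partner] at this
        exact lt_irrefl _ this

theorem CupDiagram.IsDegreeZero.undotted_unique {V : Type} [LinearOrder V] [Finite V]
    {c c' : CupDiagram V} {up : V → Prop} (h : c.IsDegreeZero up) (h' : c'.IsDegreeZero up)
    (k : V) (hk : c.dotted k = false) :
    c'.dotted k = false ∧ (c.partner k ≠ k → c'.partner k = c.partner k) := by
  rcases lt_trichotomy k (c.partner k) with hlt | heq | hgt
  · have := h.undotted_cup_unique h' _ k rfl hlt hk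
    exact ⟨this.2, fun _ => this.1⟩
  · refine ⟨?_, fun hne => absurd heq.symm hne⟩
    by_contra hcon
    exact h.undotted_ray k heq.symm hk (h'.up_of_dotted (by simpa using hcon))
  · have := h.undotted_cup_unique h' _ (c.partner k) rfl (by rwa [c.partner_partner])
      (by rwa [c.dotted_partner])
    rw [c.partner_partner] at this
    refine ⟨?_, fun _ => ?_⟩
    · have h2 := c'.dotted_partner (c.partner k)
      rw [this.1, this.2] at h2
      exact h2
    · rw [← c'.partner_partner (c.partner k), this.1]

theorem CupDiagram.no_longer_dotted {V : Type} [LinearOrder V] (c c' : CupDiagram V)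
    (hdot : ∀ k, c.dotted k = c'.dotted k) (k : V) (hk : c.dotted k = true)
    (hle : k ≤ c.partner k) (hlt : c.partner k < c'.partner k) : False := by
  rcases hle.lt_or_eq with h1 | h1
  · obtain ⟨h2, h3, h4⟩ := c'.noncrossing k _ h1 hlt
    have hd : c'.dotted (c.partner k) = true := by rw [← hdot, c.dotted_partner, hk]
    rcases le_total (c.partner k) (c'.partner (c.partner k)) with h5 | h5
    · exact absurd (c'.admissible _ k hd h5 h1).2 (not_lt.2 hlt.le)
    · have := (c'.admissible _ k ((c'.dotted_partner _).trans hd)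
        (by rwa [c'.partner_partner]) h3).2
      exact absurd this (not_lt.2 (h5.trans hlt.le))
  · rw [← h1] at hlt
    have hd : c.dotted (c'.partner k) = true := by rw [hdot, c'.dotted_partner, ← hdot, hk]
    rcases le_or_gt (c'.partner k) (c.partner (c'.partner k)) with h5 | h5
    · exact (c.admissible _ k hd h5 hlt).1 h1.symm
    · rcases lt_trichotomy (c.partner (c'.partner k)) k with h6 | h6 | h6
      · exact (c.noncrossing _ k h6 (by rwa [c.partner_partner])).1 h1.symm
      · have : c.partner (c.partner (c'.partner k)) = c.partner k := by rw [h6]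
        rw [c.partner_partner, ← h1] at this
        exact absurd this hlt.ne'
      · exact (c.admissible _ k ((c.dotted_partner _).trans hd)
          (by rw [c.partner_partner]; exact h5.le) h6).1 h1.symm

theorem CupDiagram.IsDegreeZero.unique {V : Type} [LinearOrder V] [Finite V]
    {c c' : CupDiagram V} {up : V → Prop} (h : c.IsDegreeZero up) (h' : c'.IsDegreeZero up) :
    c = c' := by
  have hdot : ∀ k, c.dotted k = c'.dotted k := by
    intro k
    cases hk : c.dotted k with
    | false => exact (h.undotted_unique h' k hk).1.symm
    | true =>
      by_contra hcon
      have := (h'.undotted_unique h k (by simpa using Ne.symm hcon)).1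
      simp [hk] at this
  refine CupDiagram.ext (funext fun k => ?_) (funext hdot)
  induction k using WellFoundedLT.induction with
  | _ k ih =>
    cases hk : c.dotted k with
    | false =>
      by_cases h1 : c.partner k = k
      · by_cases h2 : c'.partner k = k
        · rw [h1, h2]
        · exact (h'.undotted_unique h k (by rw [← hdot, hk])).2 h2
      · exact ((h.undotted_unique h' k hk).2 h1).symm
    | true =>
      rcases lt_or_ge (c.partner k) k with h1 | h1
      · have := ih _ h1
        rw [c.partner_partner] at this
        conv_rhs => rw [this]
        rw [c'.partner_partner]
      rcases lt_or_ge (c'.partner k) k with h2 | h2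
      · have := ih _ h2
        rw [c'.partner_partner] at this
        conv_lhs => rw [← this]
        rw [c.partner_partner]
      rcases lt_trichotomy (c.partner k) (c'.partner k) with h3 | h3 | h3
      · exact (c.no_longer_dotted c' hdot k hk h1 h3).elim
      · exact h3
      · exact (c'.no_longer_dotted c (fun k => (hdot k).symm) k (by rw [← hdot, hk]) h2 h3).elim

/-- The cup diagram `\underline λ` associated with a weight `λ`: the unique cup diagram on which
`λ` is an orientation of degree zero. -/
noncomputable def Block.Weight.cupDiagram {Λ : Block} (lam : Λ.Weight) : CupDiagram Λ.Vertex :=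
  (CupDiagram.exists_isDegreeZero lam.Up).choose

theorem Block.Weight.cupDiagram_isDegreeZero {Λ : Block} (lam : Λ.Weight) :
    lam.cupDiagram.IsDegreeZero lam.Up :=
  (CupDiagram.exists_isDegreeZero lam.Up).choose_spec

theorem Block.Weight.eq_cupDiagram {Λ : Block} (lam : Λ.Weight) (c : CupDiagram Λ.Vertex)
    (hc : c.IsDegreeZero lam.Up) : c = lam.cupDiagram :=
  hc.unique lam.cupDiagram_isDegreeZero

/-- All cups of `c` (read as cups or as caps) are oriented by the weight `ν`: the two labels agree
for a dotted cup and differ for an undotted cup. -/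
def CupDiagram.CupsOriented {Λ : Block} (c : CupDiagram Λ.Vertex) (ν : Λ.Weight) : Prop :=
  ∀ i, c.partner i ≠ i →
    (c.dotted i = true → (ν.Up i ↔ ν.Up (c.partner i))) ∧
    (c.dotted i = false → (ν.Up i ↔ ¬ ν.Up (c.partner i)))

/-- All rays of `c` are oriented by the weight `ν`: the label is `∧` at a dotted ray and `∨` at an
undotted ray. -/
def CupDiagram.RaysOriented {Λ : Block} (c : CupDiagram Λ.Vertex) (ν : Λ.Weight) : Prop :=
  ∀ i, c.partner i = i → (ν.Up i ↔ c.dotted i = true)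

/-- A stacked circle diagram `\underline λ (a) \overline μ` of height `h` for the block `Λ`. The
internal cup diagrams `a_1, …, a_h` are indexed by `s : Fin h`, so `inner s` is `a_{s+1}`. -/
structure StackedDiagram (Λ : Block) (h : ℕ) where
  lam : Λ.Weight
  mu : Λ.Weight
  inner : Fin h → CupDiagram Λ.Vertex

namespace StackedDiagram

variable {Λ : Block} {h : ℕ}

/-- The vertices `(i, l)` with `i ∈ P_♦` and `0 ≤ l ≤ h`. -/
abbrev Node (Λ : Block) (h : ℕ) : Type := Λ.Vertex × Fin (h + 1)

/-- The cup diagram `a_l` hanging below the vertices of level `l`, where `a_0 = \underline λ`. -/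
noncomputable def below (D : StackedDiagram Λ h) (l : Fin (h + 1)) : CupDiagram Λ.Vertex :=
  (Fin.cons D.lam.cupDiagram D.inner : Fin (h + 1) → CupDiagram Λ.Vertex) l

/-- The cup diagram `a_{l+1}` whose reflection is the cap diagram on top of the vertices of level
`l`, where `a_{h+1}^* = \overline μ`. -/
noncomputable def above (D : StackedDiagram Λ h) (l : Fin (h + 1)) : CupDiagram Λ.Vertex :=
  (Fin.snoc D.inner D.mu.cupDiagram : Fin (h + 1) → CupDiagram Λ.Vertex) l

/-- `D.Step x y n`: the vertices `x` and `y` are joined by a cup, by a cap, or by a pair of internal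
rays, and `n` is the number of undotted cups and caps used (so `n ≤ 1`). -/
inductive Step (D : StackedDiagram Λ h) : Node Λ h → Node Λ h → ℕ → Prop
  | cup (i : Λ.Vertex) (l : Fin (h + 1)) (hi : (D.below l).partner i ≠ i) :
      Step D (i, l) ((D.below l).partner i, l) (if (D.below l).dotted i = true then 0 else 1)
  | cap (i : Λ.Vertex) (l : Fin (h + 1)) (hi : (D.above l).partner i ≠ i) :
      Step D (i, l) ((D.above l).partner i, l) (if (D.above l).dotted i = true then 0 else 1)
  | rayUp (i : Λ.Vertex) (s : Fin h) (hi : (D.inner s).partner i = i) :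
      Step D (i, s.castSucc) (i, s.succ) 0
  | rayDown (i : Λ.Vertex) (s : Fin h) (hi : (D.inner s).partner i = i) :
      Step D (i, s.succ) (i, s.castSucc) 0

/-- `D.Path x y n`: there is a sequence of arcs of `D` from `x` to `y` which contains, counted with
multiplicity, exactly `n` undotted cups and caps. -/
inductive Path (D : StackedDiagram Λ h) : Node Λ h → Node Λ h → ℕ → Prop
  | nil (x : Node Λ h) : Path D x x 0
  | snoc {x y z : Node Λ h} {m n : ℕ} : Path D x y m → D.Step y z n → Path D x z (m + n)

/-- The connected components of `D` (as sets of vertices; each component contains a vertex). -/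
def Component (D : StackedDiagram Λ h) : Type := Quot fun x y => ∃ n, D.Step x y n

/-- The connected component of a vertex. -/
def comp (D : StackedDiagram Λ h) (x : Node Λ h) : D.Component := Quot.mk _ x

/-- The number of connected components. -/
noncomputable def numComponents (D : StackedDiagram Λ h) : ℕ := Nat.card D.Component

/-- The component meets the lower boundary: it contains a ray of `\underline λ`. -/
def MeetsBottom (D : StackedDiagram Λ h) (C : D.Component) : Prop :=
  ∃ i, D.comp (i, 0) = C ∧ D.lam.cupDiagram.partner i = i

/-- The component meets the upper boundary: it contains a ray of `\overline μ`. -/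
def MeetsTop (D : StackedDiagram Λ h) (C : D.Component) : Prop :=
  ∃ i, D.comp (i, Fin.last h) = C ∧ D.mu.cupDiagram.partner i = i

/-- A circle is a component not meeting the boundary; the other components are lines. -/
def IsCircle (D : StackedDiagram Λ h) (C : D.Component) : Prop :=
  ¬ D.MeetsBottom C ∧ ¬ D.MeetsTop C

/-- A propagating line has one end point at the bottom and the other one at the top. -/
def IsPropagating (D : StackedDiagram Λ h) (C : D.Component) : Prop :=
  D.MeetsBottom C ∧ D.MeetsTop C

/-- The vertex `t` is a possible tag (a rightmost vertex) of its component. -/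
def IsTag (D : StackedDiagram Λ h) (t : Node Λ h) : Prop :=
  ∀ y, D.comp y = D.comp t → y.1 ≤ t.1

open Classical in
/-- `sign_D(x) = (-1)^n`, where `n` is the number of undotted cups and caps on a sequence of arcs
from `x` to a tag of the component of `x`. For a circle of an orientable diagram it depends neither
on the tag nor on the sequence of arcs; it is used only in that case. -/
noncomputable def sign (D : StackedDiagram Λ h) (x : Node Λ h) : ℂ :=
  if ∃ t n, D.IsTag t ∧ D.Path x t n ∧ Even n then 1 else -1

/-- An orientation of `D` is a sequence `ν_0, …, ν_h` of weights of the block orienting all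
components. The dots on internal rays come in pairs, so the labels at the two ends of a pair of
internal rays agree. -/
structure IsOrientation (D : StackedDiagram Λ h) (ν : Fin (h + 1) → Λ.Weight) : Prop where
  cups : ∀ l, (D.below l).CupsOriented (ν l)
  caps : ∀ l, (D.above l).CupsOriented (ν l)
  bottom_rays : D.lam.cupDiagram.RaysOriented (ν 0)
  top_rays : D.mu.cupDiagram.RaysOriented (ν (Fin.last h))
  internal_rays : ∀ s i, (D.inner s).partner i = i → ((ν s.castSucc).Up i ↔ (ν s.succ).Up i)

/-- The orientations of `D`, that is, the oriented stacked circle diagrams with underlying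
diagram `D`. -/
def Orientation (D : StackedDiagram Λ h) : Type := {ν : Fin (h + 1) → Λ.Weight // D.IsOrientation ν}

/-- The vertex `x` is labelled `∧`. -/
def Orientation.Up {D : StackedDiagram Λ h} (ν : D.Orientation) (x : Node Λ h) : Prop :=
  (ν.1 x.2).Up x.1

/-- A circle is clockwise if its tag is labelled `∨`. All other circles, and all lines, are
anticlockwise. -/
def Orientation.Clockwise {D : StackedDiagram Λ h} (ν : D.Orientation) (C : D.Component) : Prop :=
  D.IsCircle C ∧ ∃ t, D.comp t = C ∧ D.IsTag t ∧ ¬ ν.Up t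

/-- The complex vector space with basis the oriented stacked circle diagrams with underlying
diagram `D`. It is zero if `D` is not orientable. -/
abbrev Space (D : StackedDiagram Λ h) : Type := D.Orientation →₀ ℂ

/-- `ν'` is obtained by changing `ν` in such a way that, among the components in `S`, precisely
those in `T` are oriented clockwise. -/
def IsReorientation {D D' : StackedDiagram Λ h} (ν : D.Orientation) (S T : Set D'.Component)
    (ν' : D'.Orientation) : Prop :=
  (∀ x, D'.comp x ∉ S → (ν'.Up x ↔ ν.Up x)) ∧ ∀ C ∈ S, ν'.Clockwise C ↔ C ∈ T

open Classical in
/-- The basis vector of `D'` given by the orientation `ν'` obtained by changing `ν` in such a way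
that among the components in `S` precisely those in `T ⊆ S` become clockwise. It is zero if there
is no such orientation: if `T` contains a line, or if `D'` is not orientable. -/
noncomputable def reorient {D D' : StackedDiagram Λ h} (ν : D.Orientation)
    (S T : Set D'.Component) : D'.Space :=
  if hν : ∃ ν' : D'.Orientation, IsReorientation ν S T ν' then Finsupp.single hν.choose 1 else 0

/-- A surgery from `D` to `D'` at the positions `i < j` on one level: `D'` arises from `D` by
replacing exactly one cup of exactly one internal cup diagram, connecting `i` and `j`, by two
undotted rays. With `level = s` the cup diagram changed is `a_{s+1}`. -/
structure Surgery (D D' : StackedDiagram Λ h) where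
  level : Fin h
  i : Λ.Vertex
  j : Λ.Vertex
  lt : i < j
  lam_eq : D'.lam = D.lam
  mu_eq : D'.mu = D.mu
  inner_eq : ∀ s, s ≠ level → D'.inner s = D.inner s
  cup : (D.inner level).partner i = j
  ray_i : (D'.inner level).partner i = i
  ray_j : (D'.inner level).partner j = j
  undotted_i : (D'.inner level).dotted i = false
  undotted_j : (D'.inner level).dotted j = false
  partner_eq : ∀ k, k ≠ i → k ≠ j → (D'.inner level).partner k = (D.inner level).partner k
  dotted_eq : ∀ k, k ≠ i → k ≠ j → (D'.inner level).dotted k = (D.inner level).dotted k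

namespace Surgery

variable {D D' : StackedDiagram Λ h}

/-- The vertex `(x, l - 1)` just below the surgery at level `l`. -/
def lower (s : Surgery D D') (x : Λ.Vertex) : Node Λ h := (x, s.level.castSucc)

/-- The vertex `(x, l)` just above the surgery at level `l`. -/
def upper (s : Surgery D D') (x : Λ.Vertex) : Node Λ h := (x, s.level.succ)

open Classical in
/-- The image of a basis vector if the surgery is a merge. -/
noncomputable def merge (s : Surgery D D') (ν : D.Orientation) : D'.Space :=
  let C := D'.comp (s.lower s.i)
  if ν.Clockwise (D.comp (s.lower s.i)) then
    if ν.Clockwise (D.comp (s.upper s.i)) then 0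
    else (D.sign (s.lower s.i) * D'.sign (s.lower s.i)) • reorient ν {C} {C}
  else
    if ν.Clockwise (D.comp (s.upper s.i)) then
      (D.sign (s.upper s.i) * D'.sign (s.upper s.i)) • reorient ν {C} {C}
    else reorient ν {C} ∅

open Classical in
/-- The image of a basis vector if the surgery is a split. -/
noncomputable def split (s : Surgery D D') (ν : D.Orientation) : D'.Space :=
  let Ci := D'.comp (s.upper s.i)
  let Cj := D'.comp (s.upper s.j)
  (-1 : ℂ) ^ Λ.pos s.i •
    if ν.Clockwise (D.comp (s.upper s.i)) then
      (D.sign (s.upper s.i) * D'.sign (s.upper s.i) * D'.sign (s.upper s.j)) •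
        reorient ν {Ci, Cj} {Ci, Cj}
    else if (D.inner s.level).dotted s.i = true then
      D'.sign (s.upper s.j) • reorient ν {Ci, Cj} {Cj} +
        D'.sign (s.upper s.i) • reorient ν {Ci, Cj} {Ci}
    else
      D'.sign (s.upper s.j) • reorient ν {Ci, Cj} {Cj} -
        D'.sign (s.upper s.i) • reorient ν {Ci, Cj} {Ci}

open Classical in
/-- The image of a basis vector if the surgery is a reconnect: the labels do not change if the two
lines are propagating and the labels orient `D'`; otherwise the image is zero. -/
noncomputable def reconnect (s : Surgery D D') (ν : D.Orientation) : D'.Space :=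
  if hν : D'.IsOrientation ν.1 ∧ D.IsPropagating (D.comp (s.lower s.i)) ∧
      D.IsPropagating (D.comp (s.upper s.i)) then
    Finsupp.single ⟨ν.1, hν.1⟩ 1
  else 0

/-- The image of a basis vector under the surgery map. The surgery is a merge, a split or a
reconnect if the number of components decreases, increases or stays the same, respectively. -/
noncomputable def image (s : Surgery D D') (ν : D.Orientation) : D'.Space :=
  if D'.numComponents < D.numComponents then s.merge ν
  else if D.numComponents < D'.numComponents then s.split ν
  else s.reconnect ν

/-- The surgery map `surg_{D,D'}`. -/
noncomputable def surg (s : Surgery D D') : D.Space →ₗ[ℂ] D'.Space :=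
  Finsupp.linearCombination ℂ s.image

end Surgery

end StackedDiagram

end TypeDKhovanov

/-!
Write `V(D)` for the space spanned by the orientations of `D`. The surgery maps are compared by means
of a module structure: for each vertex `x` let `turn D x` be the operator on `V(D)` which makes the
circle through `x` clockwise, multiplied by the sign of `x` (and which is zero if this circle is
clockwise already, or if `x` lies on a line). These operators commute, and the orientation
`basisVec D ∅` without clockwise circles generates `V(D)` under them (`lhom_ext_turn`). Every surgery
map commutes with the operators `turn` (`Surgery.surg_turn`), so it suffices to compare the two
composites on `basisVec D ∅`. A merge sends this vector to `basisVec E ∅`, a split sends it to its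
image under an operator `splitOp`, which is up to sign the sum or the difference of two operators
`turn`, and a reconnection sends it to `basisVec E ∅` or to zero.

Two surgeries from `D` with a common continuation either coincide or take place at different cups. In
the latter case they form a commuting square (`Square`), in which each of the four steps is a merge, a
split or a reconnection (`Surgery.trichotomy`). Comparing the numbers of components leaves 19 of the
81 combinations of types. Most of them follow from the topology of the square; what remains is to show
that two signs agree when the two splits in a square replace different cups. By `splitOp_eq_loop` such
a sign is a *twisted label* `p(x) + ν(x)` modulo two. Twisted labels are constant along arcs without
dots. They are controlled by a planarity argument: if `S` is a union of components, then the parity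
`leftCount S x` of the number of vertices of `S` to the left of `x` on the same level is constant along
each component not in `S`, and if it is odd, then this component carries no dots, since dotted arcs can
be joined to the left boundary (`leftCount_conn`). The same argument shows that all tags of a circle
carry the same label (`IsOrientation.lab_tag`), and that two propagating lines lie side by side
(`leftCount_add_of_propagates`).

Topologically, a stacked diagram is encoded by an involution `mate` on half-edges: each vertex has an
upper and a lower half-edge, and half-edges at the boundary are fixed. A surgery is a saddle move
exchanging two edges (`HalfEdge.Saddle`), and its effect on the components is found by cutting both
edges.
-/

namespace TypeDKhovanov

/-! ### Parity of sums along a cup diagram -/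

/-- The indicator of a proposition, as an element of `ZMod 2`. -/
noncomputable def ind (p : Prop) : ZMod 2 := open Classical in if p then 1 else 0

@[simp] theorem ind_of_true {p : Prop} (h : p) : ind p = 1 := by simp [ind, h]

@[simp] theorem ind_of_false {p : Prop} (h : ¬ p) : ind p = 0 := by simp [ind, h]

theorem ind_eq_zero {p : Prop} : ind p = 0 ↔ ¬ p := by
  by_cases h : p <;> simp [h]

theorem ind_inj {p q : Prop} : ind p = ind q ↔ (p ↔ q) := by
  by_cases h : p <;> by_cases h' : q <;> simp [h, h']

theorem ind_not (p : Prop) : ind (¬ p) = ind p + 1 := by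
  by_cases h : p
  · simp [h]; decide
  · simp [h]

theorem zmod_two_cases (u : ZMod 2) : u = 0 ∨ u = 1 := by
  revert u; decide

theorem zmod_two_add_self (u : ZMod 2) : u + u = 0 := by
  revert u; decide

theorem zmod_two_ne_zero {u : ZMod 2} : u ≠ 0 ↔ u = 1 := by
  revert u; decide

theorem zmod_two_add_eq_zero {u v : ZMod 2} : u + v = 0 ↔ u = v := by
  revert u v; decide

namespace CupDiagram

variable {V : Type} [LinearOrder V] (c : CupDiagram V)

theorem partner_ne {i : V} (hi : c.partner i ≠ i) : c.partner (c.partner i) ≠ c.partner i := by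
  rw [c.partner_partner]; exact hi.symm

/-- A sum of a function which is constant on cups over a set of vertices consisting of pairs of
end points of cups vanishes modulo two. -/
theorem sum_pairs (f : V → ZMod 2) (A : Finset V)
    (hA : ∀ k ∈ A, c.partner k ∈ A ∧ c.partner k ≠ k ∧ f (c.partner k) = f k) :
    ∑ k ∈ A, f k = 0 :=
  Finset.sum_involution (fun k _ => c.partner k)
    (fun k hk => by rw [(hA k hk).2.2]; exact zmod_two_add_self _)
    (fun k hk _ => (hA k hk).2.1) (fun k hk => (hA k hk).1) (fun k _ => c.partner_partner k)

/-- The vertices enclosed by a cup form pairs, so only the left end of the cup contributes to the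
difference of the sums up to its two ends. -/
theorem sum_lt_partner [Fintype V] (f : V → ZMod 2) (i : V) (hi : i < c.partner i)
    (hf : ∀ k, i < k → k < c.partner i → f (c.partner k) = f k) :
    ∑ k with k < c.partner i, f k = ∑ k with k < i, f k + f i := by
  have h1 : (Finset.univ.filter fun k => k < c.partner i) =
      (insert i (Finset.univ.filter fun k => k < i)) ∪
        Finset.univ.filter fun k => i < k ∧ k < c.partner i := by
    ext k
    simp only [Finset.mem_filter, Finset.mem_univ, true_and, Finset.mem_union, Finset.mem_insert]
    constructor
    · intro hk
      rcases lt_trichotomy k i with h | h | h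
      · exact Or.inl (Or.inr h)
      · exact Or.inl (Or.inl h)
      · exact Or.inr ⟨h, hk⟩
    · rintro ((h | h) | h)
      · exact h ▸ hi
      · exact h.trans hi
      · exact h.2
  rw [h1, Finset.sum_union, Finset.sum_insert (by simp),
    c.sum_pairs f (Finset.univ.filter fun k => i < k ∧ k < c.partner i), add_zero, add_comm]
  · intro k hk
    simp only [Finset.mem_filter, Finset.mem_univ, true_and] at hk ⊢
    have := c.noncrossing i k hk.1 hk.2
    exact ⟨this.2, this.1, hf k hk.1 hk.2⟩
  · rw [Finset.disjoint_left]
    intro k hk hk'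
    simp only [Finset.mem_filter, Finset.mem_univ, true_and, Finset.mem_insert] at hk hk'
    rcases hk with h | h
    · exact absurd hk'.1 (by rw [h]; exact lt_irrefl _)
    · exact absurd hk'.1 h.not_gt

theorem partner_lt_of_ray {i k : V} (hi : c.partner i = i) (hk : k < i) : c.partner k < i := by
  by_contra hcon
  rcases (not_lt.1 hcon).lt_or_eq with h | h
  · exact (c.noncrossing k i hk h).1 hi
  · have := congrArg c.partner h
    rw [hi, c.partner_partner] at this
    exact hk.ne this.symm

/-- The functions `f` and `g` describe two levels joined by internal rays: the vertices to the left
of a ray lie on cups to the left of it or on rays. -/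
theorem sum_lt_ray [Fintype V] (f g : V → ZMod 2) (i : V) (hi : c.partner i = i)
    (hf : ∀ k < i, c.partner k ≠ k → f (c.partner k) = f k)
    (hg : ∀ k < i, c.partner k ≠ k → g (c.partner k) = g k)
    (hfg : ∀ k < i, c.partner k = k → f k = g k) :
    ∑ k with k < i, f k = ∑ k with k < i, g k := by
  have key : ∀ f : V → ZMod 2, (∀ k < i, c.partner k ≠ k → f (c.partner k) = f k) →
      ∑ k with k < i, f k = ∑ k with k < i ∧ c.partner k = k, f k := by
    intro f hf
    rw [← Finset.sum_filter_add_sum_filter_not (Finset.univ.filter fun k => k < i)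
      (fun k => c.partner k = k), Finset.filter_filter, c.sum_pairs f (Finset.filter (fun k => ¬ c.partner k = k) _), add_zero]
    intro k hk
    simp only [Finset.mem_filter, Finset.mem_univ, true_and] at hk ⊢
    exact ⟨⟨c.partner_lt_of_ray hi hk.1, c.partner_ne hk.2⟩, hk.2, hf k hk.1 hk.2⟩
  rw [key f hf, key g hg]
  refine Finset.sum_congr rfl fun k hk => ?_
  simp only [Finset.mem_filter, Finset.mem_univ, true_and] at hk
  exact hfg k hk.1 hk.2

/-- By admissibility, all vertices to the left of a dotted arc lie on cups to the left of it. -/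
theorem sum_lt_dotted [Fintype V] (f : V → ZMod 2) (i : V) (hd : c.dotted i = true)
    (hi : i ≤ c.partner i) (hf : ∀ k < i, f (c.partner k) = f k) :
    ∑ k with k < i, f k = 0 := by
  refine c.sum_pairs f _ fun k hk => ?_
  simp only [Finset.mem_filter, Finset.mem_univ, true_and] at hk ⊢
  have := c.admissible i k hd hi hk
  exact ⟨this.2, this.1, hf k hk⟩

theorem sum_univ_eq_sum_rays [Fintype V] (f : V → ZMod 2)
    (hf : ∀ k, c.partner k ≠ k → f (c.partner k) = f k) :
    ∑ k, f k = ∑ k with c.partner k = k, f k := by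
  rw [← Finset.sum_filter_add_sum_filter_not Finset.univ (fun k => c.partner k = k),
    c.sum_pairs f (Finset.filter (fun k => ¬ c.partner k = k) _), add_zero]
  intro k hk
  simp only [Finset.mem_filter, Finset.mem_univ, true_and] at hk ⊢
  exact ⟨c.partner_ne hk, hk, hf k hk⟩

end CupDiagram

/-! ### Weights as functions to `ZMod 2` -/

noncomputable instance (Λ : Block) : Fintype Λ.Vertex := Fintype.ofFinite _

section Weight

variable {Λ : Block}

/-- The label of a vertex as an element of `ZMod 2`: `1` for `∧` and `0` for `∨`. -/
noncomputable def Block.Weight.lab (lam : Λ.Weight) (i : Λ.Vertex) : ZMod 2 := ind (lam.Up i)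

theorem Block.Weight.sum_lab (lam : Λ.Weight) : ∑ i, lam.lab i = Λ.parity := by
  classical
  rw [← lam.parity_eq]
  have h1 : {i | lam.label i = WeightSymbol.up} =
      ((Finset.univ.filter fun i => lam.Up i).map (Function.Embedding.subtype _) :
        Finset ℕ+) := by
    ext i
    simp only [Set.mem_ofPred_eq, Finset.coe_map, Set.mem_image, Finset.mem_coe, Finset.mem_filter,
      Finset.mem_univ, true_and, Function.Embedding.subtype_apply]
    constructor
    · intro hi
      exact ⟨⟨i, (lam.diamond_iff i).1 (Or.inl hi)⟩, hi, rfl⟩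
    · rintro ⟨j, hj, rfl⟩
      exact hj
  rw [h1, Set.ncard_coe_finset, Finset.card_map, Finset.card_filter]
  push_cast
  rfl

theorem Block.Weight.ext_lab {lam mu : Λ.Weight} (hl : ∀ i, lam.lab i = mu.lab i) : lam = mu := by
  have hlab : lam.label = mu.label := by
    funext i
    have h1 := lam.diamond_iff i
    have h2 := mu.diamond_iff i
    have h3 := lam.cross_iff i
    have h4 := mu.cross_iff i
    have h5 := lam.nought_iff i
    have h6 := mu.nought_iff i
    have h7 : ∀ hi : Λ.symb i = BlockSymbol.diamond,
        (lam.label i = WeightSymbol.up ↔ mu.label i = WeightSymbol.up) := fun hi =>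
      ind_inj.1 (hl ⟨i, hi⟩)
    cases hs : Λ.symb i <;> rw [hs] at h1 h2 h3 h4 h5 h6 h7
    · rw [h3.2 rfl, h4.2 rfl]
    · rw [h5.2 rfl, h6.2 rfl]
    · have h8 := h1.2 rfl
      have h9 := h2.2 rfl
      have h10 := h7 rfl
      rcases h8 with h8 | h8
      · rw [h8, h10.1 h8]
      · rcases h9 with h9 | h9
        · rw [h9, h10.2 h9]
        · rw [h8, h9]
  cases lam; cases mu; cases hlab; rfl

/-- A labelling of the vertices with the parity of the block belongs to a weight. -/
theorem Block.exists_weight (f : Λ.Vertex → ZMod 2) (hf : ∑ i, f i = Λ.parity) :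
    ∃ lam : Λ.Weight, ∀ i, lam.lab i = f i := by
  classical
  let lb : ℕ+ → WeightSymbol := fun i =>
    if hi : Λ.symb i = BlockSymbol.diamond then
      (if f ⟨i, hi⟩ = 1 then WeightSymbol.up else WeightSymbol.down)
    else if Λ.symb i = BlockSymbol.cross then WeightSymbol.cross else WeightSymbol.nought
  have hup : ∀ i : Λ.Vertex, lb i.1 = WeightSymbol.up ↔ f i = 1 := by
    intro i
    simp only [lb, i.2, dite_true]
    split_ifs with h1 <;> simp [h1]
  refine ⟨⟨lb, ?_, ?_, ?_, ?_⟩, ?_⟩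
  · intro i
    simp only [lb]
    split_ifs with h1 h2 h3 <;> simp [h1]
  · intro i
    simp only [lb]
    split_ifs with h1 h2 h3 <;> simp_all
  · intro i
    simp only [lb]
    split_ifs with h1 h2 h3
    · simp_all
    · simp_all
    · simp_all
    · cases hs : Λ.symb i <;> simp_all
  · have h1 : {i | lb i = WeightSymbol.up} =
        ((Finset.univ.filter fun i => f i = 1).map (Function.Embedding.subtype _) :
          Finset ℕ+) := by
      ext i
      simp only [Set.mem_ofPred_eq, Finset.coe_map, Set.mem_image, Finset.mem_coe, Finset.mem_filter,
        Finset.mem_univ, true_and, Function.Embedding.subtype_apply]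
      constructor
      · intro hi
        have hd : Λ.symb i = BlockSymbol.diamond := by
          by_contra hcon
          simp only [lb, hcon, dite_false] at hi
          split_ifs at hi
        exact ⟨⟨i, hd⟩, (hup ⟨i, hd⟩).1 hi, rfl⟩
      · rintro ⟨j, hj, rfl⟩
        exact (hup j).2 hj
    rw [h1, Set.ncard_coe_finset, Finset.card_map, Finset.card_filter, ← hf]
    push_cast
    refine Finset.sum_congr rfl fun i _ => ?_
    rcases zmod_two_cases (f i) with h2 | h2 <;> simp [h2]
  · intro i
    rcases zmod_two_cases (f i) with h2 | h2
    · rw [h2]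
      exact ind_of_false fun hc => by
        have := (hup i).1 hc
        rw [h2] at this; exact absurd this (by decide)
    · rw [h2]
      exact ind_of_true ((hup i).2 h2)

/-- Modulo two, `p(i)` is one more than the number of vertices to the left of `i`. -/
theorem Block.pos_eq (i : Λ.Vertex) : (Λ.pos i : ZMod 2) = ∑ k : Λ.Vertex with k < i, 1 + 1 := by
  have h1 : Λ.pos i = (Finset.univ.filter fun k : Λ.Vertex => k ≤ i).card := by
    rw [Block.pos, Nat.card_eq_fintype_card, Fintype.card_subtype]
  have h2 : (Finset.univ.filter fun k : Λ.Vertex => k ≤ i) =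
      insert i (Finset.univ.filter fun k => k < i) := by
    ext k; simp [le_iff_eq_or_lt]
  rw [h1, h2, Finset.card_insert_of_notMem (by simp)]
  simp

theorem CupDiagram.pos_partner (c : CupDiagram Λ.Vertex) (i : Λ.Vertex) (hi : c.partner i ≠ i) :
    (Λ.pos (c.partner i) : ZMod 2) = Λ.pos i + 1 := by
  have key : ∀ i, i < c.partner i → (Λ.pos (c.partner i) : ZMod 2) = Λ.pos i + 1 := by
    intro i hi
    rw [Block.pos_eq, Block.pos_eq, c.sum_lt_partner (fun _ => 1) i hi fun _ _ _ => rfl]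
  rcases hi.lt_or_gt with h1 | h1
  · have h2 := key (c.partner i) (by rwa [c.partner_partner])
    rw [c.partner_partner] at h2
    rw [h2, add_assoc, zmod_two_add_self, add_zero]
  · exact key i h1

end Weight

/-! ### Matchings of half-edges -/

namespace HalfEdge

variable {N : Type}

/-- The other half-edge at the same node. -/
def swap (e : N × Bool) : N × Bool := (e.1, !e.2)

theorem swap_swap (e : N × Bool) : swap (swap e) = e := by simp [swap]

/-- Every node `x` carries the two half-edges `(x, true)` and `(x, false)`; the map `σ` glues each
half-edge to another one, or leaves it free. `Conn σ` is the relation of lying on the same connected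
component of the resulting graph. -/
def Conn (σ : N × Bool → N × Bool) : N → N → Prop :=
  Relation.EqvGen fun x y => ∃ b, y = (σ (x, b)).1

theorem Conn.refl {σ : N × Bool → N × Bool} (x : N) : Conn σ x x := Relation.EqvGen.refl x

theorem Conn.symm {σ : N × Bool → N × Bool} {x y : N} (h : Conn σ x y) : Conn σ y x :=
  Relation.EqvGen.symm _ _ h

theorem Conn.trans {σ : N × Bool → N × Bool} {x y z : N} (h : Conn σ x y) (h' : Conn σ y z) :
    Conn σ x z :=
  Relation.EqvGen.trans _ _ _ h h'

theorem conn_mate (σ : N × Bool → N × Bool) (e : N × Bool) : Conn σ e.1 (σ e).1 :=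
  Relation.EqvGen.rel _ _ ⟨e.2, rfl⟩

theorem Conn.minimal {σ : N × Bool → N × Bool} {r : N → N → Prop} (hr : Equivalence r)
    (hσ : ∀ e, r e.1 (σ e).1) {x y : N} (h : Conn σ x y) : r x y := by
  induction h with
  | rel x y h => obtain ⟨b, rfl⟩ := h; exact hσ (x, b)
  | refl x => exact hr.refl x
  | symm x y _ ih => exact hr.symm ih
  | trans x y z _ _ ih1 ih2 => exact hr.trans ih1 ih2

theorem Conn.saturated {σ : N × Bool → N × Bool} {p : N → Prop} (hp : ∀ e, p e.1 ↔ p (σ e).1)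
    {x y : N} (h : Conn σ x y) : p x ↔ p y :=
  h.minimal (r := fun x y => p x ↔ p y) ⟨fun _ => Iff.rfl, Iff.symm, Iff.trans⟩ hp

/-- The component of `x` is a line: it contains a free half-edge. -/
def IsLine (σ : N × Bool → N × Bool) (x : N) : Prop := ∃ e, σ e = e ∧ Conn σ x e.1

/-- `σ` is a partial matching of the half-edges, and the charge `ω` orients the resulting
one-dimensional manifold: it takes different values on the two half-edges at a node and on the two
halves of an edge. -/
structure IsMating (σ : N × Bool → N × Bool) (ω : N × Bool → ZMod 2) : Prop where
  invol : ∀ e, σ (σ e) = e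
  charge_swap : ∀ e, ω (swap e) = ω e + 1
  charge : ∀ e, σ e ≠ e → ω (σ e) = ω e + 1

variable {σ σ' : N × Bool → N × Bool} {ω : N × Bool → ZMod 2} {a b c d : N × Bool}

/-- Walking from a free half-edge reaches all half-edges of its component. The walk is given by the
permutation `π = σ ∘ swap`, which `σ` inverts by conjugation. -/
theorem IsMating.exists_zpow (hσ : IsMating σ ω) {e : N × Bool} (he : σ e = e) :
    ∃ π : Equiv.Perm (N × Bool), (∀ k : ℤ, σ ((π ^ k) e) = (π ^ (-k)) e) ∧
      ∀ f : N × Bool, Conn σ e.1 f.1 → ∃ k : ℤ, f = (π ^ k) e := by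
  let s : Equiv.Perm (N × Bool) := Function.Involutive.toPerm σ hσ.invol
  let t : Equiv.Perm (N × Bool) := Function.Involutive.toPerm swap swap_swap
  have hss : s * s = 1 := by ext1 x; exact hσ.invol x
  have htt : t * t = 1 := by ext1 x; exact swap_swap x
  have hinv : (s * t)⁻¹ = t * s := by
    rw [inv_eq_iff_mul_eq_one, mul_assoc, ← mul_assoc t t s, htt, one_mul, hss]
  have hconj : ∀ k : ℤ, s * (s * t) ^ k * s = (s * t) ^ (-k) := by
    intro k
    have h1 : s⁻¹ = s := by rw [inv_eq_iff_mul_eq_one, hss]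
    have h2 : s * (s * t) ^ k * s = (s * (s * t) * s⁻¹) ^ k := by
      rw [conj_zpow, h1]
    rw [h2, zpow_neg, ← inv_zpow, hinv, h1, ← mul_assoc s s t, hss, one_mul]
  have hs : ∀ k : ℤ, σ (((s * t) ^ k) e) = ((s * t) ^ (-k)) e := by
    intro k
    have := congrArg (fun g : Equiv.Perm (N × Bool) => g e) (hconj k)
    simp only [Equiv.Perm.mul_apply] at this
    rw [← this]
    change s (((s * t) ^ k) e) = s (((s * t) ^ k) (σ e))
    rw [he]
  have ht : ∀ k : ℤ, swap (((s * t) ^ k) e) = ((s * t) ^ (-(k + 1))) e := by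
    intro k
    rw [← hs, add_comm, zpow_add, zpow_one, Equiv.Perm.mul_apply, Equiv.Perm.mul_apply]
    exact (hσ.invol _).symm
  refine ⟨s * t, hs, ?_⟩
  intro f hf
  have hsat := hf.saturated (p := fun x => ∃ b, ∃ k : ℤ, (x, b) = ((s * t) ^ k) e) (by
    have key : ∀ f : N × Bool, (∃ b, ∃ k : ℤ, (f.1, b) = ((s * t) ^ k) e) →
        ∃ k : ℤ, f = ((s * t) ^ k) e := by
      rintro ⟨x, b'⟩ ⟨b, k, hk⟩
      by_cases hb : b = b'
      · subst hb; exact ⟨k, hk⟩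
      · refine ⟨-(k + 1), ?_⟩
        rw [← ht, ← hk]
        simp only [swap, Prod.mk.injEq, true_and]
        cases b <;> cases b' <;> simp_all
    intro f
    constructor
    · intro h1
      obtain ⟨k, hk⟩ := key f h1
      refine ⟨(σ f).2, -k, ?_⟩
      rw [← hs, ← hk]
    · intro h1
      obtain ⟨k, hk⟩ := key (σ f) h1
      refine ⟨f.2, -k, ?_⟩
      rw [← hs, ← hk, hσ.invol])
  obtain ⟨b, k, hk⟩ := hsat.1 ⟨e.2, 0, rfl⟩
  by_cases hb : b = f.2
  · subst hb; exact ⟨k, hk⟩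
  · refine ⟨-(k + 1), ?_⟩
    rw [← ht, ← hk]
    obtain ⟨x, b'⟩ := f
    simp only [swap, Prod.mk.injEq, true_and]
    cases b <;> cases b' <;> simp_all

/-- A component has at most two free half-edges: if `f = π^k e` and `g = π^m e` are free, then `2k`
and `2m` are multiples of the period of `e`, and so is `k - m` unless `f` or `g` is `e`. -/
theorem IsMating.unique_end (hσ : IsMating σ ω) {e f g : N × Bool} (he : σ e = e) (hf : σ f = f)
    (hg : σ g = g) (hef : Conn σ e.1 f.1) (heg : Conn σ e.1 g.1) (hfe : f ≠ e) (hge : g ≠ e) :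
    f = g := by
  obtain ⟨π, h1, h2⟩ := hσ.exists_zpow he
  obtain ⟨k, rfl⟩ := h2 f hef
  obtain ⟨m, rfl⟩ := h2 g heg
  have hper : ∀ k : ℤ, (π ^ k) e = e ↔ (MulAction.period π e : ℤ) ∣ k := fun k =>
    MulAction.zpow_smul_eq_iff_period_dvd (j := k) (g := π) (a := e)
  have htwo : ∀ k : ℤ, σ ((π ^ k) e) = (π ^ k) e → (MulAction.period π e : ℤ) ∣ 2 * k := by
    intro k hk
    rw [h1] at hk
    rw [← hper, two_mul, zpow_add, Equiv.Perm.mul_apply, ← hk, ← Equiv.Perm.mul_apply,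
      ← zpow_add, add_neg_cancel, zpow_zero, Equiv.Perm.one_apply]
  obtain ⟨x, hx⟩ := htwo k hf
  obtain ⟨y, hy⟩ := htwo m hg
  have hfe' := mt (hper k).2 hfe
  have hge' := mt (hper m).2 hge
  set n : ℤ := (MulAction.period π e : ℤ)
  -- Here `2 * k = n * x` and `2 * m = n * y`, where `n` does not divide `k` or `m`.
  have hxo : ¬ Even x := by
    rintro ⟨z, rfl⟩
    exact hfe' ⟨z, by linarith⟩
  have hyo : ¬ Even y := by
    rintro ⟨z, rfl⟩
    exact hge' ⟨z, by linarith⟩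
  obtain ⟨z, hz⟩ := (Int.not_even_iff_odd.1 hxo).sub_odd (Int.not_even_iff_odd.1 hyo)
  have h3 : n ∣ k - m := ⟨z, by
    have : 2 * (k - m) = n * (x - y) := by linarith
    rw [hz] at this
    linarith⟩
  have h4 := (hper (k - m)).2 h3
  calc (π ^ k) e = (π ^ m) ((π ^ (k - m)) e) := by
        rw [← Equiv.Perm.mul_apply, ← zpow_add]; congr 2; ring
    _ = (π ^ m) e := by rw [h4]

/-- A component with a free half-edge has another one, of the opposite charge: the sum of the signs
given by the charge over all half-edges of the component vanishes. -/
theorem IsMating.exists_end [Finite N] (hσ : IsMating σ ω) {e : N × Bool} (he : σ e = e) :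
    ∃ f, σ f = f ∧ Conn σ e.1 f.1 ∧ ω f = ω e + 1 := by
  classical
  have := Fintype.ofFinite N
  by_contra! hcon
  let K : Finset (N × Bool) := Finset.univ.filter fun f => Conn σ e.1 f.1
  let χ : ZMod 2 → ℤ := fun u => if u = 0 then 1 else -1
  have hχ : ∀ u, χ u + χ (u + 1) = 0 := by decide
  have hχ0 : ∀ u, χ u ≠ 0 := by decide
  have hK : ∀ f, f ∈ K ↔ Conn σ e.1 f.1 := fun f => by simp [K]
  -- The half-edges of the component cancel in pairs under `swap`, and those which are not free cancel
  -- in pairs under `σ`.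
  have h1 : ∑ f ∈ K, χ (ω f) = 0 :=
    Finset.sum_involution (fun f _ => swap f)
      (fun f _ => by rw [hσ.charge_swap]; exact hχ _)
      (fun f _ _ h => by simpa [swap] using congrArg Prod.snd h)
      (fun f hf => by rw [hK] at hf ⊢; exact hf) (fun f _ => swap_swap f)
  have h2 : ∑ f ∈ K with ¬ σ f = f, χ (ω f) = 0 :=
    Finset.sum_involution (fun f _ => σ f)
      (fun f hf => by
        rw [hσ.charge f (Finset.mem_filter.1 hf).2]; exact hχ _)
      (fun f hf _ => (Finset.mem_filter.1 hf).2)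
      (fun f hf => by
        rw [Finset.mem_filter, hK] at hf ⊢
        refine ⟨hf.1.trans (conn_mate σ f), ?_⟩
        rw [hσ.invol]; exact fun h => hf.2 h.symm)
      (fun f _ => hσ.invol f)
  rw [← Finset.sum_filter_add_sum_filter_not K (fun f => σ f = f), h2, add_zero] at h1
  have h3 : ∑ f ∈ K with σ f = f, χ (ω f) = ∑ f ∈ K with σ f = f, χ (ω e) := by
    refine Finset.sum_congr rfl fun f hf => ?_
    rw [Finset.mem_filter, hK] at hf
    have := hcon f hf.2 hf.1
    rw [show ω f = ω e by revert this; generalize ω f = u; generalize ω e = v; revert u v; decide]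
  rw [h3, Finset.sum_const, smul_eq_zero] at h1
  rcases h1 with h1 | h1
  · rw [Finset.card_eq_zero] at h1
    have : e ∈ K.filter fun f => σ f = f := by
      rw [Finset.mem_filter, hK]; exact ⟨Conn.refl _, he⟩
    rw [h1] at this
    exact absurd this (Finset.notMem_empty _)
  · exact hχ0 _ h1

/-! ### Saddle moves -/

/-- `σ'` arises from `σ` by a saddle move: the edges `a b` and `c d` are replaced by the edges
`a c` and `b d`. -/
structure Saddle (σ σ' : N × Bool → N × Bool) (ω : N × Bool → ZMod 2) (a b c d : N × Bool) :
    Prop where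
  mating : IsMating σ ω
  mating' : IsMating σ' ω
  ab : σ a = b
  cd : σ c = d
  ac : σ' a = c
  bd : σ' b = d
  ne_ab : a ≠ b
  ne_ac : a ≠ c
  ne_ad : a ≠ d
  ne_bc : b ≠ c
  ne_bd : b ≠ d
  ne_cd : c ≠ d
  agree : ∀ e, e ≠ a → e ≠ b → e ≠ c → e ≠ d → σ' e = σ e

theorem Saddle.symm (h : Saddle σ σ' ω a b c d) : Saddle σ' σ ω a c b d :=
  ⟨h.mating', h.mating, h.ac, h.bd, h.ab, h.cd, h.ne_ac, h.ne_ab, h.ne_ad, h.ne_bc.symm, h.ne_cd,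
    h.ne_bd, fun e h1 h2 h3 h4 => (h.agree e h1 h3 h2 h4).symm⟩

theorem Saddle.rot (h : Saddle σ σ' ω a b c d) : Saddle σ σ' ω c d a b :=
  ⟨h.mating, h.mating', h.cd, h.ab, by rw [← h.ac, h.mating'.invol],
    by rw [← h.bd, h.mating'.invol], h.ne_cd, h.ne_ac.symm, h.ne_bc.symm, h.ne_ad.symm,
    h.ne_bd.symm, h.ne_ab, fun e h1 h2 h3 h4 => h.agree e h3 h4 h1 h2⟩

open Classical in
/-- The graph in which both edges of a saddle move are cut. -/
noncomputable def cut (σ : N × Bool → N × Bool) (a b c d : N × Bool) (e : N × Bool) : N × Bool :=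
  if e = a ∨ e = b ∨ e = c ∨ e = d then e else σ e

theorem cut_of_mem {e : N × Bool} (h : e = a ∨ e = b ∨ e = c ∨ e = d) : cut σ a b c d e = e :=
  if_pos h

theorem cut_of_notMem {e : N × Bool} (h : ¬ (e = a ∨ e = b ∨ e = c ∨ e = d)) :
    cut σ a b c d e = σ e :=
  if_neg h

theorem Saddle.cut_symm (h : Saddle σ σ' ω a b c d) : cut σ' a c b d = cut σ a b c d := by
  funext e
  by_cases he : e = a ∨ e = b ∨ e = c ∨ e = d
  · rw [cut_of_mem he, cut_of_mem (by tauto)]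
  · rw [cut_of_notMem he, cut_of_notMem (by tauto)]
    push Not at he
    exact h.agree e he.1 he.2.1 he.2.2.1 he.2.2.2

theorem cut_rot : cut σ c d a b = cut σ a b c d := by
  funext e
  by_cases he : e = a ∨ e = b ∨ e = c ∨ e = d
  · rw [cut_of_mem he, cut_of_mem (by tauto)]
  · rw [cut_of_notMem he, cut_of_notMem (by tauto)]

theorem Saddle.ba (h : Saddle σ σ' ω a b c d) : σ b = a := by rw [← h.ab, h.mating.invol]

theorem Saddle.dc (h : Saddle σ σ' ω a b c d) : σ d = c := by rw [← h.cd, h.mating.invol]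

theorem Saddle.mating_cut (h : Saddle σ σ' ω a b c d) : IsMating (cut σ a b c d) ω := by
  have hcases : ∀ e, ¬ (e = a ∨ e = b ∨ e = c ∨ e = d) →
      ¬ (σ e = a ∨ σ e = b ∨ σ e = c ∨ σ e = d) := by
    intro e he hcon
    rcases hcon with h1 | h1 | h1 | h1 <;> have h2 := congrArg σ h1 <;>
      rw [h.mating.invol] at h2
    · rw [h.ab] at h2; tauto
    · rw [h.ba] at h2; tauto
    · rw [h.cd] at h2; tauto
    · rw [h.dc] at h2; tauto
  refine ⟨fun e => ?_, h.mating.charge_swap, fun e he => ?_⟩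
  · by_cases h1 : e = a ∨ e = b ∨ e = c ∨ e = d
    · rw [cut_of_mem h1, cut_of_mem h1]
    · rw [cut_of_notMem h1, cut_of_notMem (hcases e h1), h.mating.invol]
  · by_cases h1 : e = a ∨ e = b ∨ e = c ∨ e = d
    · exact absurd (cut_of_mem h1) he
    · rw [cut_of_notMem h1] at he ⊢
      exact h.mating.charge e he

theorem Saddle.conn_of_cut (_ : Saddle σ σ' ω a b c d) {x y : N}
    (hxy : Conn (cut σ a b c d) x y) : Conn σ x y := by
  refine hxy.minimal ⟨Conn.refl, Conn.symm, Conn.trans⟩ fun e => ?_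
  by_cases h1 : e = a ∨ e = b ∨ e = c ∨ e = d
  · rw [cut_of_mem h1]; exact Conn.refl _
  · rw [cut_of_notMem h1]; exact conn_mate σ e

theorem Saddle.conn_of_cut' (h : Saddle σ σ' ω a b c d) {x y : N}
    (hxy : Conn (cut σ a b c d) x y) : Conn σ' x y :=
  h.symm.conn_of_cut (by rwa [h.cut_symm])

theorem Saddle.conn_ab (h : Saddle σ σ' ω a b c d) : Conn σ a.1 b.1 := by
  rw [← h.ab]; exact conn_mate σ a

theorem Saddle.conn_cd (h : Saddle σ σ' ω a b c d) : Conn σ c.1 d.1 := h.rot.conn_ab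

theorem Saddle.conn_ac (h : Saddle σ σ' ω a b c d) : Conn σ' a.1 c.1 := h.symm.conn_ab

theorem Saddle.conn_bd (h : Saddle σ σ' ω a b c d) : Conn σ' b.1 d.1 := h.symm.conn_cd

/-- An equivalence relation contains `Conn σ` if it contains the cut graph and the two edges. -/
theorem Saddle.minimal (h : Saddle σ σ' ω a b c d) {r : N → N → Prop} (hr : Equivalence r)
    (h0 : ∀ x y, Conn (cut σ a b c d) x y → r x y) (hab : r a.1 b.1) (hcd : r c.1 d.1) {x y : N}
    (hxy : Conn σ x y) : r x y := by
  refine hxy.minimal hr fun e => ?_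
  by_cases h1 : e = a ∨ e = b ∨ e = c ∨ e = d
  · rcases h1 with rfl | rfl | rfl | rfl
    · rw [h.ab]; exact hab
    · rw [h.ba]; exact hr.symm hab
    · rw [h.cd]; exact hcd
    · rw [h.dc]; exact hr.symm hcd
  · rw [← cut_of_notMem (σ := σ) h1]
    exact h0 _ _ (conn_mate _ e)

theorem Saddle.saturated (h : Saddle σ σ' ω a b c d) {p : N → Prop}
    (h0 : ∀ x y, Conn (cut σ a b c d) x y → (p x ↔ p y)) (hab : p a.1 ↔ p b.1)
    (hcd : p c.1 ↔ p d.1) {x y : N} (hxy : Conn σ x y) : p x ↔ p y :=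
  h.minimal (r := fun x y => p x ↔ p y) ⟨fun _ => Iff.rfl, Iff.symm, Iff.trans⟩ h0 hab hcd hxy

theorem Saddle.mate_eq_iff (h : Saddle σ σ' ω a b c d) (e : N × Bool) : σ' e = e ↔ σ e = e := by
  by_cases he : e = a ∨ e = b ∨ e = c ∨ e = d
  · rcases he with rfl | rfl | rfl | rfl
    · rw [h.ab, h.ac]; exact ⟨fun h1 => absurd h1.symm h.ne_ac, fun h1 => absurd h1.symm h.ne_ab⟩
    · rw [h.ba, h.bd]; exact ⟨fun h1 => absurd h1.symm h.ne_bd, fun h1 => absurd h1 h.ne_ab⟩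
    · rw [h.cd, h.rot.ac]; exact ⟨fun h1 => absurd h1 h.ne_ac, fun h1 => absurd h1.symm h.ne_cd⟩
    · rw [h.dc, h.rot.bd]; exact ⟨fun h1 => absurd h1 h.ne_bd, fun h1 => absurd h1 h.ne_cd⟩
  · push Not at he
    rw [h.agree e he.1 he.2.1 he.2.2.1 he.2.2.2]

/-- In terms of the relations `C`, `C'` of being connected before and after a saddle move and of the
predicate `L` of lying on a line: the distinct components of `a` and `c`, at least one of which is a
circle, are merged. -/
structure IsMerge (C C' : N → N → Prop) (L : N → Prop) (a c : N) : Prop where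
  ne : ¬ C a c
  iff : ∀ x y, C' x y ↔ C x y ∨ (C x a ∨ C x c) ∧ (C y a ∨ C y c)
  circle : ¬ L a ∨ ¬ L c

theorem IsMerge.symm {C C' : N → N → Prop} {L : N → Prop} {a c : N} (hm : IsMerge C C' L a c)
    (hC : ∀ x y, C x y → C y x) : IsMerge C C' L c a :=
  ⟨fun h => hm.ne (hC _ _ h), fun x y => by rw [hm.iff x y, or_comm (a := C x a),
    or_comm (a := C y a)], hm.circle.symm⟩

/-- The lines through `a` and `c` are replaced by the lines through `a` and `b`. -/
structure IsReconnect (C C' : N → N → Prop) (L L' : N → Prop) (a b c : N) : Prop where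
  ne : ¬ C a c
  ne' : ¬ C' a b
  line_a : L a
  line_c : L c
  line_a' : L' a
  line_b' : L' b
  mem : ∀ x, C x a ∨ C x c ↔ C' x a ∨ C' x b
  off : ∀ x y, ¬ (C x a ∨ C x c) → (C x y ↔ C' x y)

/-- A component of the cut graph has at most two free half-edges. -/
theorem Saddle.cut_free (h : Saddle σ σ' ω a b c d) {e f g : N × Bool}
    (he : cut σ a b c d e = e) (hf : cut σ a b c d f = f) (hg : cut σ a b c d g = g)
    (hef : Conn (cut σ a b c d) e.1 f.1) (heg : Conn (cut σ a b c d) e.1 g.1) (hfe : f ≠ e)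
    (hge : g ≠ e) : f = g :=
  h.mating_cut.unique_end he hf hg hef heg hfe hge

/-- If `a` and `b` remain connected after the edge joining them is cut, then they belong to a
circle, which is merged with the component of `c`. -/
theorem Saddle.merge_of_conn [Finite N] (h : Saddle σ σ' ω a b c d)
    (hab : Conn (cut σ a b c d) a.1 b.1) :
    IsMerge (Conn σ) (Conn σ') (IsLine σ) a.1 c.1 := by
  have hac : ¬ Conn (cut σ a b c d) a.1 c.1 := fun hac =>
    h.ne_bc (h.cut_free (cut_of_mem (by tauto)) (cut_of_mem (by tauto)) (cut_of_mem (by tauto))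
      hab hac h.ne_ab.symm h.ne_ac.symm)
  have had : ¬ Conn (cut σ a b c d) a.1 d.1 := fun had =>
    h.ne_bd (h.cut_free (cut_of_mem (by tauto)) (cut_of_mem (by tauto)) (cut_of_mem (by tauto))
      hab had h.ne_ab.symm h.ne_ad.symm)
  have hcomp : ∀ x, Conn σ a.1 x → Conn (cut σ a b c d) a.1 x := by
    intro x hx
    refine (h.saturated (p := fun y => Conn (cut σ a b c d) a.1 y) ?_ ?_ ?_ hx).1 (Conn.refl _)
    · exact fun y z hyz => ⟨fun h1 => h1.trans hyz, fun h1 => h1.trans hyz.symm⟩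
    · exact iff_of_true (Conn.refl _) hab
    · exact iff_of_false hac had
  have hmono : ∀ x y, Conn σ x y → Conn σ' x y := by
    intro x y hxy
    refine h.minimal ⟨Conn.refl, Conn.symm, Conn.trans⟩ (fun _ _ => h.conn_of_cut')
      (h.conn_of_cut' hab) ?_ hxy
    exact h.conn_ac.symm.trans ((h.conn_of_cut' hab).trans h.conn_bd)
  refine ⟨fun h1 => hac (hcomp _ h1), fun x y => ⟨fun hxy => ?_, fun hxy => ?_⟩, Or.inl ?_⟩
  · refine h.symm.minimal (r := fun x y => Conn σ x y ∨ (Conn σ x a.1 ∨ Conn σ x c.1) ∧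
      (Conn σ y a.1 ∨ Conn σ y c.1)) ⟨fun x => Or.inl (Conn.refl x), ?_, ?_⟩ ?_ ?_ ?_ hxy
    · rintro x y (h1 | ⟨h1, h2⟩)
      · exact Or.inl h1.symm
      · exact Or.inr ⟨h2, h1⟩
    · rintro x y z (h1 | ⟨h1, h2⟩) (h3 | ⟨h3, h4⟩)
      · exact Or.inl (h1.trans h3)
      · exact Or.inr ⟨h3.imp h1.trans h1.trans, h4⟩
      · exact Or.inr ⟨h1, h2.imp h3.symm.trans h3.symm.trans⟩
      · exact Or.inr ⟨h1, h4⟩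
    · intro x y h1
      rw [h.cut_symm] at h1
      exact Or.inl (h.conn_of_cut h1)
    · exact Or.inr ⟨Or.inl (Conn.refl _), Or.inr (Conn.refl _)⟩
    · exact Or.inr ⟨Or.inl h.conn_ab.symm, Or.inr h.conn_cd.symm⟩
  · rcases hxy with h1 | ⟨h1, h2⟩
    · exact hmono _ _ h1
    · have h3 : ∀ x, Conn σ x a.1 ∨ Conn σ x c.1 → Conn σ' x a.1 := by
        rintro x (h4 | h4)
        · exact hmono _ _ h4
        · exact (hmono _ _ h4).trans h.conn_ac.symm
      exact (h3 x h1).trans (h3 y h2).symm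
  · rintro ⟨e, he, hae⟩
    have h1 := hcomp _ hae
    have h2 : ¬ (e = a ∨ e = b ∨ e = c ∨ e = d) := by
      rintro (rfl | rfl | rfl | rfl)
      · exact h.ne_ab (he.symm.trans h.ab)
      · exact h.ne_ab (h.ba.symm.trans he)
      · exact h.ne_cd (he.symm.trans h.cd)
      · exact h.ne_cd (h.dc.symm.trans he)
    have h3 : b = e := h.cut_free (cut_of_mem (by tauto)) (cut_of_mem (by tauto))
      (by rw [cut_of_notMem h2, he]) hab h1 h.ne_ab.symm (by tauto)
    tauto

/-- The components before a saddle move if the four half-edges lie on different components of the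
cut graph. -/
theorem Saddle.conn_iff (h : Saddle σ σ' ω a b c d)
    (hac : ¬ Conn (cut σ a b c d) a.1 c.1) (had : ¬ Conn (cut σ a b c d) a.1 d.1)
    (hbc : ¬ Conn (cut σ a b c d) b.1 c.1) (hbd : ¬ Conn (cut σ a b c d) b.1 d.1) (x : N) :
    Conn σ a.1 x ↔ Conn (cut σ a b c d) a.1 x ∨ Conn (cut σ a b c d) b.1 x := by
  constructor
  · intro hx
    refine (h.saturated (p := fun y => Conn (cut σ a b c d) a.1 y ∨ Conn (cut σ a b c d) b.1 y)
      ?_ ?_ ?_ hx).1 (Or.inl (Conn.refl _))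
    · exact fun y z hyz => or_congr ⟨fun h1 => h1.trans hyz, fun h1 => h1.trans hyz.symm⟩
        ⟨fun h1 => h1.trans hyz, fun h1 => h1.trans hyz.symm⟩
    · exact iff_of_true (Or.inl (Conn.refl _)) (Or.inr (Conn.refl _))
    · exact iff_of_false (by tauto) (by tauto)
  · rintro (h1 | h1)
    · exact h.conn_of_cut h1
    · exact h.conn_ab.trans (h.conn_of_cut h1)

/-- On the component of one of the four half-edges of the cut graph there is another free half-edge
of the opposite charge. If it is not one of the four, then the component belongs to a line. -/
theorem Saddle.exists_partner [Finite N] (h : Saddle σ σ' ω a b c d) {e : N × Bool}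
    (he : e = a ∨ e = b ∨ e = c ∨ e = d) :
    (∃ f, (f = a ∨ f = b ∨ f = c ∨ f = d) ∧ f ≠ e ∧ Conn (cut σ a b c d) e.1 f.1 ∧ ω f = ω e + 1) ∨
      (IsLine σ e.1 ∧ IsLine σ' e.1) := by
  obtain ⟨f, hf, hef, hω⟩ := h.mating_cut.exists_end (cut_of_mem (σ := σ) he)
  by_cases hfm : f = a ∨ f = b ∨ f = c ∨ f = d
  · exact Or.inl ⟨f, hfm, fun h1 => by rw [h1] at hω; simp at hω, hef, hω⟩
  · rw [cut_of_notMem hfm] at hf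
    exact Or.inr ⟨⟨f, hf, h.conn_of_cut hef⟩, ⟨f, (h.mate_eq_iff f).2 hf, h.conn_of_cut' hef⟩⟩

/-- The half-edges `a` and `d` have the same charge, so they are not the two ends of a segment of
the cut graph. -/
theorem Saddle.not_cut_ad [Finite N] (h : Saddle σ σ' ω a b c d) :
    ¬ Conn (cut σ a b c d) a.1 d.1 := by
  intro had
  obtain ⟨f, hf, haf, hω⟩ := h.mating_cut.exists_end (cut_of_mem (σ := σ) (Or.inl rfl) :
    cut σ a b c d a = a)
  have h1 : f = d := h.cut_free (cut_of_mem (by tauto)) hf (cut_of_mem (by tauto)) haf had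
    (fun h1 => by rw [h1] at hω; simp at hω) h.ne_ad.symm
  have h2 : ω c = ω a + 1 := by
    rw [← h.ac]; exact h.mating'.charge a (by rw [h.ac]; exact h.ne_ac.symm)
  have h3 : ω d = ω c + 1 := by
    rw [← h.cd]; exact h.mating.charge c (by rw [h.cd]; exact h.ne_cd.symm)
  rw [h1, h3, h2] at hω
  revert hω
  generalize ω a = u
  revert u; decide

/-- A saddle move merges two components, splits a component, or reconnects two lines. -/
theorem Saddle.trichotomy [Finite N] (h : Saddle σ σ' ω a b c d) :
    IsMerge (Conn σ) (Conn σ') (IsLine σ) a.1 c.1 ∨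
      IsMerge (Conn σ') (Conn σ) (IsLine σ') a.1 b.1 ∨
      IsReconnect (Conn σ) (Conn σ') (IsLine σ) (IsLine σ') a.1 b.1 c.1 := by
  have had := h.not_cut_ad
  have hbc : ¬ Conn (cut σ a b c d) b.1 c.1 := fun h1 => by
    have := h.rot.not_cut_ad
    rw [cut_rot] at this
    exact this h1.symm
  by_cases hab : Conn (cut σ a b c d) a.1 b.1
  · exact Or.inl (h.merge_of_conn hab)
  by_cases hcd : Conn (cut σ a b c d) c.1 d.1
  · exact Or.inl ((h.rot.merge_of_conn (by rwa [cut_rot])).symm fun _ _ => Conn.symm)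
  by_cases hac : Conn (cut σ a b c d) a.1 c.1
  · exact Or.inr (Or.inl (h.symm.merge_of_conn (by rwa [h.cut_symm])))
  by_cases hbd : Conn (cut σ a b c d) b.1 d.1
  · exact Or.inr (Or.inl ((h.symm.rot.merge_of_conn (by rwa [cut_rot, h.cut_symm])).symm
      fun _ _ => Conn.symm))
  refine Or.inr (Or.inr ?_)
  -- In the remaining case the four half-edges lie on different components of the cut graph.
  have hline : ∀ e, (e = a ∨ e = b ∨ e = c ∨ e = d) → IsLine σ e.1 ∧ IsLine σ' e.1 := by
    intro e he
    rcases h.exists_partner he with ⟨f, hf, hfe, hef, -⟩ | h1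
    · exfalso
      rcases he with rfl | rfl | rfl | rfl <;> rcases hf with rfl | rfl | rfl | rfl <;>
        first
        | exact hfe rfl
        | exact hab hef
        | exact hab hef.symm
        | exact hac hef
        | exact hac hef.symm
        | exact had hef
        | exact had hef.symm
        | exact hbc hef
        | exact hbc hef.symm
        | exact hbd hef
        | exact hbd hef.symm
        | exact hcd hef
        | exact hcd hef.symm
    · exact h1
  have hA := h.conn_iff hac had hbc hbd
  have hC := h.rot.conn_iff (by rw [cut_rot]; exact fun h1 => hac h1.symm)
    (by rw [cut_rot]; exact fun h1 => hbc h1.symm) (by rw [cut_rot]; exact fun h1 => had h1.symm)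
    (by rw [cut_rot]; exact fun h1 => hbd h1.symm)
  rw [cut_rot] at hC
  have hA' := h.symm.conn_iff (by rw [h.cut_symm]; exact hab) (by rw [h.cut_symm]; exact had)
    (by rw [h.cut_symm]; exact fun h1 => hbc h1.symm) (by rw [h.cut_symm]; exact hcd)
  have hB' := h.symm.rot.conn_iff (by rw [cut_rot, h.cut_symm]; exact fun h1 => hab h1.symm)
    (by rw [cut_rot, h.cut_symm]; exact hbc)
    (by rw [cut_rot, h.cut_symm]; exact fun h1 => had h1.symm)
    (by rw [cut_rot, h.cut_symm]; exact fun h1 => hcd h1.symm)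
  rw [h.cut_symm] at hA'
  rw [cut_rot, h.cut_symm] at hB'
  have hsym : ∀ (ρ : N × Bool → N × Bool) (x y : N), Conn ρ x y ↔ Conn ρ y x :=
    fun ρ x y => ⟨Conn.symm, Conn.symm⟩
  have hmem : ∀ x, Conn σ x a.1 ∨ Conn σ x c.1 ↔ Conn σ' x a.1 ∨ Conn σ' x b.1 := by
    intro x
    rw [hsym σ x, hsym σ x, hsym σ' x, hsym σ' x, hA, hC, hA', hB']
    tauto
  refine ⟨?_, ?_, (hline a (by tauto)).1, (hline c (by tauto)).1, (hline a (by tauto)).2,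
    (hline b (by tauto)).2, hmem, ?_⟩
  · rw [hA]; rintro (h1 | h1)
    · exact hac h1
    · exact hbc h1
  · rw [hA']; rintro (h1 | h1)
    · exact hab h1
    · exact hbc h1.symm
  · intro x y hx
    -- A component which does not contain any of the four half-edges is not affected by the cut.
    have key : ∀ (ρ ρ' : N × Bool → N × Bool) (a b c d : N × Bool), Saddle ρ ρ' ω a b c d →
        ¬ (Conn ρ x a.1 ∨ Conn ρ x c.1) → Conn ρ x y → Conn (cut ρ a b c d) x y := by
      intro ρ ρ' a b c d h hx hxy
      have h1 : ∀ e, (e = a ∨ e = b ∨ e = c ∨ e = d) → ¬ Conn (cut ρ a b c d) x e.1 := by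
        rintro e (rfl | rfl | rfl | rfl) h2 <;> have h3 := h.conn_of_cut h2
        · exact hx (Or.inl h3)
        · exact hx (Or.inl (h3.trans h.conn_ab.symm))
        · exact hx (Or.inr h3)
        · exact hx (Or.inr (h3.trans h.conn_cd.symm))
      refine (h.saturated (p := fun z => Conn (cut ρ a b c d) x z) ?_ ?_ ?_ hxy).1 (Conn.refl _)
      · exact fun y z hyz => ⟨fun h1 => h1.trans hyz, fun h1 => h1.trans hyz.symm⟩
      · exact iff_of_false (h1 a (by tauto)) (h1 b (by tauto))
      · exact iff_of_false (h1 c (by tauto)) (h1 d (by tauto))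
    constructor
    · exact fun h1 => h.conn_of_cut' (key σ σ' a b c d h hx h1)
    · intro h1
      have := key σ' σ a c b d h.symm (by rwa [hmem] at hx) h1
      rw [h.cut_symm] at this
      exact h.conn_of_cut this

end HalfEdge

namespace StackedDiagram

variable {Λ : Block} {h : ℕ}

/-! ### Half-edges of a stacked circle diagram -/

section Mate

variable (D : StackedDiagram Λ h)

@[simp] theorem below_zero : D.below 0 = D.lam.cupDiagram := rfl

@[simp] theorem below_succ (s : Fin h) : D.below s.succ = D.inner s := by simp [below]

@[simp] theorem above_castSucc (s : Fin h) : D.above s.castSucc = D.inner s := by simp [above]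

@[simp] theorem above_last : D.above (Fin.last h) = D.mu.cupDiagram := by simp [above]

/-- The diagram attached to the vertices of level `l` from above (`true`) or from below
(`false`). -/
noncomputable def side (l : Fin (h + 1)) (b : Bool) : CupDiagram Λ.Vertex :=
  bif b then D.above l else D.below l

@[simp] theorem side_true (l : Fin (h + 1)) : D.side l true = D.above l := rfl

@[simp] theorem side_false (l : Fin (h + 1)) : D.side l false = D.below l := rfl

/-- A vertex has an upper half-edge `(x, true)` and a lower half-edge `(x, false)`. The map `mate`
exchanges the two halves of a cup, of a cap and of a pair of internal rays, and fixes the half-edges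
belonging to rays at the boundary. -/
noncomputable def mate : Node Λ h × Bool → Node Λ h × Bool
  | ((i, l), true) =>
    Fin.lastCases (motive := fun _ => Node Λ h × Bool)
      ((D.mu.cupDiagram.partner i, Fin.last h), true)
      (fun s => if (D.inner s).partner i = i then ((i, s.succ), false)
        else (((D.inner s).partner i, s.castSucc), true)) l
  | ((i, l), false) =>
    Fin.cases (motive := fun _ => Node Λ h × Bool)
      ((D.lam.cupDiagram.partner i, 0), false)
      (fun s => if (D.inner s).partner i = i then ((i, s.castSucc), true)
        else (((D.inner s).partner i, s.succ), false)) l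

theorem mate_last (i : Λ.Vertex) :
    D.mate ((i, Fin.last h), true) = ((D.mu.cupDiagram.partner i, Fin.last h), true) := by
  simp [mate]

theorem mate_castSucc (i : Λ.Vertex) (s : Fin h) :
    D.mate ((i, s.castSucc), true) = if (D.inner s).partner i = i then ((i, s.succ), false)
        else (((D.inner s).partner i, s.castSucc), true) := by
  simp [mate]

theorem mate_zero (i : Λ.Vertex) :
    D.mate ((i, 0), false) = ((D.lam.cupDiagram.partner i, 0), false) := by
  simp [mate]

theorem mate_succ (i : Λ.Vertex) (s : Fin h) :
    D.mate ((i, s.succ), false) = if (D.inner s).partner i = i then ((i, s.castSucc), true)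
        else (((D.inner s).partner i, s.succ), false) := by
  simp [mate]

/-- Case distinction for a half-edge: upper half-edges on the top level and below it, lower
half-edges on the bottom level and above it. -/
theorem halfEdge_cases {p : Node Λ h × Bool → Prop} (htop : ∀ i, p ((i, Fin.last h), true))
    (hup : ∀ i (s : Fin h), p ((i, s.castSucc), true)) (hbot : ∀ i, p ((i, 0), false))
    (hdown : ∀ i (s : Fin h), p ((i, s.succ), false)) (e : Node Λ h × Bool) : p e := by
  obtain ⟨⟨i, l⟩, b⟩ := e
  cases b with
  | true => exact Fin.lastCases (motive := fun l => p ((i, l), true)) (htop i) (hup i) l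
  | false => exact Fin.cases (motive := fun l => p ((i, l), false)) (hbot i) (hdown i) l

theorem mate_of_cup (i : Λ.Vertex) (l : Fin (h + 1)) (b : Bool) (hi : (D.side l b).partner i ≠ i) :
    D.mate ((i, l), b) = (((D.side l b).partner i, l), b) := by
  cases b with
  | true =>
    induction l using Fin.lastCases with
    | last => rw [mate_last, side_true, above_last]
    | cast s => rw [mate_castSucc, if_neg (by simpa using hi)]; simp
  | false =>
    induction l using Fin.cases with
    | zero => rw [mate_zero, side_false, below_zero]
    | succ s => rw [mate_succ, if_neg (by simpa using hi)]; simp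

theorem mate_up_of_ray (i : Λ.Vertex) (s : Fin h) (hi : (D.inner s).partner i = i) :
    D.mate ((i, s.castSucc), true) = ((i, s.succ), false) := by
  rw [mate_castSucc, if_pos hi]

theorem mate_down_of_ray (i : Λ.Vertex) (s : Fin h) (hi : (D.inner s).partner i = i) :
    D.mate ((i, s.succ), false) = ((i, s.castSucc), true) := by
  rw [mate_succ, if_pos hi]

/-- The column of the other half of an edge. -/
theorem mate_fst_fst (e : Node Λ h × Bool) :
    (D.mate e).1.1 = (D.side e.1.2 e.2).partner e.1.1 := by
  induction e using halfEdge_cases with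
  | htop i => rw [mate_last]; simp
  | hup i s => rw [mate_castSucc]; split_ifs with h1 <;> simp [h1]
  | hbot i => rw [mate_zero]; simp
  | hdown i s => rw [mate_succ]; split_ifs with h1 <;> simp [h1]

theorem mate_mate (e : Node Λ h × Bool) : D.mate (D.mate e) = e := by
  induction e using halfEdge_cases with
  | htop i => rw [mate_last, mate_last, CupDiagram.partner_partner]
  | hup i s =>
    rw [mate_castSucc]
    split_ifs with h1
    · exact D.mate_down_of_ray i s h1
    · rw [mate_castSucc, if_neg, CupDiagram.partner_partner]
      exact (D.inner s).partner_ne h1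
  | hbot i => rw [mate_zero, mate_zero, CupDiagram.partner_partner]
  | hdown i s =>
    rw [mate_succ]
    split_ifs with h1
    · exact D.mate_up_of_ray i s h1
    · rw [mate_succ, if_neg, CupDiagram.partner_partner]
      exact (D.inner s).partner_ne h1

/-- The charge of a half-edge: the arcs through odd positions are oriented upwards and the arcs
through even positions downwards. -/
noncomputable def charge (e : Node Λ h × Bool) : ZMod 2 := Λ.pos e.1.1 + ind (e.2 = true)

theorem isMating : HalfEdge.IsMating D.mate charge := by
  refine ⟨D.mate_mate, fun e => ?_, fun e he => ?_⟩
  · obtain ⟨x, b⟩ := e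
    cases b
    · simp [charge, HalfEdge.swap]
    · simp only [charge, HalfEdge.swap, Bool.not_true, Bool.false_eq_true, not_false_eq_true,
        ind_of_false, add_zero, ind_of_true]
      rw [add_assoc, zmod_two_add_self, add_zero]
  · by_cases h1 : (D.side e.1.2 e.2).partner e.1.1 = e.1.1
    · revert he h1
      induction e using halfEdge_cases with
      | htop i => intro he h1; exact absurd (by rw [mate_last]; simp_all) he
      | hup i s =>
        intro he h1
        rw [D.mate_up_of_ray i s (by simpa using h1)]
        simp only [charge, Bool.false_eq_true, not_false_eq_true, ind_of_false, ind_of_true]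
        rw [add_assoc, zmod_two_add_self]
      | hbot i => intro he h1; exact absurd (by rw [mate_zero]; simp_all) he
      | hdown i s =>
        intro he h1
        rw [D.mate_down_of_ray i s (by simpa using h1)]
        simp [charge]
    · rw [show e = ((e.1.1, e.1.2), e.2) from rfl, D.mate_of_cup _ _ _ h1]
      simp only [charge]
      rw [(D.side e.1.2 e.2).pos_partner _ h1]
      ring

/-- Two vertices lie on the same component. -/
def Conn (x y : Node Λ h) : Prop := HalfEdge.Conn D.mate x y

/-- The component of a vertex is a line. -/
def IsLine (x : Node Λ h) : Prop := HalfEdge.IsLine D.mate x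

variable {D}

theorem Conn.refl (x : Node Λ h) : D.Conn x x := HalfEdge.Conn.refl x

theorem Conn.symm {x y : Node Λ h} (hxy : D.Conn x y) : D.Conn y x := HalfEdge.Conn.symm hxy

theorem Conn.trans {x y z : Node Λ h} (hxy : D.Conn x y) (hyz : D.Conn y z) : D.Conn x z :=
  HalfEdge.Conn.trans hxy hyz

theorem conn_comm {x y : Node Λ h} : D.Conn x y ↔ D.Conn y x := ⟨Conn.symm, Conn.symm⟩

theorem conn_mate (e : Node Λ h × Bool) : D.Conn e.1 (D.mate e).1 := HalfEdge.conn_mate _ e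

theorem IsLine.of_conn {x y : Node Λ h} (hx : D.IsLine x) (hxy : D.Conn x y) : D.IsLine y := by
  obtain ⟨e, he, hxe⟩ := hx
  exact ⟨e, he, hxy.symm.trans hxe⟩

theorem isLine_congr {x y : Node Λ h} (hxy : D.Conn x y) : D.IsLine x ↔ D.IsLine y :=
  ⟨fun h1 => h1.of_conn hxy, fun h1 => h1.of_conn hxy.symm⟩

/-- Whether a half-edge belongs to an undotted cup or cap, as an element of `ZMod 2`. -/
noncomputable def kink (D : StackedDiagram Λ h) (e : Node Λ h × Bool) : ZMod 2 :=
  ind ((D.side e.1.2 e.2).partner e.1.1 ≠ e.1.1 ∧ (D.side e.1.2 e.2).dotted e.1.1 = false)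

/-- Whether a half-edge belongs to a dotted cup or cap, as an element of `ZMod 2`. -/
noncomputable def dot (D : StackedDiagram Λ h) (e : Node Λ h × Bool) : ZMod 2 :=
  ind ((D.side e.1.2 e.2).partner e.1.1 ≠ e.1.1 ∧ (D.side e.1.2 e.2).dotted e.1.1 = true)

theorem Step.exists_mate {x y : Node Λ h} {n : ℕ} (hs : D.Step x y n) :
    ∃ b, y = (D.mate (x, b)).1 ∧ (n : ZMod 2) = D.kink (x, b) := by
  cases hs with
  | cup i l hi =>
    refine ⟨false, by rw [D.mate_of_cup i l false hi]; rfl, ?_⟩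
    by_cases hd : (D.below l).dotted i = true
    · simp [kink, hd]
    · simp [kink, hd, hi]
  | cap i l hi =>
    refine ⟨true, by rw [D.mate_of_cup i l true hi]; rfl, ?_⟩
    by_cases hd : (D.above l).dotted i = true
    · simp [kink, hd]
    · simp [kink, hd, hi]
  | rayUp i s hi =>
    exact ⟨true, by rw [D.mate_up_of_ray i s hi], by simp [kink, hi]⟩
  | rayDown i s hi =>
    exact ⟨false, by rw [D.mate_down_of_ray i s hi], by simp [kink, hi]⟩

theorem exists_step (e : Node Λ h × Bool) :
    D.mate e = e ∨ ∃ n, D.Step e.1 (D.mate e).1 n ∧ (n : ZMod 2) = D.kink e := by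
  by_cases h1 : (D.side e.1.2 e.2).partner e.1.1 = e.1.1
  · revert h1
    induction e using halfEdge_cases with
    | htop i => intro h1; left; rw [mate_last]; simp_all
    | hup i s =>
      intro h1
      simp only [side_true, above_castSucc] at h1
      right; rw [D.mate_up_of_ray i s h1]
      exact ⟨0, Step.rayUp i s h1, by simp [kink, h1]⟩
    | hbot i => intro h1; left; rw [mate_zero]; simp_all
    | hdown i s =>
      intro h1
      simp only [side_false, below_succ] at h1
      right; rw [D.mate_down_of_ray i s h1]
      exact ⟨0, Step.rayDown i s h1, by simp [kink, h1]⟩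
  · right
    obtain ⟨⟨i, l⟩, b⟩ := e
    rw [D.mate_of_cup i l b h1]
    cases b with
    | true =>
      simp only [side_true] at h1
      refine ⟨_, Step.cap i l h1, ?_⟩
      by_cases hd : (D.above l).dotted i = true
      · simp [kink, hd]
      · simp [kink, hd, h1]
    | false =>
      simp only [side_false] at h1
      refine ⟨_, Step.cup i l h1, ?_⟩
      by_cases hd : (D.below l).dotted i = true
      · simp [kink, hd]
      · simp [kink, hd, h1]

theorem comp_eq_iff {x y : Node Λ h} : D.comp x = D.comp y ↔ D.Conn x y := by
  constructor
  · intro hxy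
    have := Quot.eqvGen_exact hxy
    induction this with
    | rel x y hr =>
      obtain ⟨n, hn⟩ := hr
      obtain ⟨b, rfl, -⟩ := hn.exists_mate
      exact conn_mate (x, b)
    | refl x => exact Conn.refl x
    | symm x y _ ih => exact (ih (Quot.eqvGen_sound ‹_›)).symm
    | trans x y z h1 h2 ih1 ih2 =>
      exact (ih1 (Quot.eqvGen_sound h1)).trans (ih2 (Quot.eqvGen_sound h2))
  · intro hxy
    refine HalfEdge.Conn.minimal (r := fun x y => D.comp x = D.comp y)
      ⟨fun _ => rfl, Eq.symm, Eq.trans⟩ (fun e => ?_) hxy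
    rcases exists_step (D := D) e with h1 | ⟨n, hn, -⟩
    · rw [h1]
    · exact Quot.sound ⟨n, hn⟩

theorem exists_rep (C : D.Component) : ∃ x, D.comp x = C := Quot.exists_rep C

theorem Conn.exists_path {x y : Node Λ h} (hxy : D.Conn x y) : ∃ n, D.Path x y n := by
  have key : ∀ e : Node Λ h × Bool, ∀ x n, D.Path x e.1 n → ∃ m, D.Path x (D.mate e).1 m := by
    intro e x n hp
    rcases exists_step (D := D) e with h1 | ⟨m, hm, -⟩
    · rw [h1]; exact ⟨n, hp⟩
    · exact ⟨_, Path.snoc hp hm⟩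
  have hsat := HalfEdge.Conn.saturated (σ := D.mate) (p := fun y => ∃ n, D.Path x y n)
    (fun e => ⟨fun ⟨n, hn⟩ => key e x n hn, fun ⟨n, hn⟩ => by
      have := key (D.mate e) x n hn
      rwa [D.mate_mate] at this⟩) hxy
  exact hsat.1 ⟨0, Path.nil x⟩

theorem mate_eq_self_iff (e : Node Λ h × Bool) : D.mate e = e ↔
    (e.2 = true ∧ e.1.2 = Fin.last h ∧ D.mu.cupDiagram.partner e.1.1 = e.1.1) ∨
    (e.2 = false ∧ e.1.2 = 0 ∧ D.lam.cupDiagram.partner e.1.1 = e.1.1) := by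
  induction e using halfEdge_cases with
  | htop i => rw [mate_last]; simp
  | hup i s =>
    rw [mate_castSucc]
    split_ifs with h1
    · simp [(Fin.castSucc_lt_last s).ne]
    · simp [h1, (Fin.castSucc_lt_last s).ne]
  | hbot i => rw [mate_zero]; simp
  | hdown i s =>
    rw [mate_succ]
    split_ifs with h1
    · simp
    · simp [h1]

theorem meetsBottom_iff {x : Node Λ h} : D.MeetsBottom (D.comp x) ↔
    ∃ e, D.mate e = e ∧ e.2 = false ∧ D.Conn x e.1 := by
  constructor
  · rintro ⟨i, hi, hr⟩
    refine ⟨((i, 0), false), ?_, rfl, (comp_eq_iff.1 hi).symm⟩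
    rw [mate_zero, hr]
  · rintro ⟨⟨⟨i, l⟩, b⟩, he, hb, hx⟩
    rw [mate_eq_self_iff] at he
    rcases he with he | he
    · rw [hb] at he; exact absurd he.1 (by simp)
    · obtain ⟨-, rfl, h1⟩ := he
      exact ⟨i, comp_eq_iff.2 hx.symm, h1⟩

theorem meetsTop_iff {x : Node Λ h} : D.MeetsTop (D.comp x) ↔
    ∃ e, D.mate e = e ∧ e.2 = true ∧ D.Conn x e.1 := by
  constructor
  · rintro ⟨i, hi, hr⟩
    refine ⟨((i, Fin.last h), true), ?_, rfl, (comp_eq_iff.1 hi).symm⟩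
    rw [mate_last, hr]
  · rintro ⟨⟨⟨i, l⟩, b⟩, he, hb, hx⟩
    rw [mate_eq_self_iff] at he
    rcases he with he | he
    · obtain ⟨-, h0, h1⟩ := he
      subst h0
      exact ⟨i, comp_eq_iff.2 hx.symm, h1⟩
    · rw [hb] at he; exact absurd he.1 (by simp)

theorem isCircle_iff {x : Node Λ h} : D.IsCircle (D.comp x) ↔ ¬ D.IsLine x := by
  rw [IsCircle, meetsBottom_iff, meetsTop_iff, IsLine, HalfEdge.IsLine, ← not_or, not_iff_not]
  constructor
  · rintro (⟨e, h1, -, h2⟩ | ⟨e, h1, -, h2⟩) <;> exact ⟨e, h1, h2⟩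
  · rintro ⟨e, h1, h2⟩
    cases hb : e.2 with
    | false => exact Or.inl ⟨e, h1, hb, h2⟩
    | true => exact Or.inr ⟨e, h1, hb, h2⟩

end Mate

/-! ### Parity of the number of vertices to the left -/

/-- The parity of the number of vertices in `S` on the level of `x` to the left of `x`. -/
noncomputable def leftCount (S : Set (Node Λ h)) (x : Node Λ h) : ZMod 2 :=
  ∑ k : Λ.Vertex with k < x.1, ind ((k, x.2) ∈ S)

/-- `S` is a union of components. -/
def Saturated (D : StackedDiagram Λ h) (S : Set (Node Λ h)) : Prop :=
  ∀ e, e.1 ∈ S ↔ (D.mate e).1 ∈ S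

section Parity

variable {D : StackedDiagram Λ h} {S : Set (Node Λ h)}

theorem Saturated.mem_iff (hS : D.Saturated S) {x y : Node Λ h} (hxy : D.Conn x y) :
    x ∈ S ↔ y ∈ S :=
  HalfEdge.Conn.saturated (p := fun x => x ∈ S) hS hxy

theorem saturated_of_conn (hS : ∀ x y, D.Conn x y → x ∈ S → y ∈ S) : D.Saturated S :=
  fun e => ⟨hS _ _ (conn_mate e), hS _ _ (conn_mate e).symm⟩

theorem saturated_conn (x : Node Λ h) : D.Saturated {y | D.Conn x y} :=
  saturated_of_conn fun _ _ h1 h2 => Conn.trans h2 h1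

variable (D)

/-- The two ends of a cup differ by the left end itself. -/
theorem leftCount_cup {e : Node Λ h × Bool} (he : e.1.1 < (D.mate e).1.1)
    (hS : ∀ f : Node Λ h × Bool, f.1.1 < (D.mate e).1.1 → (D.mate f).1.1 < (D.mate e).1.1 →
      (f.1 ∈ S ↔ (D.mate f).1 ∈ S)) :
    leftCount S (D.mate e).1 = leftCount S e.1 + ind (e.1 ∈ S) := by
  obtain ⟨⟨i, l⟩, b⟩ := e
  have h1 := D.mate_fst_fst ((i, l), b)
  simp only at h1 he
  have hne : (D.side l b).partner i ≠ i := by rw [← h1]; exact he.ne'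
  rw [h1] at he
  rw [D.mate_of_cup i l b hne] at hS ⊢
  refine (D.side l b).sum_lt_partner (fun k => ind ((k, l) ∈ S)) i he fun k hk1 hk2 => ?_
  have h2 := (D.side l b).noncrossing i k hk1 hk2
  have h3 := hS ((k, l), b) hk2 (by rw [mate_fst_fst]; exact h2.2.2)
  rw [D.mate_of_cup k l b h2.1] at h3
  exact ind_inj.2 h3.symm

/-- Passing an internal ray does not change the parity; at a boundary ray the statement is trivial.
-/
theorem leftCount_ray {e : Node Λ h × Bool} (he : (D.mate e).1.1 = e.1.1)
    (hS : ∀ f : Node Λ h × Bool, f.1.1 < e.1.1 → (D.mate f).1.1 < e.1.1 →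
      (f.1 ∈ S ↔ (D.mate f).1 ∈ S)) :
    leftCount S (D.mate e).1 = leftCount S e.1 := by
  have key : ∀ (i : Λ.Vertex) (s : Fin h), (D.inner s).partner i = i →
      (∀ f : Node Λ h × Bool, f.1.1 < i → (D.mate f).1.1 < i → (f.1 ∈ S ↔ (D.mate f).1 ∈ S)) →
      leftCount S (i, s.castSucc) = leftCount S (i, s.succ) := by
    intro i s hi hS
    refine (D.inner s).sum_lt_ray (fun k => ind ((k, s.castSucc) ∈ S))
      (fun k => ind ((k, s.succ) ∈ S)) i hi ?_ ?_ ?_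
    · intro k hk hr
      have h1 := hS ((k, s.castSucc), true) hk (by
        rw [mate_fst_fst, side_true, above_castSucc]; exact (D.inner s).partner_lt_of_ray hi hk)
      rw [mate_castSucc, if_neg hr] at h1
      exact ind_inj.2 h1.symm
    · intro k hk hr
      have h1 := hS ((k, s.succ), false) hk (by
        rw [mate_fst_fst, side_false, below_succ]; exact (D.inner s).partner_lt_of_ray hi hk)
      rw [mate_succ, if_neg hr] at h1
      exact ind_inj.2 h1.symm
    · intro k hk hr
      have h1 := hS ((k, s.castSucc), true) hk (by rw [D.mate_up_of_ray k s hr]; exact hk)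
      rw [D.mate_up_of_ray k s hr] at h1
      exact ind_inj.2 h1
  revert he hS
  induction e using halfEdge_cases with
  | htop i => intro he _; rw [mate_last] at he ⊢; simp only at he ⊢; rw [he]
  | hup i s =>
    intro he hS
    rw [mate_fst_fst, side_true, above_castSucc] at he
    rw [D.mate_up_of_ray i s he]
    exact (key i s he hS).symm
  | hbot i => intro he _; rw [mate_zero] at he ⊢; simp only at he ⊢; rw [he]
  | hdown i s =>
    intro he hS
    rw [mate_fst_fst, side_false, below_succ] at he
    rw [D.mate_down_of_ray i s he]
    exact key i s he hS

/-- All vertices to the left of a dotted cup lie on cups to the left of it. -/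
theorem leftCount_dotted {e : Node Λ h × Bool} (hd : (D.side e.1.2 e.2).dotted e.1.1 = true)
    (he : e.1.1 ≤ (D.mate e).1.1)
    (hS : ∀ f : Node Λ h × Bool, f.1.1 < e.1.1 → (D.mate f).1.1 < e.1.1 →
      (f.1 ∈ S ↔ (D.mate f).1 ∈ S)) :
    leftCount S e.1 = 0 := by
  obtain ⟨⟨i, l⟩, b⟩ := e
  rw [mate_fst_fst] at he
  refine (D.side l b).sum_lt_dotted (fun k => ind ((k, l) ∈ S)) i hd he fun k hk => ?_
  have h2 := (D.side l b).admissible i k hd he hk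
  have h3 := hS ((k, l), b) hk (by rw [mate_fst_fst]; exact h2.2)
  rw [D.mate_of_cup k l b h2.1] at h3
  exact ind_inj.2 h3.symm

theorem kink_add_dot (e : Node Λ h × Bool) :
    D.kink e + D.dot e = ind ((D.mate e).1.1 ≠ e.1.1) := by
  rw [mate_fst_fst, kink, dot]
  by_cases h1 : (D.side e.1.2 e.2).partner e.1.1 = e.1.1
  · simp [h1]
  · cases h2 : (D.side e.1.2 e.2).dotted e.1.1 <;> simp [h1]

/-- Along an arc outside of `S` the number of vertices of `S` to the left keeps its parity, and it
is even if the arc is dotted. -/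
theorem leftCount_mate {e : Node Λ h × Bool} (h1 : e.1 ∉ S) (h2 : (D.mate e).1 ∉ S)
    (hS : ∀ f : Node Λ h × Bool, f.1.1 < max e.1.1 (D.mate e).1.1 →
      (D.mate f).1.1 < max e.1.1 (D.mate e).1.1 → (f.1 ∈ S ↔ (D.mate f).1 ∈ S)) :
    leftCount S (D.mate e).1 = leftCount S e.1 ∧ (D.dot e ≠ 0 → leftCount S e.1 = 0) := by
  have key : ∀ e : Node Λ h × Bool, e.1 ∉ S → e.1.1 < (D.mate e).1.1 →
      (∀ f : Node Λ h × Bool, f.1.1 < (D.mate e).1.1 → (D.mate f).1.1 < (D.mate e).1.1 →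
        (f.1 ∈ S ↔ (D.mate f).1 ∈ S)) →
      leftCount S (D.mate e).1 = leftCount S e.1 ∧
        ((D.side e.1.2 e.2).dotted e.1.1 = true → leftCount S e.1 = 0) := by
    intro e h1 hlt hS
    refine ⟨by rw [D.leftCount_cup hlt hS, ind_of_false h1, add_zero], fun hd => ?_⟩
    exact D.leftCount_dotted hd hlt.le fun f hf1 hf2 => hS f (hf1.trans hlt) (hf2.trans hlt)
  rcases lt_trichotomy e.1.1 (D.mate e).1.1 with hlt | heq | hgt
  · rw [max_eq_right hlt.le] at hS
    obtain ⟨h3, h4⟩ := key e h1 hlt hS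
    exact ⟨h3, fun hd => h4 (by rw [dot, Ne, ind_eq_zero, not_not] at hd; exact hd.2)⟩
  · rw [max_eq_left heq.symm.le] at hS
    refine ⟨D.leftCount_ray heq.symm hS, fun hd => ?_⟩
    rw [dot, Ne, ind_eq_zero, not_not, ← mate_fst_fst] at hd
    exact absurd heq.symm hd.1
  · rw [max_eq_left hgt.le] at hS
    have := key (D.mate e) h2 (by rwa [D.mate_mate]) (by rwa [D.mate_mate])
    rw [D.mate_mate] at this
    refine ⟨this.1.symm, fun hd => this.1 ▸ this.2 ?_⟩
    rw [dot, Ne, ind_eq_zero, not_not] at hd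
    obtain ⟨⟨i, l⟩, b⟩ := e
    rw [D.mate_of_cup i l b hd.1]
    exact ((D.side l b).dotted_partner i).trans hd.2

end Parity

end StackedDiagram

namespace StackedDiagram

variable {Λ : Block} {h : ℕ} {D E : StackedDiagram Λ h}

/-! ### Orientations as labellings of the vertices -/

/-- The label of a vertex in a sequence of weights as an element of `ZMod 2`. -/
noncomputable def lab (ν : Fin (h + 1) → Λ.Weight) (x : Node Λ h) : ZMod 2 := (ν x.2).lab x.1

/-- The label of a vertex twisted by the parity of its position. It is constant along undotted arcs
and changes along dotted cups and caps. -/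
noncomputable def twist (ν : Fin (h + 1) → Λ.Weight) (x : Node Λ h) : ZMod 2 :=
  Λ.pos x.1 + lab ν x

theorem lab_ext {ν ν' : Fin (h + 1) → Λ.Weight} (hl : ∀ x, lab ν x = lab ν' x) : ν = ν' :=
  funext fun l => Block.Weight.ext_lab fun i => hl (i, l)

/-- Labels change precisely along undotted cups and caps, and they are prescribed at the end points
of lines. -/
theorem isOrientation_iff {ν : Fin (h + 1) → Λ.Weight} : D.IsOrientation ν ↔
    (∀ e, lab ν (D.mate e).1 = lab ν e.1 + D.kink e) ∧
      ∀ e, D.mate e = e → lab ν e.1 = ind ((D.side e.1.2 e.2).dotted e.1.1 = true) := by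
  have hcup : ∀ (c : CupDiagram Λ.Vertex) (w : Λ.Weight), c.CupsOriented w ↔
      ∀ i, c.partner i ≠ i → w.lab (c.partner i) = w.lab i + ind (c.dotted i = false) := by
    intro c w
    refine forall₂_congr fun i _ => ?_
    cases c.dotted i with
    | true => simp [Block.Weight.lab, ind_inj, iff_comm]
    | false =>
      simp only [Bool.false_eq_true, false_imp_iff, true_and, true_imp_iff, Block.Weight.lab,
        ind_of_true]
      rw [← ind_not, ind_inj]; tauto
  have hray : ∀ (c : CupDiagram Λ.Vertex) (w : Λ.Weight), c.RaysOriented w ↔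
      ∀ i, c.partner i = i → w.lab i = ind (c.dotted i = true) := fun c w =>
    forall₂_congr fun i _ => ind_inj.symm
  constructor
  · intro hν
    refine ⟨fun e => ?_, fun e he => ?_⟩
    · by_cases h1 : (D.side e.1.2 e.2).partner e.1.1 = e.1.1
      · rw [kink, ind_of_false (by tauto), add_zero]
        revert h1
        induction e using halfEdge_cases with
        | htop i => intro h1; simp only [side_true, above_last] at h1; rw [mate_last, h1]
        | hup i s =>
          intro h1
          simp only [side_true, above_castSucc] at h1
          rw [D.mate_up_of_ray i s h1]
          exact ind_inj.2 (hν.internal_rays s i h1).symm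
        | hbot i => intro h1; simp only [side_false, below_zero] at h1; rw [mate_zero, h1]
        | hdown i s =>
          intro h1
          simp only [side_false, below_succ] at h1
          rw [D.mate_down_of_ray i s h1]
          exact ind_inj.2 (hν.internal_rays s i h1)
      · obtain ⟨⟨i, l⟩, b⟩ := e
        rw [D.mate_of_cup i l b h1, kink]
        have h2 : (D.side l b).CupsOriented (ν l) := by
          cases b
          · exact hν.cups l
          · exact hν.caps l
        rw [hcup] at h2
        refine (h2 i h1).trans (congrArg _ (ind_inj.2 ?_))
        exact ⟨fun h3 => ⟨h1, h3⟩, fun h3 => h3.2⟩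
    · rw [mate_eq_self_iff] at he
      obtain ⟨⟨i, l⟩, b⟩ := e
      rcases he with ⟨rfl, h1, h2⟩ | ⟨rfl, h1, h2⟩
      · simp only at h1 h2; subst h1
        have := (hray _ _).1 hν.top_rays i h2
        simpa [lab] using this
      · simp only at h1 h2; subst h1
        have := (hray _ _).1 hν.bottom_rays i h2
        simpa [lab] using this
  · rintro ⟨h1, h2⟩
    have h3 : ∀ l b, (D.side l b).CupsOriented (ν l) := by
      intro l b
      rw [hcup]
      intro i hi
      have := h1 ((i, l), b)
      rw [D.mate_of_cup i l b hi, kink] at this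
      refine this.trans (congrArg _ (ind_inj.2 ?_))
      exact ⟨fun h3 => h3.2, fun h3 => ⟨hi, h3⟩⟩
    refine ⟨fun l => h3 l false, fun l => h3 l true, ?_, ?_, ?_⟩
    · rw [hray]
      intro i hi
      exact h2 ((i, 0), false) (by rw [mate_zero, hi])
    · rw [hray]
      intro i hi
      have := h2 ((i, Fin.last h), true) (by rw [mate_last, hi])
      simpa [lab] using this
    · intro s i hi
      have := h1 ((i, s.castSucc), true)
      rw [D.mate_up_of_ray i s hi, kink, ind_of_false (by simp [hi]), add_zero] at this
      exact (ind_inj.1 this).symm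

section

variable {ν ν' : Fin (h + 1) → Λ.Weight}

theorem IsOrientation.lab_mate (hν : D.IsOrientation ν) (e : Node Λ h × Bool) :
    lab ν (D.mate e).1 = lab ν e.1 + D.kink e :=
  (isOrientation_iff.1 hν).1 e

theorem IsOrientation.twist_mate (hν : D.IsOrientation ν) (e : Node Λ h × Bool) :
    twist ν (D.mate e).1 = twist ν e.1 + D.dot e := by
  have h1 := D.kink_add_dot e
  rw [twist, twist, hν.lab_mate]
  by_cases h2 : (D.mate e).1.1 = e.1.1
  · rw [ind_of_false (by tauto)] at h1
    rw [h2, zmod_two_add_eq_zero.1 h1, add_assoc]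
  · rw [ind_of_true h2] at h1
    have h3 : (Λ.pos (D.mate e).1.1 : ZMod 2) = Λ.pos e.1.1 + 1 := by
      rw [mate_fst_fst] at h2 ⊢
      exact (D.side e.1.2 e.2).pos_partner _ h2
    rw [h3, ← h1]
    generalize D.kink e = u
    generalize D.dot e = v
    generalize lab ν e.1 = w
    generalize (Λ.pos e.1.1 : ZMod 2) = z
    revert u v w z; decide

/-- Two orientations differ by a constant on each component. -/
theorem IsOrientation.lab_add (hν : D.IsOrientation ν) (hν' : D.IsOrientation ν') {x y : Node Λ h}
    (hxy : D.Conn x y) : lab ν x + lab ν' x = lab ν y + lab ν' y := by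
  refine HalfEdge.Conn.minimal (r := fun x y => lab ν x + lab ν' x = lab ν y + lab ν' y)
    ⟨fun _ => rfl, Eq.symm, Eq.trans⟩ (fun e => ?_) hxy
  rw [hν.lab_mate, hν'.lab_mate]
  generalize D.kink e = u
  generalize lab ν e.1 = v
  generalize lab ν' e.1 = w
  revert u v w; decide

theorem IsOrientation.lab_eq_of_isLine (hν : D.IsOrientation ν) (hν' : D.IsOrientation ν')
    {x : Node Λ h} (hx : D.IsLine x) : lab ν x = lab ν' x := by
  obtain ⟨e, he, hxe⟩ := hx
  have h1 := hν.lab_add hν' hxe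
  rw [(isOrientation_iff.1 hν).2 e he, (isOrientation_iff.1 hν').2 e he, zmod_two_add_self] at h1
  exact zmod_two_add_eq_zero.1 h1

/-- The number of vertices of a union `S` of components to the left of a vertex of another component
`C` has constant parity along `C`. If it is odd, then `C` contains no dotted arcs, and the twisted
labels are constant along `C`. -/
theorem leftCount_conn {S : Set (Node Λ h)} (hS : D.Saturated S) (hν : D.IsOrientation ν)
    {x y : Node Λ h} (hx : x ∉ S) (hxy : D.Conn x y) :
    leftCount S x = leftCount S y ∧ (leftCount S x ≠ 0 → twist ν x = twist ν y) := by
  have key := HalfEdge.Conn.minimal (σ := D.mate) (r := fun x y => (x ∈ S ↔ y ∈ S) ∧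
    (x ∉ S → leftCount S x = leftCount S y ∧ (leftCount S x ≠ 0 → twist ν x = twist ν y)))
    ⟨fun x => ⟨Iff.rfl, fun _ => ⟨rfl, fun _ => rfl⟩⟩, ?_, ?_⟩ ?_ hxy
  · exact key.2 hx
  · rintro x y ⟨h1, h2⟩
    refine ⟨h1.symm, fun hy => ?_⟩
    obtain ⟨h3, h4⟩ := h2 (by rwa [h1])
    exact ⟨h3.symm, fun h5 => (h4 (by rwa [h3])).symm⟩
  · rintro x y z ⟨h1, h2⟩ ⟨h3, h4⟩
    refine ⟨h1.trans h3, fun hx => ?_⟩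
    obtain ⟨h5, h6⟩ := h2 hx
    obtain ⟨h7, h8⟩ := h4 (by rwa [← h1])
    exact ⟨h5.trans h7, fun h9 => (h6 h9).trans (h8 (by rwa [← h5]))⟩
  · intro e
    refine ⟨hS e, fun he => ?_⟩
    obtain ⟨h1, h2⟩ := D.leftCount_mate he (by rwa [← hS e]) fun f _ _ => hS f
    refine ⟨h1.symm, fun h3 => ?_⟩
    rw [hν.twist_mate, show D.dot e = 0 by by_contra h4; exact h3 (h2 h4), add_zero]

/-- A union of circles meets every level in an even number of vertices. -/
theorem Saturated.sum_level {S : Set (Node Λ h)} (hS : D.Saturated S)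
    (hS' : ∀ e, D.mate e = e → e.1 ∉ S) (l : Fin (h + 1)) :
    ∑ k : Λ.Vertex, ind ((k, l) ∈ S) = 0 := by
  have hf : ∀ (l : Fin (h + 1)) (b : Bool) (k : Λ.Vertex), (D.side l b).partner k ≠ k →
      ind (((D.side l b).partner k, l) ∈ S) = ind ((k, l) ∈ S) := by
    intro l b k hk
    have := hS ((k, l), b)
    rw [D.mate_of_cup k l b hk] at this
    exact ind_inj.2 this.symm
  induction l using Fin.induction with
  | zero =>
    have h0 := hf 0 false
    simp only [side_false, below_zero] at h0
    rw [D.lam.cupDiagram.sum_univ_eq_sum_rays _ h0]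
    refine Finset.sum_eq_zero fun k hk => ind_of_false ?_
    rw [Finset.mem_filter] at hk
    exact hS' ((k, 0), false) (by rw [mate_zero, hk.2])
  | succ s ih =>
    have h1 := hf s.castSucc true
    have h2 := hf s.succ false
    simp only [side_true, above_castSucc] at h1
    simp only [side_false, below_succ] at h2
    rw [(D.inner s).sum_univ_eq_sum_rays _ h1] at ih
    rw [(D.inner s).sum_univ_eq_sum_rays _ h2, ← ih]
    refine Finset.sum_congr rfl fun k hk => ind_inj.2 ?_
    rw [Finset.mem_filter] at hk
    have := hS ((k, s.castSucc), true)
    rw [D.mate_up_of_ray k s hk.2] at this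
    exact this.symm

/-- Changing all labels on a union of circles turns orientations into orientations. -/
theorem IsOrientation.exists_flip (hν : D.IsOrientation ν) {S : Set (Node Λ h)}
    (hS : D.Saturated S) (hS' : ∀ x ∈ S, ¬ D.IsLine x) :
    ∃ ν', D.IsOrientation ν' ∧ ∀ x, lab ν' x = lab ν x + ind (x ∈ S) := by
  have hS'' : ∀ e, D.mate e = e → e.1 ∉ S := fun e he heS =>
    hS' _ heS ⟨e, he, Conn.refl _⟩
  have h1 : ∀ l, ∃ w : Λ.Weight, ∀ i, w.lab i = (ν l).lab i + ind ((i, l) ∈ S) := fun l =>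
    Block.exists_weight _ (by
      rw [Finset.sum_add_distrib, hS.sum_level hS'', add_zero, Block.Weight.sum_lab])
  choose ν' hν' using h1
  have h2 : ∀ x, lab ν' x = lab ν x + ind (x ∈ S) := fun x => hν' x.2 x.1
  refine ⟨ν', isOrientation_iff.2 ⟨fun e => ?_, fun e he => ?_⟩, h2⟩
  · rw [h2, h2, hν.lab_mate, ind_inj.2 (hS e)]; ring
  · rw [h2, ind_of_false (hS'' e he), add_zero]
    exact (isOrientation_iff.1 hν).2 e he

end

/-! ### Surgeries as saddle moves -/

namespace Surgery

variable (s : Surgery D E)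

theorem i_ne_j : s.i ≠ s.j := s.lt.ne

theorem cup_j : (D.inner s.level).partner s.j = s.i := by
  rw [← s.cup, CupDiagram.partner_partner]

theorem dotted_j : (D.inner s.level).dotted s.j = (D.inner s.level).dotted s.i := by
  rw [← s.cup, CupDiagram.dotted_partner]

theorem side_lower : D.side s.level.castSucc true = D.inner s.level := by simp

theorem side_upper : D.side s.level.succ false = D.inner s.level := by simp

theorem mate_lower_i : D.mate (s.lower s.i, true) = (s.lower s.j, true) := by
  rw [lower, mate_castSucc, if_neg (by rw [s.cup]; exact s.lt.ne'), s.cup]; rfl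

theorem mate_lower_j : D.mate (s.lower s.j, true) = (s.lower s.i, true) := by
  rw [← s.mate_lower_i, mate_mate]

theorem mate_upper_i : D.mate (s.upper s.i, false) = (s.upper s.j, false) := by
  rw [upper, mate_succ, if_neg (by rw [s.cup]; exact s.lt.ne'), s.cup]; rfl

theorem mate_upper_j : D.mate (s.upper s.j, false) = (s.upper s.i, false) := by
  rw [← s.mate_upper_i, mate_mate]

theorem mate_lower_i' : E.mate (s.lower s.i, true) = (s.upper s.i, false) :=
  E.mate_up_of_ray _ _ s.ray_i

theorem mate_lower_j' : E.mate (s.lower s.j, true) = (s.upper s.j, false) :=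
  E.mate_up_of_ray _ _ s.ray_j

theorem mate_upper_i' : E.mate (s.upper s.i, false) = (s.lower s.i, true) :=
  E.mate_down_of_ray _ _ s.ray_i

theorem mate_upper_j' : E.mate (s.upper s.j, false) = (s.lower s.j, true) :=
  E.mate_down_of_ray _ _ s.ray_j

/-- The half-edge belongs to one of the arcs which are replaced by the surgery. -/
def Touches (e : Node Λ h × Bool) : Prop :=
  e = (s.lower s.i, true) ∨ e = (s.lower s.j, true) ∨ e = (s.upper s.i, false) ∨
    e = (s.upper s.j, false)

/-- Half-edges which are not touched by the surgery are joined as before. -/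
theorem agree (e : Node Λ h × Bool) (he : ¬ s.Touches e) :
    E.mate e = D.mate e ∧
      (E.side e.1.2 e.2).partner e.1.1 = (D.side e.1.2 e.2).partner e.1.1 ∧
      (E.side e.1.2 e.2).dotted e.1.1 = (D.side e.1.2 e.2).dotted e.1.1 := by
  have key : ∀ (k : Λ.Vertex) (t : Fin h), (t = s.level → k ≠ s.i ∧ k ≠ s.j) →
      (E.inner t).partner k = (D.inner t).partner k ∧
        (E.inner t).dotted k = (D.inner t).dotted k := by
    intro k t ht
    by_cases h1 : t = s.level
    · subst h1
      exact ⟨s.partner_eq k (ht rfl).1 (ht rfl).2, s.dotted_eq k (ht rfl).1 (ht rfl).2⟩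
    · rw [s.inner_eq t h1]; exact ⟨rfl, rfl⟩
  revert he
  induction e using halfEdge_cases with
  | htop k => intro _; simp [mate_last, s.mu_eq]
  | hup k t =>
    intro he
    have h1 := key k t fun ht => ⟨fun hk => he (Or.inl (by rw [ht, hk]; rfl)),
      fun hk => he (Or.inr (Or.inl (by rw [ht, hk]; rfl)))⟩
    rw [mate_castSucc, mate_castSucc, h1.1]
    simpa using h1
  | hbot k => intro _; simp [mate_zero, s.lam_eq]
  | hdown k t =>
    intro he
    have h1 := key k t fun ht => ⟨fun hk => he (Or.inr (Or.inr (Or.inl (by rw [ht, hk]; rfl)))),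
      fun hk => he (Or.inr (Or.inr (Or.inr (by rw [ht, hk]; rfl))))⟩
    rw [mate_succ, mate_succ, h1.1]
    simpa using h1

/-- The surgery replaces the cup and the cap joining `i` and `j` by the two internal rays at `i` and
`j`. -/
theorem saddle : HalfEdge.Saddle D.mate E.mate charge (s.lower s.i, true) (s.lower s.j, true)
    (s.upper s.i, false) (s.upper s.j, false) where
  mating := D.isMating
  mating' := E.isMating
  ab := s.mate_lower_i
  cd := s.mate_upper_i
  ac := s.mate_lower_i'
  bd := s.mate_lower_j'
  ne_ab := fun h1 => s.i_ne_j (congrArg (fun e => e.1.1) h1)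
  ne_ac := fun h1 => by simpa using congrArg Prod.snd h1
  ne_ad := fun h1 => by simpa using congrArg Prod.snd h1
  ne_bc := fun h1 => by simpa using congrArg Prod.snd h1
  ne_bd := fun h1 => by simpa using congrArg Prod.snd h1
  ne_cd := fun h1 => s.i_ne_j (congrArg (fun e => e.1.1) h1)
  agree := fun e h1 h2 h3 h4 => (s.agree e (by unfold Touches; tauto)).1

theorem free_iff (s : Surgery D E) (e : Node Λ h × Bool) : E.mate e = e ↔ D.mate e = e :=
  s.saddle.mate_eq_iff e

theorem conn_lower : D.Conn (s.lower s.i) (s.lower s.j) := s.saddle.conn_ab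

theorem conn_upper : D.Conn (s.upper s.i) (s.upper s.j) := s.saddle.conn_cd

theorem conn_i : E.Conn (s.lower s.i) (s.upper s.i) := s.saddle.conn_ac

theorem conn_j : E.Conn (s.lower s.j) (s.upper s.j) := s.saddle.conn_bd

theorem kink_lower : D.kink (s.lower s.i, true) = ind ((D.inner s.level).dotted s.i = false) := by
  rw [kink]
  refine ind_inj.2 ?_
  simp only [lower, side_lower]
  exact ⟨fun h1 => h1.2, fun h1 => ⟨by rw [s.cup]; exact s.lt.ne', h1⟩⟩

theorem kink_upper : D.kink (s.upper s.i, false) = ind ((D.inner s.level).dotted s.i = false) := by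
  rw [kink]
  refine ind_inj.2 ?_
  simp only [upper, side_upper]
  exact ⟨fun h1 => h1.2, fun h1 => ⟨by rw [s.cup]; exact s.lt.ne', h1⟩⟩

variable {ν : Fin (h + 1) → Λ.Weight}

theorem lab_lower (hν : D.IsOrientation ν) :
    lab ν (s.lower s.j) = lab ν (s.lower s.i) + ind ((D.inner s.level).dotted s.i = false) := by
  have h1 := hν.lab_mate (s.lower s.i, true)
  rwa [s.mate_lower_i, s.kink_lower] at h1

theorem lab_upper (hν : D.IsOrientation ν) :
    lab ν (s.upper s.j) = lab ν (s.upper s.i) + ind ((D.inner s.level).dotted s.i = false) := by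
  have h1 := hν.lab_mate (s.upper s.i, false)
  rwa [s.mate_upper_i, s.kink_upper] at h1

theorem lab_i (hν : E.IsOrientation ν) : lab ν (s.lower s.i) = lab ν (s.upper s.i) :=
  ind_inj.2 (hν.internal_rays s.level s.i s.ray_i)

theorem lab_j (hν : E.IsOrientation ν) : lab ν (s.lower s.j) = lab ν (s.upper s.j) :=
  ind_inj.2 (hν.internal_rays s.level s.j s.ray_j)

theorem not_touches_of_free {e : Node Λ h × Bool} (he : D.mate e = e) : ¬ s.Touches e := by
  rintro (rfl | rfl | rfl | rfl)
  · rw [mate_lower_i] at he; exact s.i_ne_j (congrArg (fun e => e.1.1) he).symm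
  · rw [mate_lower_j] at he; exact s.i_ne_j (congrArg (fun e => e.1.1) he)
  · rw [mate_upper_i] at he; exact s.i_ne_j (congrArg (fun e => e.1.1) he).symm
  · rw [mate_upper_j] at he; exact s.i_ne_j (congrArg (fun e => e.1.1) he)

/-- An orientation remains an orientation after the surgery if it orients one of the two new
rays. -/
theorem isOrientation_of_lab_eq (hν : D.IsOrientation ν)
    (hi : lab ν (s.lower s.i) = lab ν (s.upper s.i)) : E.IsOrientation ν := by
  have hj : lab ν (s.lower s.j) = lab ν (s.upper s.j) := by
    rw [s.lab_lower hν, s.lab_upper hν, hi]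
  have hE : ∀ (k : Λ.Vertex) (l : Fin (h + 1)) (b : Bool), (E.side l b).partner k = k →
      E.kink ((k, l), b) = 0 := fun k l b hk => ind_of_false (by simp [hk])
  refine isOrientation_iff.2 ⟨fun e => ?_, fun e he => ?_⟩
  · by_cases h1 : s.Touches e
    · have hi1 : E.kink (s.lower s.i, true) = 0 := hE _ _ _ (by simpa using s.ray_i)
      have hj1 : E.kink (s.lower s.j, true) = 0 := hE _ _ _ (by simpa using s.ray_j)
      have hi2 : E.kink (s.upper s.i, false) = 0 := hE _ _ _ (by simpa using s.ray_i)
      have hj2 : E.kink (s.upper s.j, false) = 0 := hE _ _ _ (by simpa using s.ray_j)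
      rcases h1 with rfl | rfl | rfl | rfl
      · rw [s.mate_lower_i', hi1, add_zero, hi]
      · rw [s.mate_lower_j', hj1, add_zero, hj]
      · rw [s.mate_upper_i', hi2, add_zero, hi]
      · rw [s.mate_upper_j', hj2, add_zero, hj]
    · obtain ⟨h2, h3, h4⟩ := s.agree e h1
      rw [h2, hν.lab_mate, kink, kink, h3, h4]
  · rw [s.free_iff] at he
    obtain ⟨-, -, h4⟩ := s.agree e (s.not_touches_of_free he)
    rw [h4]
    exact (isOrientation_iff.1 hν).2 e he

/-- An orientation after the surgery is an orientation before the surgery if it orients the cup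
which is replaced. -/
theorem isOrientation_of_lab_add (hν : E.IsOrientation ν)
    (hij : lab ν (s.lower s.j) =
      lab ν (s.lower s.i) + ind ((D.inner s.level).dotted s.i = false)) : D.IsOrientation ν := by
  have hij' : lab ν (s.upper s.j) =
      lab ν (s.upper s.i) + ind ((D.inner s.level).dotted s.i = false) := by
    rw [← s.lab_i hν, ← s.lab_j hν, hij]
  refine isOrientation_iff.2 ⟨fun e => ?_, fun e he => ?_⟩
  · by_cases h1 : s.Touches e
    · have hne : (D.inner s.level).partner s.i ≠ s.i := by rw [s.cup]; exact s.lt.ne'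
      have hne' : (D.inner s.level).partner s.j ≠ s.j := by rw [s.cup_j]; exact s.lt.ne
      have hj1 : D.kink (s.lower s.j, true) = ind ((D.inner s.level).dotted s.i = false) := by
        rw [kink]; refine ind_inj.2 ?_
        simp only [lower, side_lower, s.dotted_j]; tauto
      have hj2 : D.kink (s.upper s.j, false) = ind ((D.inner s.level).dotted s.i = false) := by
        rw [kink]; refine ind_inj.2 ?_
        simp only [upper, side_upper, s.dotted_j]; tauto
      rcases h1 with rfl | rfl | rfl | rfl
      · rw [s.mate_lower_i, s.kink_lower, hij]
      · rw [s.mate_lower_j, hj1, hij, add_assoc, zmod_two_add_self, add_zero]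
      · rw [s.mate_upper_i, s.kink_upper, hij']
      · rw [s.mate_upper_j, hj2, hij', add_assoc, zmod_two_add_self, add_zero]
    · obtain ⟨h2, h3, h4⟩ := s.agree e h1
      rw [← h2, hν.lab_mate, kink, kink, h3, h4]
  · obtain ⟨-, -, h4⟩ := s.agree e (s.not_touches_of_free he)
    rw [← h4]
    exact (isOrientation_iff.1 hν).2 e ((s.free_iff e).2 he)

/-! ### The position of a saddle relative to other components -/

/-- `S` is a union of components, except that it need not be compatible with the arcs changed by the
surgery. -/
def SaturatedOff (S : Set (Node Λ h)) : Prop :=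
  ∀ e, ¬ s.Touches e → (e.1 ∈ S ↔ (D.mate e).1 ∈ S)

variable {S : Set (Node Λ h)}

theorem saturatedOff_of_saturated (hS : D.Saturated S) : s.SaturatedOff S := fun e _ => hS e

theorem saturatedOff_of_saturated' (hS : E.Saturated S) : s.SaturatedOff S := fun e he => by
  rw [← (s.agree e he).1]; exact hS e

theorem leftCount_lower_j (hS : s.SaturatedOff S) :
    leftCount S (s.lower s.j) = leftCount S (s.lower s.i) + ind (s.lower s.i ∈ S) := by
  have h1 := D.leftCount_cup (e := (s.lower s.i, true)) (S := S)
    (by rw [s.mate_lower_i]; exact s.lt) (by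
      rw [s.mate_lower_i]
      intro f hf1 hf2
      refine hS f ?_
      rintro (rfl | rfl | rfl | rfl)
      · rw [s.mate_lower_i] at hf2; exact lt_irrefl _ hf2
      · exact lt_irrefl _ hf1
      · rw [s.mate_upper_i] at hf2; exact lt_irrefl _ hf2
      · exact lt_irrefl _ hf1)
  rwa [s.mate_lower_i] at h1

theorem saturatedOff_left (hS : s.SaturatedOff S) (f : Node Λ h × Bool) (hf : f.1.1 < s.i) :
    f.1 ∈ S ↔ (D.mate f).1 ∈ S := by
  refine hS f ?_
  rintro (rfl | rfl | rfl | rfl)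
  · exact lt_irrefl _ hf
  · exact lt_asymm s.lt hf
  · exact lt_irrefl _ hf
  · exact lt_asymm s.lt hf

theorem leftCount_upper_i (hS : s.SaturatedOff S) :
    leftCount S (s.upper s.i) = leftCount S (s.lower s.i) := by
  have h1 := E.leftCount_ray (e := (s.lower s.i, true)) (S := S)
    (by rw [s.mate_lower_i']; rfl) (by
      intro f hf1 _
      have hf : ¬ s.Touches f := by
        rintro (rfl | rfl | rfl | rfl)
        · exact lt_irrefl _ hf1
        · exact lt_asymm s.lt hf1
        · exact lt_irrefl _ hf1
        · exact lt_asymm s.lt hf1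
      rw [(s.agree f hf).1]
      exact hS f hf)
  rwa [s.mate_lower_i'] at h1

theorem leftCount_of_dotted (hS : s.SaturatedOff S) (hd : (D.inner s.level).dotted s.i = true) :
    leftCount S (s.lower s.i) = 0 :=
  D.leftCount_dotted (e := (s.lower s.i, true)) (by simpa [lower] using hd)
    (by rw [s.mate_lower_i]; exact s.lt.le) fun f hf1 _ => s.saturatedOff_left hS f hf1

/-- If an odd number of vertices of `S` lies to the left of the cup changed by the surgery, then
the cup is undotted, so that the twisted labels at its ends agree. -/
theorem twist_lower_of_leftCount_ne_zero (hS : s.SaturatedOff S) (hν : D.IsOrientation ν)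
    (hl : leftCount S (s.lower s.i) ≠ 0) : twist ν (s.lower s.j) = twist ν (s.lower s.i) := by
  have h1 := hν.twist_mate (s.lower s.i, true)
  rw [s.mate_lower_i] at h1
  rw [h1, dot, ind_of_false, add_zero]
  rintro ⟨-, h2⟩
  exact hl (s.leftCount_of_dotted hS (by simpa [lower] using h2))

end Surgery

/-! ### Lines and their end points -/

/-- The component of `x` has an end point on the upper (`true`) or lower (`false`) boundary. -/
def EndsOn (D : StackedDiagram Λ h) (b : Bool) (x : Node Λ h) : Prop :=
  ∃ e, D.mate e = e ∧ e.2 = b ∧ D.Conn x e.1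

theorem isLine_iff_endsOn {x : Node Λ h} : D.IsLine x ↔ ∃ b, D.EndsOn b x :=
  ⟨fun ⟨e, h1, h2⟩ => ⟨e.2, e, h1, rfl, h2⟩, fun ⟨_, e, h1, _, h2⟩ => ⟨e, h1, h2⟩⟩

theorem EndsOn.of_conn {b : Bool} {x y : Node Λ h} (hx : D.EndsOn b x) (hxy : D.Conn x y) :
    D.EndsOn b y := by
  obtain ⟨e, h1, h2, h3⟩ := hx
  exact ⟨e, h1, h2, hxy.symm.trans h3⟩

/-- The component of `x` is a propagating line. -/
def Propagates (D : StackedDiagram Λ h) (x : Node Λ h) : Prop := D.EndsOn false x ∧ D.EndsOn true x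

theorem isPropagating_iff {x : Node Λ h} : D.IsPropagating (D.comp x) ↔ D.Propagates x := by
  rw [IsPropagating, meetsBottom_iff, meetsTop_iff, Propagates, EndsOn, EndsOn]

theorem Propagates.of_conn {x y : Node Λ h} (hx : D.Propagates x) (hxy : D.Conn x y) :
    D.Propagates y :=
  ⟨hx.1.of_conn hxy, hx.2.of_conn hxy⟩

theorem Propagates.isLine {x : Node Λ h} (hx : D.Propagates x) : D.IsLine x :=
  isLine_iff_endsOn.2 ⟨false, hx.1⟩

/-- A propagating line has only one end point on each boundary. -/
theorem Propagates.unique_end {x : Node Λ h} (hx : D.Propagates x) {e f : Node Λ h × Bool}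
    (he : D.mate e = e) (hf : D.mate f = f) (hxe : D.Conn x e.1) (hxf : D.Conn x f.1)
    (hef : e.2 = f.2) : e = f := by
  obtain ⟨g, hg, hge, hxg⟩ : D.EndsOn (!e.2) x := by
    cases e.2
    · exact hx.2
    · exact hx.1
  refine D.isMating.unique_end hg he hf (hxg.symm.trans hxe) (hxg.symm.trans hxf) ?_ ?_
  · rintro rfl; simp at hge
  · rintro rfl; rw [hef] at hge; simp at hge

theorem mem_conn_iff {x y : Node Λ h} : y ∈ {z | D.Conn x z} ↔ D.Conn x y := Iff.rfl

theorem mem_conn_self (x : Node Λ h) : x ∈ {z | D.Conn x z} := mem_conn_iff.2 (Conn.refl x)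

theorem leftCount_union {S T : Set (Node Λ h)} (hST : ∀ x ∈ S, x ∉ T) (x : Node Λ h) :
    leftCount (S ∪ T) x = leftCount S x + leftCount T x := by
  rw [leftCount, leftCount, leftCount, ← Finset.sum_add_distrib]
  refine Finset.sum_congr rfl fun k _ => ?_
  have h1 := hST (k, x.2)
  by_cases h2 : (k, x.2) ∈ S
  · rw [ind_of_true (show (k, x.2) ∈ S ∪ T from Or.inl h2), ind_of_true h2, ind_of_false (h1 h2), add_zero]
  · rw [ind_of_false h2, zero_add]
    exact ind_inj.2 ⟨fun h3 => h3.resolve_left h2, Or.inr⟩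

/-- Of two propagating lines one lies to the left of the other. -/
theorem leftCount_add_of_propagates {ν : Fin (h + 1) → Λ.Weight} (hν : D.IsOrientation ν)
    {x y : Node Λ h} (hx : D.Propagates x) (hy : D.Propagates y) (hxy : ¬ D.Conn x y) :
    leftCount {z | D.Conn x z} y + leftCount {z | D.Conn y z} x = 1 := by
  -- On the bottom level, apart from cups, a propagating line has just the ray at some vertex `r`.
  -- Hence its parity to the left of any other boundary ray `t` tells whether `r < t`.
  have key : ∀ x, D.Propagates x → ∃ r : Λ.Vertex, D.Conn x (r, 0) ∧
      D.lam.cupDiagram.partner r = r ∧ ∀ t, D.lam.cupDiagram.partner t = t →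
        leftCount {z | D.Conn x z} (t, 0) = ind (r < t) := by
    intro x hx
    obtain ⟨⟨⟨r, l⟩, b⟩, he, hb, hxr⟩ := hx.1
    have hend := he
    rw [mate_eq_self_iff] at hend
    simp only at hb
    subst hb
    obtain ⟨-, hl, hr⟩ := hend.resolve_left (by simp)
    simp only at hl hr
    subst hl
    refine ⟨r, hxr, hr, fun t ht => ?_⟩
    have h1 := D.lam.cupDiagram.sum_lt_ray (fun k => ind (D.Conn x (k, 0))) (fun k => ind (k = r)) t
      ht ?_ ?_ ?_
    · rw [leftCount]
      refine h1.trans ?_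
      by_cases hrt : r < t
      · rw [ind_of_true hrt, Finset.sum_eq_single r, ind_of_true rfl]
        · exact fun k _ hk => ind_of_false hk
        · intro h2; simp [hrt] at h2
      · rw [ind_of_false hrt]
        refine Finset.sum_eq_zero fun k hk => ind_of_false ?_
        rintro rfl
        exact hrt (Finset.mem_filter.1 hk).2
    · intro k _ hk
      have h2 := conn_mate (D := D) ((k, 0), false)
      rw [mate_zero] at h2
      exact ind_inj.2 ⟨fun h3 => h3.trans h2.symm, fun h3 => h3.trans h2⟩
    · intro k _ hk
      rw [ind_of_false, ind_of_false]
      · rintro rfl; exact hk hr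
      · intro h2
        rw [← h2, CupDiagram.partner_partner] at hr
        exact hk hr.symm
    · intro k _ hk
      refine ind_inj.2 ⟨fun h2 => ?_, fun h2 => h2 ▸ hxr⟩
      have := hx.unique_end (e := ((k, 0), false)) (f := ((r, 0), false)) (by rw [mate_zero, hk])
        (by rw [mate_zero, hr]) h2 hxr rfl
      exact congrArg (fun e => e.1.1) this
  obtain ⟨r, h1, h2, h3⟩ := key x hx
  obtain ⟨t, h4, h5, h6⟩ := key y hy
  have hrt : r ≠ t := by
    rintro rfl; exact hxy (h1.trans h4.symm)
  rw [(leftCount_conn (saturated_conn x) hν hxy h4).1,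
    (leftCount_conn (saturated_conn y) hν (fun h7 => hxy (Conn.symm h7)) h1).1, h3 t h5, h6 r h2]
  rcases hrt.lt_or_gt with h7 | h7
  · rw [ind_of_true h7, ind_of_false h7.not_gt, add_zero]
  · rw [ind_of_true h7, ind_of_false h7.not_gt, zero_add]

/-! ### Merges, splits and reconnections -/

section Merge

variable {a c : Node Λ h}

theorem merge_mono (hm : HalfEdge.IsMerge D.Conn E.Conn D.IsLine a c) {x y : Node Λ h}
    (hxy : D.Conn x y) : E.Conn x y :=
  (hm.iff x y).2 (Or.inl hxy)

theorem merge_conn (hm : HalfEdge.IsMerge D.Conn E.Conn D.IsLine a c) : E.Conn a c :=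
  (hm.iff a c).2 (Or.inr ⟨Or.inl (Conn.refl _), Or.inr (Conn.refl _)⟩)

theorem merge_conn_iff (hm : HalfEdge.IsMerge D.Conn E.Conn D.IsLine a c) {x : Node Λ h} :
    E.Conn x a ↔ D.Conn x a ∨ D.Conn x c := by
  rw [hm.iff]
  constructor
  · rintro (h1 | h1)
    · exact Or.inl h1
    · exact h1.1
  · exact fun h1 => Or.inr ⟨h1, Or.inl (Conn.refl _)⟩

theorem merge_off (hm : HalfEdge.IsMerge D.Conn E.Conn D.IsLine a c) {x y : Node Λ h}
    (hx : ¬ E.Conn x a) : E.Conn x y ↔ D.Conn x y := by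
  rw [merge_conn_iff hm] at hx
  rw [hm.iff]
  tauto

theorem merge_endsOn_off (hm : HalfEdge.IsMerge D.Conn E.Conn D.IsLine a c)
    (hfree : ∀ e, E.mate e = e ↔ D.mate e = e) {x : Node Λ h} (hx : ¬ E.Conn x a) (b : Bool) :
    E.EndsOn b x ↔ D.EndsOn b x := by
  refine exists_congr fun e => ?_
  rw [hfree, merge_off hm hx]

theorem merge_endsOn (hm : HalfEdge.IsMerge D.Conn E.Conn D.IsLine a c)
    (hfree : ∀ e, E.mate e = e ↔ D.mate e = e) (b : Bool) :
    E.EndsOn b a ↔ D.EndsOn b a ∨ D.EndsOn b c := by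
  constructor
  · rintro ⟨e, h1, h2, h3⟩
    rcases (merge_conn_iff hm).1 h3.symm with h4 | h4
    · exact Or.inl ⟨e, (hfree e).1 h1, h2, h4.symm⟩
    · exact Or.inr ⟨e, (hfree e).1 h1, h2, h4.symm⟩
  · rintro (⟨e, h1, h2, h3⟩ | ⟨e, h1, h2, h3⟩)
    · exact ⟨e, (hfree e).2 h1, h2, merge_mono hm h3⟩
    · exact ⟨e, (hfree e).2 h1, h2, (merge_conn hm).trans (merge_mono hm h3)⟩

theorem merge_isLine_off (hm : HalfEdge.IsMerge D.Conn E.Conn D.IsLine a c)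
    (hfree : ∀ e, E.mate e = e ↔ D.mate e = e) {x : Node Λ h} (hx : ¬ E.Conn x a) :
    E.IsLine x ↔ D.IsLine x := by
  rw [isLine_iff_endsOn, isLine_iff_endsOn]
  exact exists_congr fun b => merge_endsOn_off hm hfree hx b

theorem merge_isLine (hm : HalfEdge.IsMerge D.Conn E.Conn D.IsLine a c)
    (hfree : ∀ e, E.mate e = e ↔ D.mate e = e) : E.IsLine a ↔ D.IsLine a ∨ D.IsLine c := by
  simp only [isLine_iff_endsOn, merge_endsOn hm hfree, exists_or]

/-- On a line, a merge does not change the end points of the component. -/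
theorem merge_endsOn_of_isLine (hm : HalfEdge.IsMerge D.Conn E.Conn D.IsLine a c)
    (hfree : ∀ e, E.mate e = e ↔ D.mate e = e) {x : Node Λ h} (hx : D.IsLine x) (b : Bool) :
    E.EndsOn b x ↔ D.EndsOn b x := by
  by_cases h1 : E.Conn x a
  · have h2 : E.EndsOn b x ↔ E.EndsOn b a := ⟨fun h2 => h2.of_conn h1, fun h2 => h2.of_conn h1.symm⟩
    have hno : ∀ y, ¬ D.IsLine y → ¬ D.EndsOn b y := fun y hy h3 =>
      hy (isLine_iff_endsOn.2 ⟨b, h3⟩)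
    rw [h2, merge_endsOn hm hfree]
    rcases (merge_conn_iff hm).1 h1 with h3 | h3
    · have h4 := hno c (hm.circle.resolve_left (not_not.2 (hx.of_conn h3)))
      exact ⟨fun h5 => (h5.resolve_right h4).of_conn h3.symm, fun h5 => Or.inl (h5.of_conn h3)⟩
    · have h4 := hno a (hm.circle.resolve_right (not_not.2 (hx.of_conn h3)))
      exact ⟨fun h5 => (h5.resolve_left h4).of_conn h3.symm, fun h5 => Or.inr (h5.of_conn h3)⟩
  · exact merge_endsOn_off hm hfree h1 b

theorem merge_isLine_of_isLine (hm : HalfEdge.IsMerge D.Conn E.Conn D.IsLine a c)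
    (hfree : ∀ e, E.mate e = e ↔ D.mate e = e) {x : Node Λ h} (hx : D.IsLine x) : E.IsLine x := by
  obtain ⟨b, hb⟩ := isLine_iff_endsOn.1 hx
  exact isLine_iff_endsOn.2 ⟨b, (merge_endsOn_of_isLine hm hfree hx b).2 hb⟩

theorem merge_propagates_of_isLine (hm : HalfEdge.IsMerge D.Conn E.Conn D.IsLine a c)
    (hfree : ∀ e, E.mate e = e ↔ D.mate e = e) {x : Node Λ h} (hx : D.IsLine x) :
    E.Propagates x ↔ D.Propagates x := by
  rw [Propagates, Propagates, merge_endsOn_of_isLine hm hfree hx,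
    merge_endsOn_of_isLine hm hfree hx]

instance : Finite D.Component := Quot.finite _

theorem numComponents_lt_of_merge (hm : HalfEdge.IsMerge D.Conn E.Conn D.IsLine a c) :
    E.numComponents < D.numComponents := by
  let f : D.Component → E.Component := Quot.lift E.comp (by
    rintro x y hxy
    exact comp_eq_iff.2 (merge_mono hm (comp_eq_iff.1 (Quot.sound hxy))))
  have hf : Function.Surjective f := by
    intro C
    obtain ⟨x, rfl⟩ := exists_rep C
    exact ⟨D.comp x, rfl⟩
  by_contra hcon
  have h1 := (hf.bijective_of_nat_card_le (not_lt.1 hcon)).1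
  have h2 : D.comp a = D.comp c := h1 (comp_eq_iff.2 (merge_conn hm))
  exact hm.ne (comp_eq_iff.1 h2)

/-- The number of components decreases by at most one, since the map from the components of `D` to
those of `E` is injective outside of the component of `c`. -/
theorem numComponents_le_of_merge
    (hm : HalfEdge.IsMerge D.Conn E.Conn D.IsLine a c) : D.numComponents ≤ E.numComponents + 1 := by
  classical
  let f : D.Component → E.Component := Quot.lift E.comp (by
    rintro x y hxy
    exact comp_eq_iff.2 (merge_mono hm (comp_eq_iff.1 (Quot.sound hxy))))
  have hf : ∀ x, f (D.comp x) = E.comp x := fun _ => rfl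
  let g : D.Component → Option E.Component := fun C => if C = D.comp c then none else some (f C)
  have hg : Function.Injective g := by
    intro C C' hCC
    by_cases h1 : C = D.comp c <;> by_cases h2 : C' = D.comp c <;> simp only [g, h1, h2, if_true,
      if_false, reduceCtorEq, Option.some.injEq] at hCC ⊢
    obtain ⟨x, rfl⟩ := exists_rep C
    obtain ⟨y, rfl⟩ := exists_rep C'
    rw [comp_eq_iff] at h1 h2
    rw [hf, hf, comp_eq_iff, hm.iff] at hCC
    rw [comp_eq_iff]
    rcases hCC with h3 | ⟨h3, h4⟩
    · exact h3
    · exact (h3.resolve_right h1).trans (Conn.symm (h4.resolve_right h2))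
  have := Nat.card_le_card_of_injective g hg
  rwa [Finite.card_option] at this

end Merge

section Reconnect

variable {a b c : Node Λ h}

/-- The two new components are mapped to the two old ones, and all other components to themselves.
-/
theorem numComponents_le_of_reconnect (hne : ¬ D.Conn a c)
    (hmem : ∀ x, D.Conn x a ∨ D.Conn x c → E.Conn x a ∨ E.Conn x b)
    (hoff : ∀ x y, ¬ (E.Conn x a ∨ E.Conn x b) → D.Conn x y → E.Conn x y) :
    E.numComponents ≤ D.numComponents := by
  classical
  let f : E.Component → D.Component := fun C =>
    if C = E.comp a then D.comp a else if C = E.comp b then D.comp c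
    else D.comp (exists_rep C).choose
  refine Nat.card_le_card_of_injective f ?_
  have hval : ∀ C, C ≠ E.comp a → C ≠ E.comp b → ∃ x, E.comp x = C ∧ f C = D.comp x ∧
      ¬ (E.Conn x a ∨ E.Conn x b) := by
    intro C h1 h2
    refine ⟨(exists_rep C).choose, (exists_rep C).choose_spec, by simp only [f, h1, h2, if_false],
      ?_⟩
    rw [← comp_eq_iff, ← comp_eq_iff, (exists_rep C).choose_spec]
    tauto
  have hvala : f (E.comp a) = D.comp a := by simp [f]
  have hvalb : E.comp b ≠ E.comp a → f (E.comp b) = D.comp c := fun h1 => by simp [f, h1]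
  have hother : ∀ C, C ≠ E.comp a → C ≠ E.comp b → f C ≠ D.comp a ∧ f C ≠ D.comp c := by
    intro C h1 h2
    obtain ⟨x, -, h4, h5⟩ := hval C h1 h2
    rw [h4, Ne, Ne, comp_eq_iff, comp_eq_iff, ← not_or]
    exact fun h6 => h5 (hmem x h6)
  have hne' : D.comp a ≠ D.comp c := by rwa [Ne, comp_eq_iff]
  intro C C' hCC
  by_cases h1 : C = E.comp a
  · subst h1
    by_cases h2 : C' = E.comp a
    · exact h2.symm
    by_cases h3 : C' = E.comp b
    · subst h3; rw [hvala, hvalb h2] at hCC; exact absurd hCC hne'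
    · exact absurd (hCC.symm.trans hvala) (hother C' h2 h3).1
  by_cases h1' : C = E.comp b
  · subst h1'
    by_cases h2 : C' = E.comp a
    · subst h2; rw [hvala, hvalb h1] at hCC; exact absurd hCC.symm hne'
    by_cases h3 : C' = E.comp b
    · exact h3.symm
    · exact absurd (hCC.symm.trans (hvalb h1)) (hother C' h2 h3).2
  by_cases h2 : C' = E.comp a
  · subst h2; exact absurd (hCC.trans hvala) (hother C h1 h1').1
  by_cases h3 : C' = E.comp b
  · subst h3; exact absurd (hCC.trans (hvalb h2)) (hother C h1 h1').2
  obtain ⟨x, rfl, h4, h5⟩ := hval C h1 h1'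
  obtain ⟨y, rfl, h6, -⟩ := hval C' h2 h3
  rw [h4, h6, comp_eq_iff] at hCC
  exact comp_eq_iff.2 (hoff x y h5 hCC)

theorem numComponents_eq_of_reconnect
    (hr : HalfEdge.IsReconnect D.Conn E.Conn D.IsLine E.IsLine a b c) :
    E.numComponents = D.numComponents := by
  refine le_antisymm (numComponents_le_of_reconnect hr.ne (fun x => (hr.mem x).1) fun x y h1 h2 => ?_)
    (numComponents_le_of_reconnect hr.ne' (fun x => (hr.mem x).2)
    fun x y h1 h2 => ?_)
  · rw [← hr.mem] at h1
    exact (hr.off x y h1).1 h2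
  · exact (hr.off x y h1).2 h2

theorem reconnect_isLine_of_mem
    (hr : HalfEdge.IsReconnect D.Conn E.Conn D.IsLine E.IsLine a b c) {x : Node Λ h}
    (hx : D.Conn x a ∨ D.Conn x c) : D.IsLine x ∧ E.IsLine x := by
  constructor
  · rcases hx with h1 | h1
    · exact IsLine.of_conn hr.line_a h1.symm
    · exact IsLine.of_conn hr.line_c h1.symm
  · rcases (hr.mem x).1 hx with h1 | h1
    · exact IsLine.of_conn hr.line_a' h1.symm
    · exact IsLine.of_conn hr.line_b' h1.symm

theorem reconnect_endsOn_off
    (hr : HalfEdge.IsReconnect D.Conn E.Conn D.IsLine E.IsLine a b c)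
    (hfree : ∀ e, E.mate e = e ↔ D.mate e = e) {x : Node Λ h} (hx : ¬ (D.Conn x a ∨ D.Conn x c))
    (t : Bool) : E.EndsOn t x ↔ D.EndsOn t x := by
  refine exists_congr fun e => ?_
  rw [hfree, hr.off x e.1 hx]

theorem reconnect_isLine
    (hr : HalfEdge.IsReconnect D.Conn E.Conn D.IsLine E.IsLine a b c)
    (hfree : ∀ e, E.mate e = e ↔ D.mate e = e) (x : Node Λ h) : E.IsLine x ↔ D.IsLine x := by
  by_cases hx : D.Conn x a ∨ D.Conn x c
  · have := reconnect_isLine_of_mem hr hx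
    tauto
  · rw [isLine_iff_endsOn, isLine_iff_endsOn]
    exact exists_congr fun t => reconnect_endsOn_off hr hfree hx t

theorem reconnect_propagates_off
    (hr : HalfEdge.IsReconnect D.Conn E.Conn D.IsLine E.IsLine a b c)
    (hfree : ∀ e, E.mate e = e ↔ D.mate e = e) {x : Node Λ h} (hx : ¬ (D.Conn x a ∨ D.Conn x c)) :
    E.Propagates x ↔ D.Propagates x := by
  rw [Propagates, Propagates, reconnect_endsOn_off hr hfree hx, reconnect_endsOn_off hr hfree hx]

end Reconnect

namespace Surgery

variable (s : Surgery D E)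

/-- The components of `(i, l - 1)` and `(i, l)`, at least one of which is a circle, are merged. -/
def IsMerge : Prop := HalfEdge.IsMerge D.Conn E.Conn D.IsLine (s.lower s.i) (s.upper s.i)

/-- A component splits into the components of `i` and `j`, at least one of which is a circle. -/
def IsSplit : Prop := HalfEdge.IsMerge E.Conn D.Conn E.IsLine (s.lower s.i) (s.lower s.j)

/-- Two lines are cut and reconnected. -/
def IsReconnect : Prop :=
  HalfEdge.IsReconnect D.Conn E.Conn D.IsLine E.IsLine (s.lower s.i) (s.lower s.j) (s.upper s.i)

/-- The type of a surgery is determined by the change of the number of components. -/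
theorem trichotomy : (s.IsMerge ∧ D.numComponents = E.numComponents + 1) ∨
    (s.IsSplit ∧ E.numComponents = D.numComponents + 1) ∨
    (s.IsReconnect ∧ E.numComponents = D.numComponents) := by
  rcases s.saddle.trichotomy with hs | hs | hs
  · exact Or.inl ⟨hs, le_antisymm (numComponents_le_of_merge hs) (numComponents_lt_of_merge hs)⟩
  · exact Or.inr (Or.inl ⟨hs, le_antisymm (numComponents_le_of_merge hs)
      (numComponents_lt_of_merge hs)⟩)
  · exact Or.inr (Or.inr ⟨hs, numComponents_eq_of_reconnect hs⟩)

theorem free_iff' (s : Surgery D E) (e : Node Λ h × Bool) : D.mate e = e ↔ E.mate e = e :=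
  (s.free_iff e).symm

variable {s} {ν ν' : Fin (h + 1) → Λ.Weight}

/-! ### Orientations before and after a surgery -/

/-- Before a merge one of the two components is a circle, and its orientation can be adjusted to the
other component. -/
theorem IsMerge.exists_isOrientation (hs : s.IsMerge) (hν : D.IsOrientation ν) :
    ∃ ν', D.IsOrientation ν' ∧ E.IsOrientation ν' ∧
      ∀ x, ¬ E.Conn x (s.lower s.i) → lab ν' x = lab ν x := by
  by_cases h1 : lab ν (s.lower s.i) = lab ν (s.upper s.i)
  · exact ⟨ν, hν, s.isOrientation_of_lab_eq hν h1, fun _ _ => rfl⟩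
  have h2 : lab ν (s.lower s.i) = lab ν (s.upper s.i) + 1 := by
    revert h1
    generalize lab ν (s.lower s.i) = u
    generalize lab ν (s.upper s.i) = v
    revert u v; decide
  rcases hs.circle with hc | hc
  · obtain ⟨ν', h3, h4⟩ := hν.exists_flip (saturated_conn (s.lower s.i))
      fun x hx => (isLine_congr hx).not.1 hc
    refine ⟨ν', h3, s.isOrientation_of_lab_eq h3 ?_, fun x hx => ?_⟩
    · rw [h4, h4, ind_of_true (mem_conn_self _), ind_of_false (fun h5 => hs.ne (mem_conn_iff.1 h5)), h2,
        add_assoc,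
        zmod_two_add_self]
    · rw [h4, ind_of_false, add_zero]
      exact fun h5 => hx (merge_mono hs (Conn.symm (mem_conn_iff.1 h5)))
  · obtain ⟨ν', h3, h4⟩ := hν.exists_flip (saturated_conn (s.upper s.i))
      fun x hx => (isLine_congr hx).not.1 hc
    refine ⟨ν', h3, s.isOrientation_of_lab_eq h3 ?_, fun x hx => ?_⟩
    · rw [h4, h4, ind_of_true (mem_conn_self _), 
        ind_of_false (fun h5 => hs.ne (Conn.symm (mem_conn_iff.1 h5))), h2,
        add_zero]
    · rw [h4, ind_of_false, add_zero]
      exact fun h5 => hx ((merge_mono hs (Conn.symm (mem_conn_iff.1 h5))).trans s.conn_i.symm)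

/-- After a split one of the two components is a circle, and its orientation can be adjusted to the
other component. -/
theorem IsSplit.exists_isOrientation (hs : s.IsSplit) (hν : E.IsOrientation ν) :
    ∃ ν', D.IsOrientation ν' ∧ E.IsOrientation ν' ∧
      ∀ x, ¬ D.Conn x (s.lower s.i) → lab ν' x = lab ν x := by
  by_cases h1 : lab ν (s.lower s.j) =
      lab ν (s.lower s.i) + ind ((D.inner s.level).dotted s.i = false)
  · exact ⟨ν, s.isOrientation_of_lab_add hν h1, hν, fun _ _ => rfl⟩
  have h2 : lab ν (s.lower s.j) + 1 =
      lab ν (s.lower s.i) + ind ((D.inner s.level).dotted s.i = false) := by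
    revert h1
    generalize lab ν (s.lower s.i) + ind ((D.inner s.level).dotted s.i = false) = u
    generalize lab ν (s.lower s.j) = v
    revert u v; decide
  rcases hs.circle with hc | hc
  · obtain ⟨ν', h3, h4⟩ := hν.exists_flip (saturated_conn (s.lower s.i))
      fun x hx => (isLine_congr hx).not.1 hc
    refine ⟨ν', s.isOrientation_of_lab_add h3 ?_, h3, fun x hx => ?_⟩
    · rw [h4, h4, ind_of_true (mem_conn_self _), ind_of_false (fun h5 => hs.ne (mem_conn_iff.1 h5)), add_right_comm,
        ← h2, add_assoc, zmod_two_add_self]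
    · rw [h4, ind_of_false, add_zero]
      exact fun h5 => hx (merge_mono hs (Conn.symm (mem_conn_iff.1 h5)))
  · obtain ⟨ν', h3, h4⟩ := hν.exists_flip (saturated_conn (s.lower s.j))
      fun x hx => (isLine_congr hx).not.1 hc
    refine ⟨ν', s.isOrientation_of_lab_add h3 ?_, h3, fun x hx => ?_⟩
    · rw [h4, h4, ind_of_true (mem_conn_self _), 
        ind_of_false (fun h5 => hs.ne (Conn.symm (mem_conn_iff.1 h5))), add_zero,
        h2]
    · rw [h4, ind_of_false, add_zero]
      exact fun h5 => hx ((merge_mono hs (Conn.symm (mem_conn_iff.1 h5))).trans s.conn_lower.symm)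

theorem IsMerge.isOrientation (hs : s.IsMerge) (hν : D.IsOrientation ν) (hν' : E.IsOrientation ν') :
    D.IsOrientation ν' := by
  obtain ⟨ν₁, h1, h2, -⟩ := hs.exists_isOrientation hν
  refine s.isOrientation_of_lab_add hν' ?_
  have h3 := h2.lab_add hν' (merge_mono hs s.conn_lower)
  rw [s.lab_lower h1] at h3
  revert h3
  generalize lab ν₁ (s.lower s.i) = u
  generalize lab ν' (s.lower s.i) = v
  generalize lab ν' (s.lower s.j) = w
  generalize ind ((D.inner s.level).dotted s.i = false) = z
  revert u v w z; decide

theorem IsSplit.isOrientation (hs : s.IsSplit) (hν : E.IsOrientation ν) (hν' : D.IsOrientation ν') :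
    E.IsOrientation ν' := by
  obtain ⟨ν₁, h1, h2, -⟩ := hs.exists_isOrientation hν
  refine s.isOrientation_of_lab_eq hν' ?_
  have h3 := h1.lab_add hν' (merge_mono hs s.conn_i)
  rw [s.lab_i h2] at h3
  exact add_left_cancel h3

theorem IsReconnect.isOrientation (hs : s.IsReconnect) (h1 : D.IsOrientation ν)
    (h2 : E.IsOrientation ν) (hν' : D.IsOrientation ν') : E.IsOrientation ν' := by
  refine s.isOrientation_of_lab_eq hν' ?_
  rw [hν'.lab_eq_of_isLine h1 hs.line_a, hν'.lab_eq_of_isLine h1 hs.line_c, s.lab_i h2]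

theorem IsReconnect.isOrientation' (hs : s.IsReconnect) (h1 : D.IsOrientation ν)
    (h2 : E.IsOrientation ν) (hν' : E.IsOrientation ν') : D.IsOrientation ν' := by
  refine s.isOrientation_of_lab_add hν' ?_
  rw [hν'.lab_eq_of_isLine h2 hs.line_a', hν'.lab_eq_of_isLine h2 hs.line_b', s.lab_lower h1]

/-- Reconnecting two propagating lines of which one lies to the left of the other cannot result in
propagating lines again. -/
theorem IsReconnect.not_propagates (hs : s.IsReconnect) (h1 : D.IsOrientation ν)
    (h2 : E.IsOrientation ν) (hP : D.Propagates (s.lower s.i)) (hQ : D.Propagates (s.upper s.i)) :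
    ¬ E.Propagates (s.lower s.i) ∧ ¬ E.Propagates (s.lower s.j) := by
  have hboth : ¬ (E.Propagates (s.lower s.i) ∧ E.Propagates (s.lower s.j)) := by
    rintro ⟨hP', hQ'⟩
    -- Both pairs of lines have the same union `S`. The first line of the pair before the surgery
    -- contains the lower ends of the saddle, and the second one its upper ends, so `S` has odd parity at
    -- `i` by `h3`. The new lines contain one column each, so `S` has even parity at `i` by `h4`.
    have h3 := leftCount_add_of_propagates h1 hP hQ hs.ne
    have h4 := leftCount_add_of_propagates h2 hP' hQ' hs.ne'
    rw [s.leftCount_upper_i (s.saturatedOff_of_saturated (saturated_conn _)),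
      ← leftCount_union] at h3
    · rw [s.leftCount_lower_j (s.saturatedOff_of_saturated' (saturated_conn _)),
        ind_of_true (mem_conn_self _), add_right_comm, ← leftCount_union] at h4
      · have h5 : {z | D.Conn (s.lower s.i) z} ∪ {z | D.Conn (s.upper s.i) z} =
            {z | E.Conn (s.lower s.i) z} ∪ {z | E.Conn (s.lower s.j) z} := by
          ext z
          have := hs.mem z
          rw [conn_comm, conn_comm (y := s.upper s.i), conn_comm (y := s.lower s.i),
            conn_comm (y := s.lower s.j)] at this
          exact this
        rw [h5] at h3
        rw [h3] at h4
        exact absurd h4 (by decide)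
      · exact fun x h5 h6 => hs.ne' (h5.trans (Conn.symm h6))
    · exact fun x h5 h6 => hs.ne (h5.trans (Conn.symm h6))
  have hfree := s.free_iff
  -- Each of the four end points lies on one of the new lines, and no propagating line contains
  -- two end points on the same boundary.
  have hother : ∀ x y, (∀ z, D.Conn z (s.lower s.i) ∨ D.Conn z (s.upper s.i) →
      E.Conn z x ∨ E.Conn z y) → E.Propagates x → E.Propagates y := by
    intro x y hxy hx
    have key : ∀ b, D.EndsOn b (s.lower s.i) → D.EndsOn b (s.upper s.i) → E.EndsOn b y := by
      rintro b ⟨e, he, heb, hce⟩ ⟨f, hf, hfb, hcf⟩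
      rcases hxy e.1 (Or.inl hce.symm) with h3 | h3
      · rcases hxy f.1 (Or.inr hcf.symm) with h4 | h4
        · have := hx.unique_end ((hfree e).2 he) ((hfree f).2 hf) h3.symm h4.symm
            (heb.trans hfb.symm)
          subst this
          exact absurd (hce.trans hcf.symm) hs.ne
        · exact ⟨f, (hfree f).2 hf, hfb, h4.symm⟩
      · exact ⟨e, (hfree e).2 he, heb, h3.symm⟩
    exact ⟨key false hP.1 hQ.1, key true hP.2 hQ.2⟩
  exact ⟨fun h3 => hboth ⟨h3, hother _ _ (fun z hz => (hs.mem z).1 hz) h3⟩,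
    fun h3 => hboth ⟨hother _ _ (fun z hz => ((hs.mem z).1 hz).symm) h3, h3⟩⟩

end Surgery

end StackedDiagram

/-! ### Cutting a circle in two places -/

namespace HalfEdge

variable {N : Type} {σ σ' : N × Bool → N × Bool} {ω : N × Bool → ZMod 2} {a b c d : N × Bool}

/-- Any two edges whose end points have matching charges can be replaced by a saddle move. -/
theorem IsMating.exists_saddle (hσ : IsMating σ ω) (ha : σ a ≠ a) (hc : σ c ≠ c) (hca : c ≠ a)
    (hca' : c ≠ σ a) (hω : ω c = ω a + 1) : ∃ σ', Saddle σ σ' ω a (σ a) c (σ c) := by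
  classical
  set π : Equiv.Perm (N × Bool) := Equiv.swap (σ a) c with hπ
  have hππ : ∀ e, π (π e) = e := Equiv.swap_apply_self _ _
  have hωπ : ∀ e, ω (π e) = ω e := by
    intro e
    have h1 : ω (σ a) = ω c := by rw [hσ.charge a ha, hω]
    rw [hπ, Equiv.swap_apply_def]
    split_ifs with h2 h3
    · rw [h2, h1]
    · rw [h3, h1]
    · rfl
  have hac : a ≠ σ c := fun h1 => hca' (by rw [h1, hσ.invol])
  have hσ' : σ a ≠ σ c := fun h1 => hca (by rw [← hσ.invol c, ← h1, hσ.invol])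
  have h1 : π (σ a) = c := Equiv.swap_apply_left _ _
  have h2 : π c = σ a := Equiv.swap_apply_right _ _
  have h3 : ∀ e, e ≠ σ a → e ≠ c → π e = e := fun e => Equiv.swap_apply_of_ne_of_ne
  refine ⟨fun e => π (σ (π e)), hσ, ⟨fun e => ?_, hσ.charge_swap, fun e he => ?_⟩, rfl, rfl, ?_, ?_,
    ha.symm, hca.symm, hac, hca'.symm, hσ', hc.symm, fun e h4 h5 h6 h7 => ?_⟩
  · simp only [hππ, hσ.invol]
  · rw [hωπ, hσ.charge, hωπ]
    exact fun h4 => he (by rw [h4, hππ])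
  · simp only [h3 a ha.symm hca.symm, h1]
  · simp only [h1, h3 (σ c) hσ'.symm hc]
  · rw [h3 e h5 h6, h3]
    · exact fun h8 => h4 (by rw [← hσ.invol e, h8, hσ.invol])
    · exact fun h8 => h7 (by rw [← hσ.invol e, h8])

/-- Cutting a circle in two places results in two segments. -/
theorem Saddle.segments [Finite N] (h : Saddle σ σ' ω a b c d) (hac : Conn σ a.1 c.1)
    (hl : ¬ IsLine σ a.1) : Conn (cut σ a b c d) a.1 c.1 ∧ Conn (cut σ a b c d) b.1 d.1 ∧
      ¬ Conn (cut σ a b c d) a.1 b.1 ∧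
      ∀ x, Conn σ a.1 x ↔ Conn (cut σ a b c d) a.1 x ∨ Conn (cut σ a b c d) b.1 x := by
  have hab : ¬ Conn (cut σ a b c d) a.1 b.1 := fun h1 => (h.merge_of_conn h1).ne hac
  have had := h.not_cut_ad
  have hlb : ¬ IsLine σ b.1 := fun ⟨e, h1, h2⟩ => hl ⟨e, h1, h.conn_ab.trans h2⟩
  have h1 : Conn (cut σ a b c d) a.1 c.1 := by
    obtain ⟨f, h1, h2, h3, -⟩ := (h.exists_partner (Or.inl rfl)).resolve_right fun h4 => hl h4.1
    rcases h1 with rfl | rfl | rfl | rfl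
    · exact absurd rfl h2
    · exact absurd h3 hab
    · exact h3
    · exact absurd h3 had
  have h2 : Conn (cut σ a b c d) b.1 d.1 := by
    obtain ⟨f, h4, h2, h3, -⟩ := (h.exists_partner (Or.inr (Or.inl rfl))).resolve_right
      fun h4 => hlb h4.1
    rcases h4 with rfl | rfl | rfl | rfl
    · exact absurd h3.symm hab
    · exact absurd rfl h2
    · exact absurd (h1.trans h3.symm) hab
    · exact h3
  refine ⟨h1, h2, hab, fun x => ⟨fun hx => ?_, ?_⟩⟩
  · refine (h.saturated (p := fun y => Conn (cut σ a b c d) a.1 y ∨ Conn (cut σ a b c d) b.1 y)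
      (fun x y hxy => ?_) ?_ ?_ hx).1 (Or.inl (Conn.refl _))
    · exact ⟨Or.imp (fun h3 => h3.trans hxy) fun h3 => h3.trans hxy,
        Or.imp (fun h3 => h3.trans hxy.symm) fun h3 => h3.trans hxy.symm⟩
    · exact iff_of_true (Or.inl (Conn.refl _)) (Or.inr (Conn.refl _))
    · exact iff_of_true (Or.inl h1) (Or.inr h2)
  · rintro (hx | hx)
    · exact h.conn_of_cut hx
    · exact h.conn_ab.trans (h.conn_of_cut hx)

end HalfEdge

namespace StackedDiagram

variable {Λ : Block} {h : ℕ} {D E : StackedDiagram Λ h} {ν ν' : Fin (h + 1) → Λ.Weight}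

/-! ### Tags -/

/-- From a tag of a circle one reaches, going up along rays, a tag with a cap on top. -/
theorem IsOrientation.exists_cap (hν : D.IsOrientation ν) {i : Λ.Vertex} (l : Fin (h + 1)) :
    ¬ D.IsLine (i, l) → (∀ y, D.Conn (i, l) y → y.1 ≤ i) → ∃ (m : Fin (h + 1)) (u : Node Λ h),
      D.Conn (i, l) (i, m) ∧ lab ν (i, m) = lab ν (i, l) ∧ u.1 < i ∧
        D.mate ((i, m), true) = (u, true) := by
  induction l using Fin.reverseInduction with
  | last =>
    intro hl hi
    have h1 := hi _ (conn_mate ((i, Fin.last h), true))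
    rw [mate_last] at h1
    by_cases h2 : D.mu.cupDiagram.partner i = i
    · exact absurd ⟨((i, Fin.last h), true), by rw [mate_last, h2], Conn.refl _⟩ hl
    · exact ⟨_, _, Conn.refl _, rfl, lt_of_le_of_ne h1 h2, mate_last D i⟩
  | cast s ih =>
    intro hl hi
    have h1 := conn_mate (D := D) ((i, s.castSucc), true)
    have h2 := hν.lab_mate ((i, s.castSucc), true)
    by_cases h3 : (D.inner s).partner i = i
    · rw [D.mate_up_of_ray i s h3] at h1 h2
      rw [kink, ind_of_false (by simp [h3]), add_zero] at h2
      obtain ⟨m, u, h4, h5, h6⟩ := ih (fun h4 => hl (h4.of_conn h1.symm))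
        fun y hy => hi y (h1.trans hy)
      exact ⟨m, u, h1.trans h4, h5.trans h2, h6⟩
    · have h4 := D.mate_castSucc i s
      rw [if_neg h3] at h4
      rw [h4] at h1
      exact ⟨_, _, Conn.refl _, rfl, lt_of_le_of_ne (hi _ h1) h3, h4⟩

/-- The caps at two tags cut the circle into two segments. Modulo two, exactly one of them passes an
odd number of times to the left of the first tag. There are no dots on the other segment, nor on one
of the two caps, so that the twisted labels of the tags agree. -/
theorem IsOrientation.lab_eq_of_caps (hν : D.IsOrientation ν) {i : Λ.Vertex} {l m : Fin (h + 1)}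
    {u v : Node Λ h} (hl : ¬ D.IsLine (i, l)) (hi : ∀ y, D.Conn (i, l) y → y.1 ≤ i)
    (hlm : D.Conn (i, l) (i, m)) (hu : u.1 < i) (hv : v.1 < i)
    (hmu : D.mate ((i, l), true) = (u, true)) (hmv : D.mate ((i, m), true) = (v, true)) :
    lab ν (i, l) = lab ν (i, m) := by
  -- The caps at the tags are changed by an abstract saddle move, so that `τ` below is the graph
  -- in which both caps are cut. Its segments join `(i, l)` to `v` and `u` to `(i, m)`.
  rcases eq_or_ne l m with rfl | hne
  · rfl
  have hmu' : D.mate (u, true) = ((i, l), true) := by rw [← hmu, mate_mate]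
  have hmv' : D.mate (v, true) = ((i, m), true) := by rw [← hmv, mate_mate]
  obtain ⟨σ', hs⟩ := D.isMating.exists_saddle (a := ((i, l), true)) (c := (v, true))
    (by rw [hmu]; intro h1; rw [Prod.mk.injEq] at h1; exact hu.ne (congrArg Prod.fst h1.1))
    (by rw [hmv']; intro h1; rw [Prod.mk.injEq] at h1; exact hv.ne' (congrArg Prod.fst h1.1))
    (by intro h1; rw [Prod.mk.injEq] at h1; exact hv.ne (congrArg Prod.fst h1.1))
    (by
      rw [hmu]; intro h1
      rw [h1, hmu'] at hmv'
      simp only [Prod.mk.injEq, and_true, true_and] at hmv'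
      exact hne hmv')
    (by
      have := D.isMating.charge ((i, m), true) (by
        rw [hmv]; intro h1; rw [Prod.mk.injEq] at h1; exact hv.ne (congrArg Prod.fst h1.1))
      rw [hmv] at this
      exact this)
  rw [hmu, hmv'] at hs
  have hcv := conn_mate (D := D) ((i, m), true)
  rw [hmv] at hcv
  obtain ⟨htv, hut, htu, hK⟩ := hs.segments (hlm.trans hcv) hl
  set τ := HalfEdge.cut D.mate ((i, l), true) (u, true) (v, true) ((i, m), true) with hτ
  have hτD : ∀ {x y}, HalfEdge.Conn τ x y → D.Conn x y := fun hxy => hs.conn_of_cut hxy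
  -- The segments are compatible with all arcs to the left of the column of the tags.
  have hcompat : ∀ (x : Node Λ h) (f : Node Λ h × Bool), f.1.1 < i → (D.mate f).1.1 < i →
      (f.1 ∈ {y | HalfEdge.Conn τ x y} ↔ (D.mate f).1 ∈ {y | HalfEdge.Conn τ x y}) := by
    intro x f h1 h2
    have h3 : τ f = D.mate f := by
      refine HalfEdge.cut_of_notMem ?_
      rintro (rfl | rfl | rfl | rfl)
      · exact lt_irrefl _ h1
      · rw [hmu'] at h2; exact lt_irrefl _ h2
      · rw [hmv'] at h2; exact lt_irrefl _ h2
      · exact lt_irrefl _ h1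
    have h4 := HalfEdge.conn_mate τ f
    rw [h3] at h4
    exact ⟨fun h5 => HalfEdge.Conn.trans h5 h4, fun h5 => HalfEdge.Conn.trans h5 h4.symm⟩
  -- If one segment has odd parity to the left of the other one, then there are no dots on the latter.
  have hconst : ∀ x y z : Node Λ h, ¬ HalfEdge.Conn τ x y → HalfEdge.Conn τ y z →
      D.Conn (i, l) y → leftCount {w | HalfEdge.Conn τ x w} y = leftCount {w | HalfEdge.Conn τ x w} z ∧
        (leftCount {w | HalfEdge.Conn τ x w} y ≠ 0 → twist ν y = twist ν z) := by
    intro x y z hxy hyz hy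
    have key := HalfEdge.Conn.minimal (σ := τ)
      (r := fun y z => (D.Conn (i, l) y ↔ D.Conn (i, l) z) ∧
        (HalfEdge.Conn τ x y ↔ HalfEdge.Conn τ x z) ∧
        (D.Conn (i, l) y → ¬ HalfEdge.Conn τ x y →
          leftCount {w | HalfEdge.Conn τ x w} y = leftCount {w | HalfEdge.Conn τ x w} z ∧
          (leftCount {w | HalfEdge.Conn τ x w} y ≠ 0 → twist ν y = twist ν z)))
      ⟨fun y => ⟨Iff.rfl, Iff.rfl, fun _ _ => ⟨rfl, fun _ => rfl⟩⟩, ?_, ?_⟩ ?_ hyz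
    · exact key.2.2 hy hxy
    · rintro y z ⟨h1, h2, h3⟩
      refine ⟨h1.symm, h2.symm, fun h4 h5 => ?_⟩
      obtain ⟨h6, h7⟩ := h3 (h1.2 h4) (by rwa [h2])
      exact ⟨h6.symm, fun h8 => (h7 (by rwa [h6])).symm⟩
    · rintro y z w ⟨h1, h2, h3⟩ ⟨h1', h2', h3'⟩
      refine ⟨h1.trans h1', h2.trans h2', fun h4 h5 => ?_⟩
      obtain ⟨h6, h7⟩ := h3 h4 h5
      obtain ⟨h8, h9⟩ := h3' (h1.1 h4) (by rwa [← h2])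
      exact ⟨h6.trans h8, fun h10 => (h7 h10).trans (h9 (by rwa [← h6]))⟩
    · intro e
      by_cases he : e = ((i, l), true) ∨ e = (u, true) ∨ e = (v, true) ∨ e = ((i, m), true)
      · rw [hτ, HalfEdge.cut_of_mem he]
        exact ⟨Iff.rfl, Iff.rfl, fun _ _ => ⟨rfl, fun _ => rfl⟩⟩
      · have h1 : HalfEdge.Conn τ e.1 (τ e).1 := HalfEdge.conn_mate τ e
        have h2 : HalfEdge.Conn τ x e.1 ↔ HalfEdge.Conn τ x (τ e).1 :=
          ⟨fun h3 => h3.trans h1, fun h3 => h3.trans h1.symm⟩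
        have h2' : D.Conn (i, l) e.1 ↔ D.Conn (i, l) (τ e).1 :=
          ⟨fun h3 => h3.trans (hτD h1), fun h3 => h3.trans (hτD h1).symm⟩
        refine ⟨h2', h2, fun h4 h5 => ?_⟩
        have h6 : τ e = D.mate e := HalfEdge.cut_of_notMem he
        have h7 := hi _ h4
        have h8 := hi _ (h2'.1 h4)
        rw [h6] at h2 h8 ⊢
        obtain ⟨h9, h10⟩ := D.leftCount_mate (S := {w | HalfEdge.Conn τ x w}) (e := e) h5
          (fun h9 => h5 (h2.2 h9)) fun f h9 h10 =>
            hcompat x f (h9.trans_le (max_le h7 h8)) (h10.trans_le (max_le h7 h8))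
        refine ⟨h9.symm, fun h11 => ?_⟩
        rw [hν.twist_mate, show D.dot e = 0 by by_contra h12; exact h11 (h10 h12), add_zero]
  -- A cap at a tag is undotted if a segment has odd parity to the left of it.
  have hdot : ∀ (x w t : Node Λ h), w.1 < i → t.1 = i → D.mate (w, true) = (t, true) →
      leftCount {y | HalfEdge.Conn τ x y} w ≠ 0 → twist ν t = twist ν w := by
    intro x w t hw ht hwt h1
    have h2 := hν.twist_mate (w, true)
    rw [hwt] at h2
    rw [h2, dot, ind_of_false, add_zero]
    rintro ⟨-, h3⟩
    refine h1 (D.leftCount_dotted (e := (w, true)) h3 (by rw [hwt]; exact hw.le.trans ht.ge) ?_)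
    exact fun f h4 h5 => hcompat x f (h4.trans hw) (h5.trans hw)
  have htwist : twist ν (i, l) = twist ν (i, m) := by
    -- The circle has an even number of vertices on the level of the tag, which is the rightmost one.
    have h1 : leftCount {y | D.Conn (i, l) y} (i, l) = 1 := by
      have h2 := (saturated_conn (D := D) (i, l)).sum_level
        (fun e he h3 => hl ⟨e, he, h3⟩) l
      rw [← Finset.sum_filter_add_sum_filter_not _ (fun k => k < i)] at h2
      have h3 : ∑ k with ¬ k < i, ind ((k, l) ∈ {y | D.Conn (i, l) y}) = 1 := by
        rw [Finset.sum_eq_single i, ind_of_true (mem_conn_self _)]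
        · exact fun k hk hki => ind_of_false fun h3 =>
            (Finset.mem_filter.1 hk).2 (lt_of_le_of_ne (hi _ h3) hki)
        · intro h3; simp at h3
      rw [h3, zmod_two_add_eq_zero] at h2
      exact h2
    have h2 : {y | D.Conn (i, l) y} =
        {y | HalfEdge.Conn τ (i, l) y} ∪ {y | HalfEdge.Conn τ u y} := by
      ext y; exact hK y
    have hdisj : ∀ x ∈ {y | HalfEdge.Conn τ (i, l) y}, x ∉ {y | HalfEdge.Conn τ u y} :=
      fun x h3 h4 => htu (HalfEdge.Conn.trans h3 (HalfEdge.Conn.symm h4))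
    rw [h2, leftCount_union hdisj] at h1
    have hDu : D.Conn (i, l) u := by
      have := conn_mate (D := D) ((i, l), true)
      rwa [hmu] at this
    by_cases h3 : leftCount {y | HalfEdge.Conn τ u y} (i, l) = 0
    · have h4 : leftCount {y | HalfEdge.Conn τ (i, l) y} u ≠ 0 := by
        have h5 := D.leftCount_cup (e := (u, true)) (S := {y | HalfEdge.Conn τ (i, l) y})
          (by rw [hmu']; exact hu) (by rw [hmu']; exact fun f => hcompat _ f)
        rw [hmu', ind_of_false (show (u, true).1 ∉ {y | HalfEdge.Conn τ (i, l) y} from htu),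
          add_zero] at h5
        rw [← h5]
        rw [h3, add_zero] at h1
        rw [h1]; exact one_ne_zero
      rw [hdot _ u (i, l) hu rfl hmu' h4]
      exact (hconst _ _ _ htu hut hDu).2 h4
    · obtain ⟨h4, h5⟩ := hconst u (i, l) v (fun h4 => htu h4.symm) htv (Conn.refl _)
      rw [h5 h3, hdot u v (i, m) hv rfl hmv' (by rwa [← h4])]
  exact add_left_cancel htwist

/-- All tags of a circle have the same label. -/
theorem IsOrientation.lab_tag (hν : D.IsOrientation ν) {s t : Node Λ h} (hs : ¬ D.IsLine s)
    (hst : D.Conn s t) (hs' : D.IsTag s) (ht' : D.IsTag t) : lab ν s = lab ν t := by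
  obtain ⟨i, l⟩ := s
  obtain ⟨j, m⟩ := t
  obtain rfl : i = j := le_antisymm (ht' (i, l) (comp_eq_iff.2 hst)) (hs' (j, m) (comp_eq_iff.2 hst.symm))
  have hi : ∀ l, D.Conn (i, l) (i, m) → ∀ y, D.Conn (i, l) y → y.1 ≤ i := fun l hl y hy =>
    ht' y (comp_eq_iff.2 (hy.symm.trans hl))
  obtain ⟨l', u, h1, h2, h3, h4⟩ := hν.exists_cap l hs (hi l hst)
  obtain ⟨m', v, h5, h6, h7, h8⟩ := hν.exists_cap m ((isLine_congr hst).not.1 hs)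
    (hi m (Conn.refl _))
  rw [← h2, ← h6]
  exact hν.lab_eq_of_caps ((isLine_congr h1).not.1 hs) (hi l' (h1.symm.trans hst))
    (h1.symm.trans (hst.trans h5)) h3 h7 h4 h8

theorem exists_tag (D : StackedDiagram Λ h) (x : Node Λ h) : ∃ t, D.Conn x t ∧ D.IsTag t := by
  classical
  obtain ⟨t, h1, h2⟩ := Finset.exists_max_image (Finset.univ.filter fun y => D.Conn x y)
    (fun y => y.1) ⟨x, Finset.mem_filter.2 ⟨Finset.mem_univ _, Conn.refl _⟩⟩
  have h3 := (Finset.mem_filter.1 h1).2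
  exact ⟨t, h3, fun y hy => h2 y (Finset.mem_filter.2 ⟨Finset.mem_univ _,
    h3.trans (comp_eq_iff.1 hy).symm⟩)⟩

/-! ### Clockwise circles and signs -/

namespace Orientation

variable (ν : D.Orientation)

/-- The component of the vertex is a clockwise circle. -/
def Cw (x : Node Λ h) : Prop := ν.Clockwise (D.comp x)

variable {ν}

theorem Cw.not_isLine {x : Node Λ h} (hx : ν.Cw x) : ¬ D.IsLine x := isCircle_iff.1 hx.1

theorem cw_congr {x y : Node Λ h} (hxy : D.Conn x y) : ν.Cw x ↔ ν.Cw y := by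
  rw [Cw, Cw, comp_eq_iff.2 hxy]

theorem cw_iff_of_tag {x t : Node Λ h} (hx : ¬ D.IsLine x) (hxt : D.Conn x t) (ht : D.IsTag t) :
    ν.Cw x ↔ lab ν.1 t = 0 := by
  have hlab : ∀ t, lab ν.1 t = 0 ↔ ¬ ν.Up t := fun t => ind_eq_zero
  constructor
  · rintro ⟨-, t', h1, h2, h3⟩
    have h4 := comp_eq_iff.1 h1
    rwa [← ν.2.lab_tag ((isLine_congr h4.symm).not.1 hx) (h4.trans hxt) h2 ht, hlab]
  · exact fun h1 => ⟨isCircle_iff.2 hx, t, comp_eq_iff.2 hxt.symm, ht, (hlab t).1 h1⟩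

/-- Two orientations differ exactly on those circles to which they give different senses of
rotation. -/
theorem lab_add_lab (ν ν' : D.Orientation) (x : Node Λ h) :
    lab ν.1 x + lab ν'.1 x = ind (ν.Cw x) + ind (ν'.Cw x) := by
  by_cases hx : D.IsLine x
  · rw [ν.2.lab_eq_of_isLine ν'.2 hx, ind_of_false fun h1 => h1.not_isLine hx,
      ind_of_false fun h1 => h1.not_isLine hx, zmod_two_add_self, zmod_two_add_self]
  · obtain ⟨t, h1, h2⟩ := D.exists_tag x
    rw [ν.2.lab_add ν'.2 h1, ind_inj.2 (cw_iff_of_tag (ν := ν) hx h1 h2),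
      ind_inj.2 (cw_iff_of_tag (ν := ν') hx h1 h2)]
    have key : ∀ u : ZMod 2, ind (u = 0) = u + 1 := fun u => by
      rcases zmod_two_cases u with rfl | rfl
      · rw [ind_of_true rfl, zero_add]
      · rw [ind_of_false one_ne_zero, zmod_two_add_self]
    rw [key, key]
    generalize lab ν.1 t = u
    generalize lab ν'.1 t = v
    revert u v; decide

theorem ext_cw {ν ν' : D.Orientation} (hν : ∀ x, ν.Cw x ↔ ν'.Cw x) : ν = ν' := by
  refine Subtype.ext (lab_ext fun x => ?_)
  have := lab_add_lab ν ν' x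
  rw [ind_inj.2 (hν x), zmod_two_add_self] at this
  exact zmod_two_add_eq_zero.1 this

/-- Every set of circles is the set of clockwise circles of an orientation. -/
theorem exists_cw (ν : D.Orientation) {T : Set (Node Λ h)} (hT : D.Saturated T)
    (hT' : ∀ x ∈ T, ¬ D.IsLine x) : ∃ ν' : D.Orientation, ∀ x, ν'.Cw x ↔ x ∈ T := by
  obtain ⟨ν', h1, h2⟩ := ν.2.exists_flip (S := {x | ¬ (ν.Cw x ↔ x ∈ T)})
    (fun e => not_congr (iff_congr (cw_congr (conn_mate e)) (hT e))) (fun x hx hl => hx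
      (iff_of_false (fun h1 => h1.not_isLine hl) fun h1 => hT' x h1 hl))
  refine ⟨⟨ν', h1⟩, fun x => ?_⟩
  have h3 := lab_add_lab ν ⟨ν', h1⟩ x
  rw [show lab (⟨ν', h1⟩ : D.Orientation).1 x = _ from h2 x] at h3
  rw [← ind_inj]
  have key : ind (x ∈ {x | ¬ (ν.Cw x ↔ x ∈ T)}) = ind (ν.Cw x) + ind (x ∈ T) := by
    by_cases h4 : ν.Cw x <;> by_cases h5 : x ∈ T <;>
      (simp [ind, h4, h5]; try decide)
  rw [key] at h3
  revert h3
  generalize lab ν.1 x = u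
  generalize ind (ν.Cw x) = v
  generalize ind (x ∈ T) = w
  generalize ind _ = z
  revert u v w z; decide

end Orientation

/-- The nontrivial character of `ZMod 2`. -/
noncomputable def chi (u : ZMod 2) : ℂ := if u = 0 then 1 else -1

@[simp] theorem chi_zero : chi 0 = 1 := if_pos rfl

@[simp] theorem chi_one : chi 1 = -1 := if_neg one_ne_zero

theorem chi_add (u v : ZMod 2) : chi (u + v) = chi u * chi v := by
  rcases zmod_two_cases u with rfl | rfl <;> rcases zmod_two_cases v with rfl | rfl <;>
    simp [zmod_two_add_self]

theorem chi_mul_self (u : ZMod 2) : chi u * chi u = 1 := by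
  rw [← chi_add, zmod_two_add_self, chi_zero]

theorem chi_natCast (n : ℕ) : chi n = (-1) ^ n := by
  induction n with
  | zero => simp
  | succ n ih => rw [Nat.cast_succ, chi_add, ih, chi_one, pow_succ]

theorem Path.conn {x y : Node Λ h} {n : ℕ} (hp : D.Path x y n) : D.Conn x y := by
  induction hp with
  | nil => exact Conn.refl _
  | snoc _ hs ih =>
    obtain ⟨b, rfl, -⟩ := hs.exists_mate
    exact ih.trans (conn_mate (_, b))

theorem IsOrientation.lab_path (hν : D.IsOrientation ν) {x y : Node Λ h} {n : ℕ}
    (hp : D.Path x y n) : lab ν y = lab ν x + n := by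
  induction hp with
  | nil => simp
  | snoc _ hs ih =>
    obtain ⟨b, rfl, h2⟩ := hs.exists_mate
    rw [hν.lab_mate, ih, Nat.cast_add, h2, add_assoc]

/-- The sign of a vertex on a circle compares its label with the label of the tag. -/
theorem Orientation.sign_eq (ν : D.Orientation) {x : Node Λ h} (hx : ¬ D.IsLine x) :
    D.sign x = chi (lab ν.1 x + 1 + ind (ν.Cw x)) := by
  obtain ⟨t, h1, h2⟩ := D.exists_tag x
  have hval : lab ν.1 x + 1 + ind (ν.Cw x) = lab ν.1 x + lab ν.1 t := by
    rw [ind_inj.2 (cw_iff_of_tag (ν := ν) hx h1 h2), add_assoc]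
    congr 1
    rcases zmod_two_cases (lab ν.1 t) with h3 | h3 <;> rw [h3]
    · rw [ind_of_true rfl]; decide
    · rw [ind_of_false one_ne_zero, add_zero]
  have hpath : ∀ {t' n}, D.IsTag t' → D.Path x t' n → (n : ZMod 2) = lab ν.1 x + lab ν.1 t := by
    intro t' n h3 h4
    rw [h1.symm.trans h4.conn |> fun h5 => ν.2.lab_tag ((isLine_congr h1).not.1 hx) h5 h2 h3,
      ν.2.lab_path h4, ← add_assoc, zmod_two_add_self, zero_add]
  rw [hval, sign]
  split_ifs with h3
  · obtain ⟨t', n, h4, h5, h6⟩ := h3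
    rw [← hpath h4 h5, (ZMod.natCast_eq_zero_iff_even).2 h6, chi_zero]
  · obtain ⟨n, hn⟩ := h1.exists_path
    have h4 : ¬ Even n := fun h4 => h3 ⟨t, n, h2, hn, h4⟩
    rw [← hpath h2 hn, show (n : ZMod 2) = 1 from
      zmod_two_ne_zero.1 fun h5 => h4 ((ZMod.natCast_eq_zero_iff_even).1 h5), chi_one]

end StackedDiagram

namespace StackedDiagram

variable {Λ : Block} {h : ℕ} {D E : StackedDiagram Λ h}

/-! ### The basis indexed by sets of clockwise circles -/

open Classical in
/-- The basis vector given by the orientation for which `T` is the set of vertices on clockwise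
circles. It is zero if there is no such orientation. -/
noncomputable def basisVec (D : StackedDiagram Λ h) (T : Set (Node Λ h)) : D.Space :=
  if hT : ∃ ν : D.Orientation, ∀ x, ν.Cw x ↔ x ∈ T then Finsupp.single hT.choose 1 else 0

theorem basisVec_eq {T : Set (Node Λ h)} (ν : D.Orientation) (hν : ∀ x, ν.Cw x ↔ x ∈ T) :
    D.basisVec T = Finsupp.single ν 1 := by
  have hT : ∃ ν : D.Orientation, ∀ x, ν.Cw x ↔ x ∈ T := ⟨ν, hν⟩
  rw [basisVec, dif_pos hT,
    Orientation.ext_cw (ν' := ν) fun x => (hT.choose_spec x).trans (hν x).symm]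

theorem basisVec_cw (ν : D.Orientation) : D.basisVec {x | ν.Cw x} = Finsupp.single ν 1 :=
  basisVec_eq ν fun _ => Iff.rfl

theorem basisVec_of_isLine {T : Set (Node Λ h)} {x : Node Λ h} (hx : x ∈ T) (hl : D.IsLine x) :
    D.basisVec T = 0 :=
  dif_neg fun ⟨_, hν⟩ => ((hν x).2 hx).not_isLine hl

theorem Orientation.saturated_cw (ν : D.Orientation) : D.Saturated {x | ν.Cw x} := fun e =>
  Orientation.cw_congr (conn_mate e)

/-- If `D` is orientable, then a union of components containing no line gives a basis vector. -/
theorem basisVec_cases (ν : D.Orientation) {T : Set (Node Λ h)} (hT : D.Saturated T) :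
    (∃ x ∈ T, D.IsLine x) ∨ ∃ ν : D.Orientation, ∀ x, ν.Cw x ↔ x ∈ T := by
  by_cases hl : ∃ x ∈ T, D.IsLine x
  · exact Or.inl hl
  · push Not at hl
    exact Or.inr (ν.exists_cw hT hl)

theorem Saturated.union {S T : Set (Node Λ h)} (hS : D.Saturated S) (hT : D.Saturated T) :
    D.Saturated (S ∪ T) := fun e => or_congr (hS e) (hT e)

theorem saturated_empty : D.Saturated ∅ := fun _ => Iff.rfl

/-- A linear map on `V(D)` is determined by its values on the vectors `basisVec T` for unions `T` of
components. -/
theorem lhom_ext {M : Type*} [AddCommGroup M] [Module ℂ M] {f g : D.Space →ₗ[ℂ] M}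
    (hfg : ∀ T, D.Saturated T → f (D.basisVec T) = g (D.basisVec T)) : f = g := by
  refine Finsupp.lhom_ext' fun ν => LinearMap.ext_ring ?_
  have := hfg _ ν.saturated_cw
  rwa [basisVec_cw] at this

theorem basisVec_of_isEmpty (hD : IsEmpty D.Orientation) (T : Set (Node Λ h)) :
    D.basisVec T = 0 :=
  dif_neg fun ⟨ν, _⟩ => hD.elim ν

/-! ### The operators reversing circles -/

open Classical in
/-- The operator making the circle through `x` clockwise, multiplied by the sign of `x`. It kills
the orientations for which this circle is clockwise already, and it is zero if `x` lies on a line.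
-/
noncomputable def turn (D : StackedDiagram Λ h) (x : Node Λ h) : D.Space →ₗ[ℂ] D.Space :=
  Finsupp.linearCombination ℂ fun ν : D.Orientation =>
    if ν.Cw x then 0 else D.sign x • D.basisVec ({y | ν.Cw y} ∪ {y | D.Conn x y})

open Classical in
theorem turn_basisVec {T : Set (Node Λ h)} (hT : D.Saturated T) (x : Node Λ h) :
    D.turn x (D.basisVec T) =
      if x ∈ T then 0 else D.sign x • D.basisVec (T ∪ {y | D.Conn x y}) := by
  by_cases hν : ∃ ν : D.Orientation, ∀ x, ν.Cw x ↔ x ∈ T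
  · obtain ⟨ν, hν⟩ := hν
    obtain rfl : {y | ν.Cw y} = T := Set.ext hν
    rw [basisVec_cw, turn, Finsupp.linearCombination_single, one_smul]
    rfl
  · rw [show D.basisVec T = 0 from dif_neg hν, map_zero]
    split_ifs with hx
    · rfl
    have h0 : D.basisVec (T ∪ {y | D.Conn x y}) = 0 := dif_neg fun ⟨ν', hν'⟩ =>
      hν (ν'.exists_cw hT fun y hy => ((hν' y).2 (Or.inl hy)).not_isLine)
    rw [h0, smul_zero]

theorem turn_of_isLine {x : Node Λ h} (hx : D.IsLine x) : D.turn x = 0 := by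
  refine lhom_ext fun T hT => ?_
  rw [turn_basisVec hT, basisVec_of_isLine (x := x) (Or.inr (Conn.refl _)) hx]
  simp

theorem conn_set_congr {x y : Node Λ h} (hxy : D.Conn x y) :
    {z | D.Conn x z} = {z | D.Conn y z} :=
  Set.ext fun _ => ⟨fun hz => hxy.symm.trans hz, fun hz => hxy.trans hz⟩

theorem sign_mul_self (D : StackedDiagram Λ h) (x : Node Λ h) : D.sign x * D.sign x = 1 := by
  rw [sign]; split_ifs <;> norm_num

theorem turn_comm (x y : Node Λ h) (v : D.Space) :
    D.turn x (D.turn y v) = D.turn y (D.turn x v) := by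
  suffices hxy : D.turn x ∘ₗ D.turn y = D.turn y ∘ₗ D.turn x from LinearMap.congr_fun hxy v
  refine lhom_ext fun T hT => ?_
  have hx := hT.union (saturated_conn (D := D) x)
  have hy := hT.union (saturated_conn (D := D) y)
  have h1 : y ∈ T ∪ {z | D.Conn x z} ↔ y ∈ T ∨ D.Conn x y := Iff.rfl
  have h2 : x ∈ T ∪ {z | D.Conn y z} ↔ x ∈ T ∨ D.Conn y x := Iff.rfl
  have h3 : D.Conn y x ↔ D.Conn x y := conn_comm
  simp only [LinearMap.comp_apply, turn_basisVec hT]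
  by_cases h4 : x ∈ T <;> by_cases h5 : y ∈ T <;> by_cases h6 : D.Conn x y <;>
    simp only [h4, h5, h6, if_true, if_false, map_zero, map_smul, turn_basisVec hx,
      turn_basisVec hy, h1, h2, h3, or_true, or_false, smul_zero]
  rw [smul_comm, Set.union_right_comm]

/-- The vector space is generated by the orientation without clockwise circles under the operators
`turn`. -/
theorem lhom_ext_turn {M : Type*} [AddCommGroup M] [Module ℂ M] {f g : D.Space →ₗ[ℂ] M}
    (h0 : f (D.basisVec ∅) = g (D.basisVec ∅))
    (hfg : ∀ x v, f v = g v → f (D.turn x v) = g (D.turn x v)) : f = g := by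
  have key : ∀ (n : ℕ) (T : Set (Node Λ h)), T.ncard = n → D.Saturated T →
      f (D.basisVec T) = g (D.basisVec T) := by
    intro n
    induction n using Nat.strong_induction_on with
    | _ n ih =>
      intro T hn hT
      rcases T.eq_empty_or_nonempty with rfl | ⟨x, hx⟩
      · exact h0
      · have h1 : D.Saturated (T \ {y | D.Conn x y}) := fun e =>
          and_congr (hT e) (not_congr (saturated_conn (D := D) x e))
        have h2 : x ∉ T \ {y | D.Conn x y} := fun h2 => h2.2 (Conn.refl _)
        have h3 : T = T \ {y | D.Conn x y} ∪ {y | D.Conn x y} := by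
          rw [Set.sdiff_union_of_subset]
          exact fun y hy => (hT.mem_iff hy).1 hx
        have h4 := hfg x _ (ih _ (by
          rw [← hn]
          exact Set.ncard_lt_ncard ⟨Set.sdiff_subset, fun h4 => h2 (h4 hx)⟩ T.toFinite) _ rfl h1)
        rw [turn_basisVec h1, if_neg h2, ← h3, map_smul, map_smul] at h4
        have h5 := congrArg (D.sign x • ·) h4
        simpa only [smul_smul, sign_mul_self, one_smul] using h5
  exact lhom_ext fun T hT => key _ T rfl hT

/-- The operator `turn x` depends on the vertex `x` of a component only through its label. -/
theorem turn_of_conn (ν : D.Orientation) {x y : Node Λ h} (hxy : D.Conn x y) :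
    D.turn x = chi (lab ν.1 x + lab ν.1 y) • D.turn y := by
  by_cases hx : D.IsLine x
  · rw [turn_of_isLine hx, turn_of_isLine (hx.of_conn hxy), smul_zero]
  have hy := (isLine_congr hxy).not.1 hx
  have hsign : D.sign x = chi (lab ν.1 x + lab ν.1 y) * D.sign y := by
    rw [ν.sign_eq hx, ν.sign_eq hy, ← chi_add, ind_inj.2 (Orientation.cw_congr hxy)]
    congr 1
    generalize lab ν.1 x = u
    generalize lab ν.1 y = v
    generalize ind (ν.Cw y) = w
    revert u v w; decide
  refine lhom_ext fun T hT => ?_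
  rw [LinearMap.smul_apply, turn_basisVec hT, turn_basisVec hT, conn_set_congr hxy, hsign]
  by_cases h1 : y ∈ T
  · rw [if_pos h1, if_pos ((hT.mem_iff hxy).2 h1), smul_zero]
  · rw [if_neg h1, if_neg fun h2 => h1 ((hT.mem_iff hxy).1 h2), smul_smul]

/-- The operator `turn x`, normalized by means of an orientation in such a way that it depends only
on the component of `x`. -/
noncomputable def loop (ν : D.Orientation) (x : Node Λ h) : D.Space →ₗ[ℂ] D.Space :=
  chi (lab ν.1 x) • D.turn x

theorem turn_eq_loop (ν : D.Orientation) (x : Node Λ h) :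
    D.turn x = chi (lab ν.1 x) • loop ν x := by
  rw [loop, smul_smul, chi_mul_self, one_smul]

theorem loop_of_conn (ν : D.Orientation) {x y : Node Λ h} (hxy : D.Conn x y) :
    loop ν x = loop ν y := by
  rw [loop, turn_of_conn ν hxy, smul_smul, ← chi_add, ← add_assoc, zmod_two_add_self, zero_add,
    loop]

theorem loop_of_isLine (ν : D.Orientation) {x : Node Λ h} (hx : D.IsLine x) : loop ν x = 0 := by
  rw [loop, turn_of_isLine hx, smul_zero]

/-! ### Reorientation -/

theorem Orientation.cw_congr_diagram {ν : D.Orientation} {ν' : E.Orientation} {x : Node Λ h}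
    (hc : ∀ y, D.Conn x y ↔ E.Conn x y) (hl : D.IsLine x ↔ E.IsLine x)
    (hν : ∀ y, D.Conn x y → lab ν.1 y = lab ν'.1 y) : ν.Cw x ↔ ν'.Cw x := by
  by_cases hx : D.IsLine x
  · exact iff_of_false (fun h1 => h1.not_isLine hx) fun h1 => h1.not_isLine (hl.1 hx)
  · obtain ⟨t, h1, h2⟩ := D.exists_tag x
    have h3 : E.IsTag t := fun y hy => h2 y (by
      rw [comp_eq_iff] at hy ⊢
      exact ((hc y).2 (((hc t).1 h1).trans hy.symm)).symm.trans h1)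
    rw [cw_iff_of_tag hx h1 h2, cw_iff_of_tag (hl.not.1 hx) ((hc t).1 h1) h3, hν t h1]

theorem sign_congr_diagram {ν : D.Orientation} {ν' : E.Orientation} {x : Node Λ h}
    (hx : ¬ D.IsLine x) (hx' : ¬ E.IsLine x) (hν : lab ν.1 x = lab ν'.1 x)
    (hcw : ν.Cw x ↔ ν'.Cw x) : D.sign x = E.sign x := by
  rw [ν.sign_eq hx, ν'.sign_eq hx', hν, ind_inj.2 hcw]

/-- The sets of circles made clockwise by a reorientation. The orientation `ν'` witnesses that the
labels of `ν` outside of `S` extend to an orientation of `E`. -/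
theorem reorient_eq {ν : D.Orientation} (ν' : E.Orientation) {S T : Set E.Component} (hTS : T ⊆ S)
    (hlab : ∀ x, E.comp x ∉ S → lab ν'.1 x = lab ν.1 x)
    (hcw : ∀ x, E.comp x ∉ S → (ν.Cw x ↔ ν'.Cw x)) :
    reorient ν S T = E.basisVec {x | E.comp x ∈ T ∨ (E.comp x ∉ S ∧ ν.Cw x)} := by
  have key : ∀ ν₁ : E.Orientation, IsReorientation ν S T ν₁ ↔
      ∀ x, ν₁.Cw x ↔ x ∈ {x | E.comp x ∈ T ∨ (E.comp x ∉ S ∧ ν.Cw x)} := by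
    intro ν₁
    have hoff : ∀ x, E.comp x ∉ S → ((ν₁.Up x ↔ ν.Up x) ↔ (ν₁.Cw x ↔ ν.Cw x)) := by
      intro x hx
      have h1 : (ν₁.Up x ↔ ν.Up x) ↔ lab ν₁.1 x = lab ν'.1 x := by
        rw [hlab x hx]; exact ind_inj.symm
      rw [h1, hcw x hx, ← zmod_two_add_eq_zero, Orientation.lab_add_lab ν₁ ν' x,
        zmod_two_add_eq_zero, ind_inj]
    constructor
    · rintro ⟨h1, h2⟩ x
      by_cases hx : E.comp x ∈ S
      · rw [Orientation.Cw, h2 _ hx]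
        exact ⟨Or.inl, fun h3 => h3.resolve_right fun h4 => h4.1 hx⟩
      · rw [(hoff x hx).1 (h1 x hx)]
        exact ⟨fun h3 => Or.inr ⟨hx, h3⟩, fun h3 => (h3.resolve_left fun h4 => hx (hTS h4)).2⟩
    · intro h1
      refine ⟨fun x hx => (hoff x hx).2 ?_, fun C hC => ?_⟩
      · rw [h1]
        exact ⟨fun h3 => (h3.resolve_left fun h4 => hx (hTS h4)).2, fun h3 => Or.inr ⟨hx, h3⟩⟩
      · obtain ⟨x, rfl⟩ := exists_rep C
        refine (h1 x).trans ⟨fun h3 => h3.resolve_right fun h4 => h4.1 hC, Or.inl⟩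
  by_cases hν : ∃ ν₁ : E.Orientation, IsReorientation ν S T ν₁
  · rw [reorient, dif_pos hν, basisVec_eq _ ((key _).1 hν.choose_spec)]
  · rw [reorient, dif_neg hν, basisVec, dif_neg fun ⟨ν₁, hν₁⟩ => hν ⟨ν₁, (key ν₁).2 hν₁⟩]

/-! ### The surgery maps in terms of sets of circles -/

section Merge

variable {a c : Node Λ h}

theorem merge_off' (hm : HalfEdge.IsMerge D.Conn E.Conn D.IsLine a c) {x : Node Λ h}
    (hx : ¬ E.Conn x a) (y : Node Λ h) : D.Conn x y ↔ E.Conn x y :=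
  (merge_off hm hx).symm

theorem merge_saturated_union (hm : HalfEdge.IsMerge D.Conn E.Conn D.IsLine a c)
    {T : Set (Node Λ h)} (hT : D.Saturated T) : E.Saturated (T ∪ {y | E.Conn a y}) := by
  refine saturated_of_conn fun x y hxy hx => ?_
  by_cases h1 : E.Conn x a
  · exact Or.inr (h1.symm.trans hxy)
  · exact Or.inl ((hT.mem_iff ((merge_off hm h1).1 hxy)).1
      (hx.resolve_right fun h2 => h1 (Conn.symm h2)))

theorem merge_saturated_of_iff (hm : HalfEdge.IsMerge D.Conn E.Conn D.IsLine a c)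
    {T : Set (Node Λ h)} (hT : D.Saturated T) (hac : a ∈ T ↔ c ∈ T) : E.Saturated T := by
  refine saturated_of_conn fun x y hxy hx => ?_
  rcases (hm.iff x y).1 hxy with h1 | ⟨h1, h2⟩
  · exact (hT.mem_iff h1).1 hx
  · have h3 : ∀ z, D.Conn z a ∨ D.Conn z c → (z ∈ T ↔ a ∈ T) := fun z hz =>
      hz.elim (fun h4 => hT.mem_iff h4) fun h4 => (hT.mem_iff h4).trans hac.symm
    exact (h3 y h2).2 ((h3 x h1).1 hx)

theorem merge_saturated_mono (hm : HalfEdge.IsMerge D.Conn E.Conn D.IsLine a c)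
    {T : Set (Node Λ h)} (hT : E.Saturated T) : D.Saturated T :=
  saturated_of_conn fun _ _ hxy => (hT.mem_iff (merge_mono hm hxy)).1

end Merge

namespace Surgery

variable {s : Surgery D E}

theorem surg_single (s : Surgery D E) (ν : D.Orientation) :
    s.surg (Finsupp.single ν 1) = s.image ν := by
  rw [surg, Finsupp.linearCombination_single, one_smul]

theorem IsMerge.surg_single (hs : s.IsMerge) (ν : D.Orientation) :
    s.surg (Finsupp.single ν 1) = s.merge ν := by
  rw [s.surg_single, image, if_pos (numComponents_lt_of_merge hs)]

theorem IsSplit.surg_single (hs : s.IsSplit) (ν : D.Orientation) :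
    s.surg (Finsupp.single ν 1) = s.split ν := by
  have := numComponents_lt_of_merge hs
  rw [s.surg_single, image, if_neg this.not_gt, if_pos this]

theorem IsReconnect.surg_single (hs : s.IsReconnect) (ν : D.Orientation) :
    s.surg (Finsupp.single ν 1) = s.reconnect ν := by
  have := numComponents_eq_of_reconnect hs
  rw [s.surg_single, image, if_neg this.not_lt, if_neg this.not_gt]

open Classical in
theorem IsMerge.surg_basisVec (hs : s.IsMerge) (ν₀ : D.Orientation) {T : Set (Node Λ h)}
    (hT : D.Saturated T) : s.surg (D.basisVec T) =
      if s.lower s.i ∈ T then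
        if s.upper s.i ∈ T then 0
        else (D.sign (s.lower s.i) * E.sign (s.lower s.i)) •
          E.basisVec (T ∪ {y | E.Conn (s.lower s.i) y})
      else
        if s.upper s.i ∈ T then (D.sign (s.upper s.i) * E.sign (s.upper s.i)) •
          E.basisVec (T ∪ {y | E.Conn (s.lower s.i) y})
        else E.basisVec T := by
  rcases basisVec_cases ν₀ hT with ⟨x, hx, hl⟩ | ⟨ν, hν⟩
  · have hl' : E.IsLine x := merge_isLine_of_isLine hs s.free_iff hl
    rw [basisVec_of_isLine hx hl, basisVec_of_isLine hx hl',
      basisVec_of_isLine (D := E) (Or.inl hx) hl', map_zero]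
    simp only [smul_zero, ite_self]
  obtain rfl : {y | ν.Cw y} = T := Set.ext hν
  obtain ⟨ν₁, h1, h2, h3⟩ := hs.exists_isOrientation ν.2
  obtain ⟨ν', rfl⟩ : ∃ ν' : E.Orientation, ν'.1 = ν₁ := ⟨⟨ν₁, h2⟩, rfl⟩
  have hC : ∀ x, E.comp x = E.comp (s.lower s.i) ↔ E.Conn x (s.lower s.i) := fun x => comp_eq_iff
  have hlab : ∀ x, E.comp x ∉ ({E.comp (s.lower s.i)} : Set E.Component) →
      lab ν'.1 x = lab ν.1 x := fun x hx => h3 x fun h4 => hx ((hC x).2 h4)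
  have hcw : ∀ x, E.comp x ∉ ({E.comp (s.lower s.i)} : Set E.Component) →
      (ν.Cw x ↔ ν'.Cw x) := by
    intro x hx
    have hx' : ¬ E.Conn x (s.lower s.i) := fun h4 => hx ((hC x).2 h4)
    refine Orientation.cw_congr_diagram (merge_off' hs hx')
      (merge_isLine_off hs s.free_iff hx').symm fun y hxy => (h3 y fun h4 => hx' ?_).symm
    exact (merge_mono hs hxy).trans h4
  have hset : {x | E.comp x ∈ ({E.comp (s.lower s.i)} : Set E.Component) ∨
      (E.comp x ∉ ({E.comp (s.lower s.i)} : Set E.Component) ∧ ν.Cw x)} =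
      {y | ν.Cw y} ∪ {y | E.Conn (s.lower s.i) y} := by
    ext x
    change (E.comp x = _ ∨ ¬ (E.comp x = _) ∧ ν.Cw x) ↔ ν.Cw x ∨ E.Conn (s.lower s.i) x
    rw [hC, conn_comm (x := s.lower s.i)]
    tauto
  rw [basisVec_cw, hs.surg_single, merge]
  change (if ν.Cw (s.lower s.i) then if ν.Cw (s.upper s.i) then 0 else _ else
    if ν.Cw (s.upper s.i) then _ else _) = if ν.Cw (s.lower s.i) then if ν.Cw (s.upper s.i) then 0
    else _ else if ν.Cw (s.upper s.i) then _ else _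
  rw [reorient_eq ν' subset_rfl hlab hcw, hset]
  split_ifs with h4 h5 h5
  · rfl
  · rfl
  · rfl
  · rw [reorient_eq ν' (Set.empty_subset _) hlab hcw]
    congr 1
    ext x
    change (False ∨ ¬ (E.comp x = _) ∧ ν.Cw x) ↔ ν.Cw x
    rw [hC, merge_conn_iff hs]
    constructor
    · tauto
    · refine fun h6 => Or.inr ⟨?_, h6⟩
      rintro (h7 | h7)
      · exact h4 ((Orientation.cw_congr h7).1 h6)
      · exact h5 ((Orientation.cw_congr h7).1 h6)

/-- The operator describing the image of an anticlockwise component under a split. -/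
noncomputable def splitOp (s : Surgery D E) (F : StackedDiagram Λ h) : F.Space →ₗ[ℂ] F.Space :=
  (-1 : ℂ) ^ Λ.pos s.i • (F.turn (s.upper s.j) +
    chi (ind ((D.inner s.level).dotted s.i = false)) • F.turn (s.upper s.i))

theorem IsSplit.conn_upper_j (hs : s.IsSplit) {x : Node Λ h} :
    D.Conn x (s.upper s.i) ↔ E.Conn x (s.upper s.i) ∨ E.Conn x (s.upper s.j) := by
  have h1 : D.Conn x (s.upper s.i) ↔ D.Conn x (s.lower s.i) :=
    ⟨fun h2 => h2.trans (merge_mono hs s.conn_i).symm, fun h2 => h2.trans (merge_mono hs s.conn_i)⟩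
  rw [h1, merge_conn_iff hs]
  exact or_congr ⟨fun h2 => h2.trans s.conn_i, fun h2 => h2.trans s.conn_i.symm⟩
    ⟨fun h2 => h2.trans s.conn_j, fun h2 => h2.trans s.conn_j.symm⟩

theorem IsSplit.off (hs : s.IsSplit) {x : Node Λ h} (hx : ¬ D.Conn x (s.upper s.i)) :
    (∀ y, D.Conn x y ↔ E.Conn x y) ∧ (D.IsLine x ↔ E.IsLine x) := by
  have hx' : ¬ D.Conn x (s.lower s.i) := fun h1 => hx (h1.trans (merge_mono hs s.conn_i))
  exact ⟨fun y => merge_off hs hx', merge_isLine_off hs s.free_iff' hx'⟩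

open Classical in
theorem IsSplit.surg_basisVec (hs : s.IsSplit) (ν₀ : E.Orientation) {T : Set (Node Λ h)}
    (hT : D.Saturated T) : s.surg (D.basisVec T) =
      if s.upper s.i ∈ T then ((-1 : ℂ) ^ Λ.pos s.i *
        (D.sign (s.upper s.i) * E.sign (s.upper s.i) * E.sign (s.upper s.j))) • E.basisVec T
      else s.splitOp E (E.basisVec T) := by
  obtain ⟨ν₁, h1, h2, -⟩ := hs.exists_isOrientation ν₀.2
  rcases basisVec_cases ⟨ν₁, h1⟩ hT with ⟨x, hx, hl⟩ | ⟨ν, hν⟩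
  · by_cases hxc : D.Conn x (s.upper s.i)
    · have h3 : s.upper s.i ∈ T := (hT.mem_iff hxc).1 hx
      have h3' : s.lower s.i ∈ T := (hT.mem_iff (merge_mono hs s.conn_i)).2 h3
      have h4 : D.IsLine (s.lower s.i) := hl.of_conn (hxc.trans (merge_mono hs s.conn_i).symm)
      rw [if_pos h3, basisVec_of_isLine hx hl, map_zero]
      rcases (merge_isLine hs s.free_iff').1 h4 with h5 | h5
      · rw [basisVec_of_isLine h3' h5, smul_zero]
      · rw [basisVec_of_isLine ((hT.mem_iff (merge_conn hs)).1 h3') h5, smul_zero]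
    · rw [basisVec_of_isLine hx hl, basisVec_of_isLine hx ((hs.off hxc).2.1 hl)]
      simp only [map_zero, smul_zero, ite_self]
  obtain rfl : {y | ν.Cw y} = T := Set.ext hν
  have hνE : E.IsOrientation ν.1 := hs.isOrientation h2 ν.2
  obtain ⟨ν', hν'⟩ : ∃ ν' : E.Orientation, ν'.1 = ν.1 := ⟨⟨ν.1, hνE⟩, rfl⟩
  have hTE : E.Saturated {y | ν.Cw y} := merge_saturated_mono hs hT
  set S : Set E.Component := {E.comp (s.upper s.i), E.comp (s.upper s.j)} with hS
  have hC : ∀ x, E.comp x ∈ S ↔ D.Conn x (s.upper s.i) := by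
    intro x
    rw [hs.conn_upper_j, ← comp_eq_iff, ← comp_eq_iff]
    exact Iff.rfl
  have hcw : ∀ x, E.comp x ∉ S → (ν.Cw x ↔ ν'.Cw x) := by
    intro x hx
    rw [hC] at hx
    exact Orientation.cw_congr_diagram (hs.off hx).1 (hs.off hx).2 fun _ _ => by rw [hν']
  have hre : ∀ T : Set E.Component, T ⊆ S → reorient ν S T =
      E.basisVec {x | E.comp x ∈ T ∨ (E.comp x ∉ S ∧ ν.Cw x)} := fun T hT =>
    reorient_eq ν' hT (fun _ _ => by rw [hν']) hcw
  have hmem : s.upper s.i ∈ {y | ν.Cw y} ↔ ν.Cw (s.upper s.i) := Iff.rfl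
  have hj : ν.Cw (s.upper s.j) ↔ ν.Cw (s.upper s.i) := Orientation.cw_congr s.conn_upper.symm
  rw [basisVec_cw, hs.surg_single, split]
  by_cases h3 : ν.Cw (s.upper s.i)
  · rw [if_pos (hmem.2 h3)]
    simp only [← hS]
    rw [if_pos (show ν.Clockwise (D.comp _) from h3), smul_smul, hre _ subset_rfl]
    congr 2
    ext x
    change (E.comp x ∈ S ∨ ¬ (E.comp x ∈ S) ∧ ν.Cw x) ↔ ν.Cw x
    rw [hC]
    constructor
    · rintro (h4 | h4)
      · exact (Orientation.cw_congr h4).2 h3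
      · exact h4.2
    · tauto
  · have hk : ∀ k, k = s.i ∨ k = s.j → reorient ν S {E.comp (s.upper k)} =
        E.basisVec ({y | ν.Cw y} ∪ {y | E.Conn (s.upper k) y}) := by
      intro k hk
      rw [hre _ (by rintro C rfl; rcases hk with rfl | rfl; exacts [Or.inl rfl, Or.inr rfl])]
      congr 1
      ext x
      change (E.comp x = E.comp (s.upper k) ∨ ¬ (E.comp x ∈ S) ∧ ν.Cw x) ↔
        ν.Cw x ∨ E.Conn (s.upper k) x
      rw [hC, comp_eq_iff, conn_comm (x := s.upper k)]
      constructor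
      · tauto
      · rintro (h4 | h4)
        · exact Or.inr ⟨fun h5 => h3 ((Orientation.cw_congr h5).1 h4), h4⟩
        · exact Or.inl h4
    rw [if_neg (hmem.not.2 h3), splitOp]
    simp only [← hS]
    rw [if_neg (show ¬ ν.Clockwise (D.comp _) from h3), LinearMap.smul_apply, LinearMap.add_apply, LinearMap.smul_apply,
      turn_basisVec hTE, turn_basisVec hTE,
      if_neg (show s.upper s.i ∉ {y | ν.Cw y} from h3),
      if_neg (show s.upper s.j ∉ {y | ν.Cw y} from fun h4 => h3 (hj.1 h4)),
      hk _ (Or.inl rfl), hk _ (Or.inr rfl)]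
    congr 1
    cases hd : (D.inner s.level).dotted s.i with
    | true => rw [if_pos rfl, ind_of_false (by simp), chi_zero, one_smul]
    | false => rw [if_neg (by simp), ind_of_true rfl, chi_one, neg_one_smul, sub_eq_add_neg]

/-- The image of a basis vector under the reconnection of two lines is not zero. -/
def IsGood (s : Surgery D E) : Prop :=
  (∃ ν, D.IsOrientation ν ∧ E.IsOrientation ν) ∧ D.Propagates (s.lower s.i) ∧
    D.Propagates (s.upper s.i)

open Classical in
theorem IsReconnect.surg_basisVec (hs : s.IsReconnect) (ν₀ : D.Orientation) {T : Set (Node Λ h)}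
    (hT : D.Saturated T) :
    s.surg (D.basisVec T) = if s.IsGood then E.basisVec T else 0 := by
  rcases basisVec_cases ν₀ hT with ⟨x, hx, hl⟩ | ⟨ν, hν⟩
  · rw [basisVec_of_isLine hx hl, basisVec_of_isLine hx ((reconnect_isLine hs s.free_iff x).2 hl),
      map_zero, ite_self]
  obtain rfl : {y | ν.Cw y} = T := Set.ext hν
  rw [basisVec_cw, hs.surg_single, reconnect]
  by_cases hg : s.IsGood
  · obtain ⟨⟨ν₁, h1, h2⟩, h3, h4⟩ := hg
    have hνE : E.IsOrientation ν.1 := hs.isOrientation h1 h2 ν.2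
    rw [dif_pos ⟨hνE, isPropagating_iff.2 h3, isPropagating_iff.2 h4⟩,
      if_pos ⟨⟨ν₁, h1, h2⟩, h3, h4⟩]
    refine (basisVec_eq (⟨ν.1, hνE⟩ : E.Orientation) fun x => ?_).symm
    change Orientation.Cw (D := E) _ x ↔ ν.Cw x
    by_cases hx : D.Conn x (s.lower s.i) ∨ D.Conn x (s.upper s.i)
    · have := reconnect_isLine_of_mem hs hx
      exact iff_of_false (fun h5 => h5.not_isLine this.2) fun h5 => h5.not_isLine this.1
    · exact (Orientation.cw_congr_diagram (hs.off x · hx) (reconnect_isLine hs s.free_iff x).symm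
        fun _ _ => rfl).symm
  · rw [if_neg hg, dif_neg]
    rintro ⟨h1, h2, h3⟩
    exact hg ⟨⟨ν.1, ν.2, h1⟩, isPropagating_iff.1 h2, isPropagating_iff.1 h3⟩

end Surgery

/-! ### The surgery maps commute with the operators reversing circles -/

theorem sign_eq_of_conn_iff {ν : D.Orientation} {ν' : E.Orientation} (hν : ν'.1 = ν.1)
    {x : Node Λ h} (hx : ¬ D.IsLine x) (hc : ∀ y, D.Conn x y ↔ E.Conn x y)
    (hl : D.IsLine x ↔ E.IsLine x) : D.sign x = E.sign x :=
  sign_congr_diagram hx (hl.not.1 hx) (by rw [hν])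
    (Orientation.cw_congr_diagram hc hl fun _ _ => by rw [hν])

theorem mem_union_conn (T : Set (Node Λ h)) (x : Node Λ h) : x ∈ T ∪ {y | D.Conn x y} :=
  Or.inr (Conn.refl _)

namespace Surgery

variable {s : Surgery D E}

/-- An orientation of both `D` and `E` is used to compare the signs in `D` with the signs in `E`. -/
theorem IsMerge.surg_turn (hs : s.IsMerge) (x : Node Λ h) (v : D.Space) :
    s.surg (D.turn x v) = E.turn x (s.surg v) := by
  classical
  suffices hx : s.surg ∘ₗ D.turn x = E.turn x ∘ₗ s.surg from LinearMap.congr_fun hx v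
  refine lhom_ext fun T hT => ?_
  rcases isEmpty_or_nonempty D.Orientation with hD | ⟨⟨ν₀⟩⟩
  · rw [basisVec_of_isEmpty hD, map_zero, map_zero]
  obtain ⟨ν₁, h1, h2, -⟩ := hs.exists_isOrientation ν₀.2
  obtain ⟨ν, hν⟩ : ∃ ν : D.Orientation, ν.1 = ν₁ := ⟨⟨ν₁, h1⟩, rfl⟩
  obtain ⟨ν', hν'⟩ : ∃ ν' : E.Orientation, ν'.1 = ν₁ := ⟨⟨ν₁, h2⟩, rfl⟩
  simp only [LinearMap.comp_apply]
  have hTC : E.Saturated (T ∪ {y | E.Conn (s.lower s.i) y}) := merge_saturated_union hs hT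
  have hTx := hT.union (saturated_conn (D := D) x)
  by_cases hx : E.Conn x (s.lower s.i)
  · -- On the merged component it suffices to consider the two vertices `y` occurring in the formula
    -- for a merge; other vertices differ from them by the same sign in `D` and in `E`.
    have key : ∀ y, (y = s.lower s.i ∨ y = s.upper s.i) →
        s.surg (D.turn y (D.basisVec T)) = E.turn y (s.surg (D.basisVec T)) := by
      intro y hy
      have hTy := hT.union (saturated_conn (D := D) y)
      have hyC : y ∈ T ∪ {y | E.Conn (s.lower s.i) y} := by
        rcases hy with rfl | rfl
        · exact Or.inr (Conn.refl _)
        · exact Or.inr (merge_conn hs)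
      have hE0 : E.turn y (E.basisVec (T ∪ {y | E.Conn (s.lower s.i) y})) = 0 := by
        rw [turn_basisVec hTC, if_pos hyC]
      have hne : ¬ D.Conn (s.upper s.i) (s.lower s.i) := fun h3 => hs.ne h3.symm
      have hmem : ∀ z w, w ∈ T ∪ {y | D.Conn z y} ↔ w ∈ T ∨ D.Conn z w := fun _ _ => Iff.rfl
      have hset : T ∪ {z | D.Conn y z} ∪ {z | E.Conn (s.lower s.i) z} =
          T ∪ {z | E.Conn y z} := by
        have h3 : {z | E.Conn (s.lower s.i) z} = {z | E.Conn y z} := by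
          rcases hy with rfl | rfl
          · rfl
          · exact conn_set_congr (merge_conn hs)
        rw [h3, Set.union_assoc]
        exact congrArg _ (Set.union_eq_self_of_subset_left fun z hz => merge_mono hs hz)
      by_cases ha : s.lower s.i ∈ T <;> by_cases hc : s.upper s.i ∈ T
      · have hyT : y ∈ T := by rcases hy with rfl | rfl <;> assumption
        rw [turn_basisVec hT, if_pos hyT, map_zero, hs.surg_basisVec ν hT, if_pos ha, if_pos hc,
          map_zero]
      · rw [hs.surg_basisVec ν hT, if_pos ha, if_neg hc, map_smul, hE0, smul_zero, turn_basisVec hT]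
        rcases hy with rfl | rfl
        · rw [if_pos ha, map_zero]
        · rw [if_neg hc, map_smul, hs.surg_basisVec ν hTy, if_pos (Set.mem_union_left _ ha),
            if_pos (mem_union_conn _ _), smul_zero]
      · rw [hs.surg_basisVec ν hT, if_neg ha, if_pos hc, map_smul, hE0, smul_zero, turn_basisVec hT]
        rcases hy with rfl | rfl
        · rw [if_neg ha, map_smul, hs.surg_basisVec ν hTy, if_pos (mem_union_conn _ _),
            if_pos (Set.mem_union_left _ hc), smul_zero]
        · rw [if_pos hc, map_zero]
      · have hTE : E.Saturated T := merge_saturated_of_iff hs hT (iff_of_false ha hc)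
        have hyT : y ∉ T := by rcases hy with rfl | rfl <;> assumption
        rw [hs.surg_basisVec ν hT, if_neg ha, if_neg hc, turn_basisVec hT, turn_basisVec hTE,
          if_neg hyT, if_neg hyT, map_smul, hs.surg_basisVec ν hTy, hset]
        rcases hy with rfl | rfl
        · rw [if_pos (mem_union_conn _ _), if_neg (fun h3 => ((hmem _ _).1 h3).elim hc hs.ne),
            smul_smul, ← mul_assoc, sign_mul_self, one_mul]
        · rw [if_neg (fun h3 => ((hmem _ _).1 h3).elim ha hne), if_pos (mem_union_conn _ _),
            smul_smul, ← mul_assoc, sign_mul_self, one_mul]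
    have hred : ∀ y, (y = s.lower s.i ∨ y = s.upper s.i) → D.Conn x y →
        s.surg (D.turn x (D.basisVec T)) = E.turn x (s.surg (D.basisVec T)) := by
      intro y hy hxy
      rw [turn_of_conn ν hxy, turn_of_conn ν' (merge_mono hs hxy), hν, hν', LinearMap.smul_apply,
        LinearMap.smul_apply, map_smul, key y hy]
    rcases (merge_conn_iff hs).1 hx with h3 | h3
    · exact hred _ (Or.inl rfl) h3
    · exact hred _ (Or.inr rfl) h3
  · have hoff := merge_off' hs hx
    have hlx := (merge_isLine_off hs s.free_iff hx).symm
    by_cases hl : D.IsLine x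
    · rw [turn_of_isLine hl, turn_of_isLine (hlx.1 hl), LinearMap.zero_apply, LinearMap.zero_apply,
        map_zero]
    have hsign : D.sign x = E.sign x := sign_eq_of_conn_iff (hν'.trans hν.symm) hl hoff hlx
    have hK : {y | D.Conn x y} = {y | E.Conn x y} := Set.ext hoff
    have ha : s.lower s.i ∈ T ∪ {y | D.Conn x y} ↔ s.lower s.i ∈ T :=
      ⟨fun h3 => h3.resolve_right fun h4 => hx (merge_mono hs h4), Or.inl⟩
    have hc : s.upper s.i ∈ T ∪ {y | D.Conn x y} ↔ s.upper s.i ∈ T :=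
      ⟨fun h3 => h3.resolve_right fun h4 => hx ((merge_mono hs h4).trans (merge_conn hs).symm),
        Or.inl⟩
    have hxC : x ∈ T ∪ {y | E.Conn (s.lower s.i) y} ↔ x ∈ T :=
      ⟨fun h3 => h3.resolve_right fun h4 => hx (Conn.symm h4), Or.inl⟩
    have hE1 : E.turn x (E.basisVec (T ∪ {y | E.Conn (s.lower s.i) y})) = if x ∈ T then 0 else
        D.sign x • E.basisVec (T ∪ {y | D.Conn x y} ∪ {y | E.Conn (s.lower s.i) y}) := by
      rw [turn_basisVec hTC, hK, Set.union_right_comm, hsign]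
      simp only [hxC]
    by_cases h3 : s.lower s.i ∈ T <;> by_cases h4 : s.upper s.i ∈ T <;> by_cases h5 : x ∈ T <;>
      simp only [turn_basisVec hT, hs.surg_basisVec ν hT, hs.surg_basisVec ν hTx, ha, hc, h3, h4,
        h5, if_true, if_false, map_zero, map_smul, smul_zero, hE1]
    · rw [smul_comm]
    · rw [smul_comm]
    · rw [turn_basisVec (merge_saturated_of_iff hs hT (iff_of_false h3 h4)), if_pos h5]
    · rw [turn_basisVec (merge_saturated_of_iff hs hT (iff_of_false h3 h4)), if_neg h5, hK, hsign]

theorem splitOp_comm (s : Surgery D E) (F : StackedDiagram Λ h) (x : Node Λ h) (v : F.Space) :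
    s.splitOp F (F.turn x v) = F.turn x (s.splitOp F v) := by
  simp only [splitOp, LinearMap.smul_apply, LinearMap.add_apply, map_smul, map_add]
  rw [turn_comm x, turn_comm x]

theorem IsSplit.surg_turn (hs : s.IsSplit) (x : Node Λ h) (v : D.Space) :
    s.surg (D.turn x v) = E.turn x (s.surg v) := by
  classical
  suffices hx : s.surg ∘ₗ D.turn x = E.turn x ∘ₗ s.surg from LinearMap.congr_fun hx v
  refine lhom_ext fun T hT => ?_
  simp only [LinearMap.comp_apply]
  rcases isEmpty_or_nonempty E.Orientation with hE | ⟨⟨ν₀⟩⟩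
  · exact Subsingleton.elim _ _
  obtain ⟨ν₁, h1, h2, -⟩ := hs.exists_isOrientation ν₀.2
  obtain ⟨ν, hν⟩ : ∃ ν : D.Orientation, ν.1 = ν₁ := ⟨⟨ν₁, h1⟩, rfl⟩
  obtain ⟨ν', hν'⟩ : ∃ ν' : E.Orientation, ν'.1 = ν₁ := ⟨⟨ν₁, h2⟩, rfl⟩
  have hTE : E.Saturated T := merge_saturated_mono hs hT
  have hTx := hT.union (saturated_conn (D := D) x)
  have hcd : D.Conn (s.upper s.j) (s.upper s.i) := s.conn_upper.symm
  have hdT : s.upper s.j ∈ T ↔ s.upper s.i ∈ T := hT.mem_iff hcd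
  by_cases hx : D.Conn x (s.upper s.i)
  · have hTc := hT.union (saturated_conn (D := D) (s.upper s.i))
    have hlabd : chi (lab ν₁ (s.upper s.j) + lab ν₁ (s.upper s.i)) =
        chi (ind ((D.inner s.level).dotted s.i = false)) := by
      rw [s.lab_upper h1, add_right_comm, zmod_two_add_self, zero_add]
    have hset : T ∪ {y | E.Conn (s.upper s.i) y} ∪ {y | E.Conn (s.upper s.j) y} =
        T ∪ {y | D.Conn (s.upper s.i) y} := by
      rw [Set.union_assoc]
      congr 1
      ext y
      change E.Conn _ y ∨ E.Conn _ y ↔ D.Conn _ y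
      rw [conn_comm, conn_comm (y := y), conn_comm (y := y), hs.conn_upper_j]
    have key : ∀ y, (y = s.upper s.i ∨ y = s.upper s.j) →
        s.surg (D.turn y (D.basisVec T)) = E.turn y (s.surg (D.basisVec T)) := by
      by_cases hc : s.upper s.i ∈ T
      · intro y hy
        have hyT : y ∈ T := by
          rcases hy with rfl | rfl
          · exact hc
          · exact hdT.2 hc
        rw [turn_basisVec hT, if_pos hyT, map_zero, hs.surg_basisVec ν' hT, if_pos hc, map_smul,
          turn_basisVec hTE, if_pos hyT, smul_zero]
      · have hd : s.upper s.j ∉ T := hdT.not.2 hc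
        have hcd' : ¬ E.Conn (s.upper s.i) (s.upper s.j) := fun h3 =>
          hs.ne (s.conn_i.trans (h3.trans s.conn_j.symm))
        have hi2 : E.turn (s.upper s.i) (E.turn (s.upper s.i) (E.basisVec T)) = 0 := by
          rw [turn_basisVec hTE, if_neg hc, map_smul,
            turn_basisVec (hTE.union (saturated_conn (D := E) _)), if_pos (mem_union_conn _ _),
            smul_zero]
        have hj2 : E.turn (s.upper s.j) (E.turn (s.upper s.j) (E.basisVec T)) = 0 := by
          rw [turn_basisVec hTE, if_neg hd, map_smul,
            turn_basisVec (hTE.union (saturated_conn (D := E) _)), if_pos (mem_union_conn _ _),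
            smul_zero]
        have hij : E.turn (s.upper s.i) (E.turn (s.upper s.j) (E.basisVec T)) =
            (E.sign (s.upper s.i) * E.sign (s.upper s.j)) •
              E.basisVec (T ∪ {y | D.Conn (s.upper s.i) y}) := by
          rw [turn_comm, turn_basisVec hTE, if_neg hc, map_smul,
            turn_basisVec (hTE.union (saturated_conn (D := E) _)), if_neg, smul_smul, hset]
          exact fun h3 => h3.elim hd hcd'
        have hi : s.surg (D.turn (s.upper s.i) (D.basisVec T)) =
            E.turn (s.upper s.i) (s.surg (D.basisVec T)) := by
          rw [turn_basisVec hT, if_neg hc, map_smul, hs.surg_basisVec ν' hTc,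
            if_pos (mem_union_conn _ _), hs.surg_basisVec ν' hT, if_neg hc, splitOp]
          simp only [LinearMap.smul_apply, LinearMap.add_apply, map_smul, map_add]
          rw [hi2, hij, smul_zero, add_zero, smul_smul, smul_smul]
          congr 1
          linear_combination ((-1 : ℂ) ^ Λ.pos s.i * E.sign (s.upper s.i) * E.sign (s.upper s.j)) *
            D.sign_mul_self (s.upper s.i)
        rintro y (rfl | rfl)
        · exact hi
        · rw [turn_of_conn ν hcd, hν, hlabd, LinearMap.smul_apply, map_smul, hi,
            hs.surg_basisVec ν' hT, if_neg hc, splitOp]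
          simp only [LinearMap.smul_apply, LinearMap.add_apply, map_smul, map_add]
          rw [hi2, hj2, turn_comm (s.upper s.j) (s.upper s.i), smul_zero, add_zero, zero_add,
            smul_comm]
    rcases hs.conn_upper_j.1 hx with h3 | h3
    · rw [turn_of_conn ν hx, turn_of_conn ν' h3, hν, hν', LinearMap.smul_apply,
        LinearMap.smul_apply, map_smul, key _ (Or.inl rfl)]
    · rw [turn_of_conn ν (hx.trans s.conn_upper), turn_of_conn ν' h3, hν, hν',
        LinearMap.smul_apply, LinearMap.smul_apply, map_smul, key _ (Or.inr rfl)]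
  · obtain ⟨hoff, hlx⟩ := hs.off hx
    by_cases hl : D.IsLine x
    · rw [turn_of_isLine hl, turn_of_isLine (hlx.1 hl), LinearMap.zero_apply, LinearMap.zero_apply,
        map_zero]
    have hsign : D.sign x = E.sign x := sign_eq_of_conn_iff (hν'.trans hν.symm) hl hoff hlx
    have hK : {y | D.Conn x y} = {y | E.Conn x y} := Set.ext hoff
    have hc : s.upper s.i ∈ T ∪ {y | D.Conn x y} ↔ s.upper s.i ∈ T :=
      ⟨fun h3 => h3.resolve_right fun h4 => hx h4, Or.inl⟩
    have hEx : E.turn x (E.basisVec T) =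
        if x ∈ T then 0 else D.sign x • E.basisVec (T ∪ {y | D.Conn x y}) := by
      rw [turn_basisVec hTE, hK, hsign]
    by_cases h4 : s.upper s.i ∈ T <;> by_cases h5 : x ∈ T <;>
      simp only [turn_basisVec hT, hs.surg_basisVec ν' hT, hs.surg_basisVec ν' hTx, hc, h4,
        h5, if_true, if_false, map_zero, map_smul, ← splitOp_comm, hEx]
    · rw [smul_zero]
    · rw [smul_comm]

theorem IsReconnect.surg_turn (hs : s.IsReconnect) (x : Node Λ h) (v : D.Space) :
    s.surg (D.turn x v) = E.turn x (s.surg v) := by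
  classical
  suffices hx : s.surg ∘ₗ D.turn x = E.turn x ∘ₗ s.surg from LinearMap.congr_fun hx v
  refine lhom_ext fun T hT => ?_
  simp only [LinearMap.comp_apply]
  rcases isEmpty_or_nonempty D.Orientation with hD | ⟨⟨ν₀⟩⟩
  · rw [basisVec_of_isEmpty hD, map_zero, map_zero, map_zero]
  have hlx := (reconnect_isLine hs s.free_iff x).symm
  by_cases hl : D.IsLine x
  · rw [turn_of_isLine hl, turn_of_isLine (hlx.1 hl), LinearMap.zero_apply, LinearMap.zero_apply,
      map_zero]
  have hx : ¬ (D.Conn x (s.lower s.i) ∨ D.Conn x (s.upper s.i)) := fun h1 =>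
    hl (reconnect_isLine_of_mem hs h1).1
  have hoff := fun y => hs.off x y hx
  have hTx := hT.union (saturated_conn (D := D) x)
  by_cases hg : s.IsGood
  · obtain ⟨ν₁, h1, h2⟩ := hg.1
    obtain ⟨ν, hν⟩ : ∃ ν : D.Orientation, ν.1 = ν₁ := ⟨⟨ν₁, h1⟩, rfl⟩
    obtain ⟨ν', hν'⟩ : ∃ ν' : E.Orientation, ν'.1 = ν₁ := ⟨⟨ν₁, h2⟩, rfl⟩
    have hsign : D.sign x = E.sign x := sign_eq_of_conn_iff (hν'.trans hν.symm) hl hoff hlx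
    rw [hs.surg_basisVec ν₀ hT, if_pos hg, turn_basisVec hT]
    by_cases hTl : ∃ y ∈ T, D.IsLine y
    · obtain ⟨y, hy, hyl⟩ := hTl
      have hyl' := (reconnect_isLine hs s.free_iff y).2 hyl
      rw [basisVec_of_isLine hy hyl', map_zero, basisVec_of_isLine (Or.inl hy) hyl]
      simp
    have hTE : E.Saturated T := by
      refine saturated_of_conn fun y z hyz hy => ?_
      have hy' : ¬ (D.Conn y (s.lower s.i) ∨ D.Conn y (s.upper s.i)) := fun h3 =>
        hTl ⟨y, hy, (reconnect_isLine_of_mem hs h3).1⟩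
      exact (hT.mem_iff ((hs.off y z hy').2 hyz)).1 hy
    rw [turn_basisVec hTE, ← show {y | D.Conn x y} = {y | E.Conn x y} from Set.ext hoff, ← hsign]
    by_cases h5 : x ∈ T
    · rw [if_pos h5, if_pos h5, map_zero]
    · rw [if_neg h5, if_neg h5, map_smul, hs.surg_basisVec ν₀ hTx, if_pos hg]
  · rw [hs.surg_basisVec ν₀ hT, if_neg hg, map_zero, turn_basisVec hT]
    split_ifs
    · rw [map_zero]
    · rw [map_smul, hs.surg_basisVec ν₀ hTx, if_neg hg, smul_zero]

/-- Surgery maps commute with the operators `turn x`. -/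
theorem surg_turn (s : Surgery D E) (x : Node Λ h) (v : D.Space) :
    s.surg (D.turn x v) = E.turn x (s.surg v) := by
  rcases s.trichotomy with ⟨hs, -⟩ | ⟨hs, -⟩ | ⟨hs, -⟩
  · exact IsMerge.surg_turn hs x v
  · exact IsSplit.surg_turn hs x v
  · exact IsReconnect.surg_turn hs x v

theorem surg_splitOp {D' E' : StackedDiagram Λ h} (s : Surgery D E) (t : Surgery D' E')
    (v : D.Space) : s.surg (t.splitOp D v) = t.splitOp E (s.surg v) := by
  simp only [splitOp, LinearMap.smul_apply, LinearMap.add_apply, map_smul, map_add, surg_turn]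

theorem IsMerge.surg_empty (hs : s.IsMerge) (ν : D.Orientation) :
    s.surg (D.basisVec ∅) = E.basisVec ∅ := by
  rw [hs.surg_basisVec ν saturated_empty, if_neg (Set.notMem_empty _), if_neg (Set.notMem_empty _)]

theorem IsSplit.surg_empty (hs : s.IsSplit) :
    s.surg (D.basisVec ∅) = s.splitOp E (E.basisVec ∅) := by
  rcases isEmpty_or_nonempty E.Orientation with hE | ⟨⟨ν⟩⟩
  · exact Subsingleton.elim _ _
  · rw [hs.surg_basisVec ν saturated_empty, if_neg (Set.notMem_empty _)]

open Classical in
theorem IsReconnect.surg_empty (hs : s.IsReconnect) (ν : D.Orientation) :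
    s.surg (D.basisVec ∅) = if s.IsGood then E.basisVec ∅ else 0 :=
  hs.surg_basisVec ν saturated_empty

end Surgery

end StackedDiagram

namespace StackedDiagram

variable {Λ : Block} {h : ℕ} {D E E₁ E₂ F : StackedDiagram Λ h}

/-! ### The sign of a split -/

theorem Surgery.twist_j (s : Surgery D E) {ν : Fin (h + 1) → Λ.Weight} (hE : E.IsOrientation ν) :
    twist ν (s.upper s.j) = twist ν (s.lower s.j) := by
  rw [twist, twist, s.lab_j hE]; rfl

/-- Twisted labels at a saddle and on a component next to it, before the surgery. -/
theorem Surgery.twist_eq_of_conn (s : Surgery D E) {ν : Fin (h + 1) → Λ.Weight}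
    (hD : D.IsOrientation ν) (hE : E.IsOrientation ν) {S : Set (Node Λ h)} (hS : D.Saturated S)
    {x : Node Λ h} (hx : x ∉ S) (hw : leftCount S x ≠ 0)
    (hc : D.Conn x (s.lower s.i) ∨ D.Conn x (s.upper s.i)) :
    twist ν (s.upper s.j) = twist ν x := by
  rcases hc with h1 | h1
  · rw [(leftCount_conn hS hD hx (h1.trans s.conn_lower)).2 hw]
    exact s.twist_j hE
  · exact ((leftCount_conn hS hD hx (h1.trans s.conn_upper)).2 hw).symm

/-- Twisted labels at a saddle and on a component next to it, after the surgery. -/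
theorem Surgery.twist_eq_of_conn' (s : Surgery D E) {ν : Fin (h + 1) → Λ.Weight}
    (hD : D.IsOrientation ν) (hE : E.IsOrientation ν) {S : Set (Node Λ h)} (hS : E.Saturated S)
    {x : Node Λ h} (hx : x ∉ S) (hw : leftCount S x ≠ 0)
    (hc : E.Conn x (s.lower s.i) ∨ E.Conn x (s.lower s.j)) :
    twist ν (s.upper s.j) = twist ν x := by
  rw [s.twist_j hE]
  rcases hc with h1 | h1
  · obtain ⟨h2, h3⟩ := leftCount_conn hS hE hx h1
    rw [h3 hw]
    exact s.twist_lower_of_leftCount_ne_zero (s.saturatedOff_of_saturated' hS) hD (by rwa [← h2])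
  · exact ((leftCount_conn hS hE hx h1).2 hw).symm

theorem Surgery.pos_j (s : Surgery D E) : (Λ.pos s.j : ZMod 2) = Λ.pos s.i + 1 := by
  have := (D.inner s.level).pos_partner s.i (by rw [s.cup]; exact s.lt.ne')
  rwa [s.cup] at this

/-- If the labels of an orientation of `F` orient the cup of the surgery, then the sign of the split
is a twisted label. -/
theorem Surgery.splitOp_eq_loop (s : Surgery D E) (ν : F.Orientation)
    (hν : D.IsOrientation ν.1) : s.splitOp F =
      chi (twist ν.1 (s.upper s.j) + 1) • (loop ν (s.upper s.j) + loop ν (s.upper s.i)) := by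
  have h1 := s.lab_upper hν
  have h2 : twist ν.1 (s.upper s.j) + 1 = Λ.pos s.i + lab ν.1 (s.upper s.j) := by
    rw [twist, show (s.upper s.j).1 = s.j from rfl, s.pos_j, add_right_comm,
      add_assoc (Λ.pos s.i : ZMod 2) 1 1, zmod_two_add_self, add_zero]
  rw [splitOp, turn_eq_loop ν (s.upper s.j), turn_eq_loop ν (s.upper s.i), h2, chi_add, chi_natCast,
    mul_smul, smul_smul, ← chi_add, add_comm (ind _), ← h1, ← smul_add]

/-! ### Commuting squares of surgeries -/

/-- Two surgeries at different cups are performed in both orders: `s₁` and `t₂` take place at one of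
the cups, `s₂` and `t₁` at the other one. -/
structure Square (s₁ : Surgery D E₁) (s₂ : Surgery D E₂) (t₁ : Surgery E₁ F) (t₂ : Surgery E₂ F) :
    Prop where
  level₁ : t₂.level = s₁.level
  i₁ : t₂.i = s₁.i
  j₁ : t₂.j = s₁.j
  dotted₁ : (E₂.inner t₂.level).dotted t₂.i = (D.inner s₁.level).dotted s₁.i
  level₂ : t₁.level = s₂.level
  i₂ : t₁.i = s₂.i
  j₂ : t₁.j = s₂.j
  dotted₂ : (E₁.inner t₁.level).dotted t₁.i = (D.inner s₂.level).dotted s₂.i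

namespace Square

variable {s₁ : Surgery D E₁} {s₂ : Surgery D E₂} {t₁ : Surgery E₁ F} {t₂ : Surgery E₂ F}
  {ν : Fin (h + 1) → Λ.Weight}

theorem symm (q : Square s₁ s₂ t₁ t₂) : Square s₂ s₁ t₂ t₁ :=
  ⟨q.level₂, q.i₂, q.j₂, q.dotted₂, q.level₁, q.i₁, q.j₁, q.dotted₁⟩

theorem lower_i (q : Square s₁ s₂ t₁ t₂) : t₂.lower t₂.i = s₁.lower s₁.i := by
  rw [Surgery.lower, Surgery.lower, q.level₁, q.i₁]

theorem lower_j (q : Square s₁ s₂ t₁ t₂) : t₂.lower t₂.j = s₁.lower s₁.j := by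
  rw [Surgery.lower, Surgery.lower, q.level₁, q.j₁]

theorem upper_i (q : Square s₁ s₂ t₁ t₂) : t₂.upper t₂.i = s₁.upper s₁.i := by
  rw [Surgery.upper, Surgery.upper, q.level₁, q.i₁]

theorem upper_j (q : Square s₁ s₂ t₁ t₂) : t₂.upper t₂.j = s₁.upper s₁.j := by
  rw [Surgery.upper, Surgery.upper, q.level₁, q.j₁]

theorem splitOp_eq (q : Square s₁ s₂ t₁ t₂) (G : StackedDiagram Λ h) :
    t₂.splitOp G = s₁.splitOp G := by
  rw [Surgery.splitOp, Surgery.splitOp, q.upper_i, q.upper_j, q.dotted₁, q.i₁]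

/-- Labels which orient the first cup, and the rays replacing it, do so as well in the diagrams in
which the second cup is replaced. -/
theorem isOrientation_left (q : Square s₁ s₂ t₁ t₂) (hD : D.IsOrientation ν)
    (hF : F.IsOrientation ν) : E₁.IsOrientation ν := by
  refine s₁.isOrientation_of_lab_eq hD ?_
  rw [← q.lower_i, ← q.upper_i, t₂.lab_i hF]

theorem isOrientation_source (q : Square s₁ s₂ t₁ t₂) (h1 : E₁.IsOrientation ν)
    (h2 : E₂.IsOrientation ν) : D.IsOrientation ν := by
  refine s₁.isOrientation_of_lab_add h1 ?_
  rw [← q.lower_i, ← q.lower_j, t₂.lab_lower h2, q.dotted₁]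

end Square

/-! ### Reconnections in a square -/

/-- A circle through `x` and `z` can be merged with the line through `y` or with the line through
`w`. If both components propagate after one of the merges, then so they do after the other one. -/
theorem propagates_of_merge_merge {x y z w : Node Λ h}
    (hm₁ : HalfEdge.IsMerge D.Conn E₁.Conn D.IsLine x y)
    (hf₁ : ∀ e, E₁.mate e = e ↔ D.mate e = e)
    (hm₂ : HalfEdge.IsMerge D.Conn E₂.Conn D.IsLine z w)
    (hf₂ : ∀ e, E₂.mate e = e ↔ D.mate e = e) (hz : ¬ D.IsLine z) (hPz : E₁.Propagates z)
    (hPw : E₁.Propagates w) (hne : ¬ E₁.Conn z w) (hzx : D.Conn z x) :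
    E₂.Propagates x ∧ E₂.Propagates y := by
  have hx : ¬ D.IsLine x := (isLine_congr hzx).not.1 hz
  have hPx : E₁.Propagates x := hPz.of_conn (merge_mono hm₁ hzx)
  have hPy : E₁.Propagates y := hPx.of_conn (merge_conn hm₁)
  have hy : D.IsLine y := ((merge_isLine hm₁ hf₁).1 hPx.isLine).resolve_left hx
  have hw : ¬ E₁.Conn w x := fun h1 => hne ((merge_mono hm₁ hzx).trans (Conn.symm h1))
  have hwl : D.IsLine w := (merge_isLine_off hm₁ hf₁ hw).1 hPw.isLine
  have hwD : D.Propagates w := (merge_propagates_of_isLine hm₁ hf₁ hwl).1 hPw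
  refine ⟨?_, ?_⟩
  · exact ((merge_propagates_of_isLine hm₂ hf₂ hwl).2 hwD).of_conn
      ((merge_conn hm₂).symm.trans (merge_mono hm₂ hzx))
  · exact (merge_propagates_of_isLine hm₂ hf₂ hy).2 ((merge_propagates_of_isLine hm₁ hf₁ hy).1 hPy)

namespace Square

variable {s₁ : Surgery D E₁} {s₂ : Surgery D E₂} {t₁ : Surgery E₁ F} {t₂ : Surgery E₂ F}

/-- A circle between two propagating lines is merged with either of them, and then the two lines are
reconnected. -/
theorem isGood_of_merge_reconnect (q : Square s₁ s₂ t₁ t₂) (ν₀ : D.Orientation)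
    (hs₁ : s₁.IsMerge) (ht₁ : t₁.IsReconnect) (hs₂ : s₂.IsMerge) (hg : t₁.IsGood) :
    t₂.IsGood := by
  obtain ⟨⟨ν, h1, h2⟩, h3, h4⟩ := hg
  have hD := hs₁.isOrientation ν₀.2 h1
  have hne := ht₁.ne
  rw [q.symm.lower_i] at h3 hne
  rw [q.symm.upper_i] at h4 hne
  refine ⟨⟨ν, q.symm.isOrientation_left hD h2, h2⟩, ?_⟩
  rw [q.lower_i, q.upper_i]
  have hs₁' : HalfEdge.IsMerge D.Conn E₁.Conn D.IsLine (s₁.upper s₁.i) (s₁.lower s₁.i) :=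
    HalfEdge.IsMerge.symm hs₁ fun _ _ => Conn.symm
  have key : ∀ z w, HalfEdge.IsMerge D.Conn E₂.Conn D.IsLine z w → ¬ D.IsLine z →
      E₁.Propagates z → E₁.Propagates w → ¬ E₁.Conn z w →
      E₂.Propagates (s₁.lower s₁.i) ∧ E₂.Propagates (s₁.upper s₁.i) := by
    intro z w hm hz hPz hPw hzw
    have h5 : E₁.Conn z (s₁.lower s₁.i) := by
      by_contra h5
      exact hz ((merge_isLine_off hs₁ s₁.free_iff h5).1 hPz.isLine)
    rcases (merge_conn_iff hs₁).1 h5 with h6 | h6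
    · exact propagates_of_merge_merge hs₁ s₁.free_iff hm s₂.free_iff hz hPz hPw hzw h6
    · exact (propagates_of_merge_merge hs₁' s₁.free_iff hm s₂.free_iff hz hPz hPw hzw h6).symm
  rcases hs₂.circle with h5 | h5
  · exact key _ _ hs₂ h5 h3 h4 hne
  · exact key _ _ (HalfEdge.IsMerge.symm hs₂ fun _ _ => Conn.symm) h5 h4 h3
      fun h6 => hne (Conn.symm h6)

/-- Two lines are reconnected before or after a merge with a circle. -/
theorem isGood_iff_of_merge (q : Square s₁ s₂ t₁ t₂) (ν₀ : D.Orientation)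
    (hs₁ : s₁.IsMerge) (hs₂ : s₂.IsReconnect) (ht₂ : t₂.IsMerge) :
    t₁.IsGood ↔ s₂.IsGood := by
  have hprop : (E₁.Propagates (s₂.lower s₂.i) ∧ E₁.Propagates (s₂.upper s₂.i)) ↔
      D.Propagates (s₂.lower s₂.i) ∧ D.Propagates (s₂.upper s₂.i) := by
    rw [merge_propagates_of_isLine hs₁ s₁.free_iff hs₂.line_a,
      merge_propagates_of_isLine hs₁ s₁.free_iff hs₂.line_c]
  rw [Surgery.IsGood, Surgery.IsGood, q.symm.lower_i, q.symm.upper_i, hprop]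
  refine and_congr_left fun _ => ⟨?_, ?_⟩
  · rintro ⟨ν, h1, h2⟩
    have hD := hs₁.isOrientation ν₀.2 h1
    exact ⟨ν, hD, q.symm.isOrientation_left hD h2⟩
  · rintro ⟨ν, h1, h2⟩
    obtain ⟨ν', h3, h4, -⟩ := ht₂.exists_isOrientation h2
    exact ⟨ν', q.isOrientation_left (hs₂.isOrientation' h1 h2 h3) h4, h4⟩

/-- Two lines are reconnected before or after a circle splits off. -/
theorem isGood_iff_of_split (q : Square s₁ s₂ t₁ t₂) (μ₀ : F.Orientation)
    (hs₁ : s₁.IsSplit) (ht₁ : t₁.IsReconnect) (ht₂ : t₂.IsSplit) :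
    t₁.IsGood ↔ s₂.IsGood := by
  have hla : E₁.IsLine (s₂.lower s₂.i) := by rw [← q.symm.lower_i]; exact ht₁.line_a
  have hlc : E₁.IsLine (s₂.upper s₂.i) := by rw [← q.symm.upper_i]; exact ht₁.line_c
  have hprop : (E₁.Propagates (s₂.lower s₂.i) ∧ E₁.Propagates (s₂.upper s₂.i)) ↔
      D.Propagates (s₂.lower s₂.i) ∧ D.Propagates (s₂.upper s₂.i) := by
    rw [merge_propagates_of_isLine hs₁ s₁.free_iff' hla,
      merge_propagates_of_isLine hs₁ s₁.free_iff' hlc]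
  rw [Surgery.IsGood, Surgery.IsGood, q.symm.lower_i, q.symm.upper_i, hprop]
  refine and_congr_left fun _ => ⟨?_, ?_⟩
  · rintro ⟨ν, h1, h2⟩
    obtain ⟨ν', h3, h4, -⟩ := hs₁.exists_isOrientation h1
    exact ⟨ν', h3, q.symm.isOrientation_left h3 (ht₁.isOrientation h1 h2 h4)⟩
  · rintro ⟨ν, h1, h2⟩
    have hF := ht₂.isOrientation μ₀.2 h2
    exact ⟨ν, q.isOrientation_left h1 hF, hF⟩

/-- The first reconnection turns lines into lines, so the components at the other cup remain lines.
-/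
theorem not_reconnect_merge (q : Square s₁ s₂ t₁ t₂) (hs₁ : s₁.IsReconnect) (ht₁ : t₁.IsMerge)
    (hs₂ : s₂.IsReconnect) : False := by
  have := ht₁.circle
  rw [q.symm.lower_i, q.symm.upper_i, reconnect_isLine hs₁ s₁.free_iff,
    reconnect_isLine hs₁ s₁.free_iff] at this
  exact this.elim (fun h1 => h1 hs₂.line_a) fun h1 => h1 hs₂.line_c

/-- The components of `F` at a cup replaced by `t₁` are lines, also before the reconnection `t₂`, so
no circle has split off there. -/
theorem not_split_reconnect (q : Square s₁ s₂ t₁ t₂) (ht₁ : t₁.IsReconnect) (hs₂ : s₂.IsSplit)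
    (ht₂ : t₂.IsReconnect) : False := by
  have h1 := ht₁.line_a'
  have h2 := ht₁.line_b'
  rw [q.symm.lower_i, reconnect_isLine ht₂ t₂.free_iff] at h1
  rw [q.symm.lower_j, reconnect_isLine ht₂ t₂.free_iff] at h2
  exact hs₂.circle.elim (fun h3 => h3 h1) fun h3 => h3 h2

/-- Merging a circle with another component does not connect two different lines. -/
theorem not_merge_split (q : Square s₁ s₂ t₁ t₂) (hs₁ : s₁.IsMerge) (ht₁ : t₁.IsSplit)
    (hs₂ : s₂.IsReconnect) : False := by
  have h1 := merge_mono ht₁ t₁.conn_i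
  rw [q.symm.lower_i, q.symm.upper_i, hs₁.iff] at h1
  have h2 : ¬ D.IsLine (s₁.lower s₁.i) ∨ ¬ D.IsLine (s₁.upper s₁.i) := hs₁.circle
  have key : ∀ {x}, D.Conn (s₂.lower s₂.i) x ∨ D.Conn (s₂.upper s₂.i) x → D.IsLine x := fun hx =>
    hx.elim (fun h3 => IsLine.of_conn hs₂.line_a h3) fun h3 => IsLine.of_conn hs₂.line_c h3
  rcases h1 with h1 | ⟨h3 | h3, h4 | h4⟩
  · exact hs₂.ne h1
  · exact hs₂.ne (h3.trans (Conn.symm h4))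
  · exact h2.elim (fun h5 => h5 (key (Or.inl h3))) fun h5 => h5 (key (Or.inr h4))
  · exact h2.elim (fun h5 => h5 (key (Or.inr h4))) fun h5 => h5 (key (Or.inl h3))
  · exact hs₂.ne (h3.trans (Conn.symm h4))

/-- If both surgeries of a path reconnect two propagating lines to propagating lines, then they
involve four different lines. -/
theorem isGood_of_reconnect_reconnect (q : Square s₁ s₂ t₁ t₂) (hs₁ : s₁.IsReconnect)
    (ht₁ : t₁.IsReconnect) (hg₁ : s₁.IsGood) (hg₂ : t₁.IsGood) :
    s₂.IsReconnect ∧ s₂.IsGood ∧ (t₂.IsReconnect → t₂.IsGood) := by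
  obtain ⟨⟨ν, hD, hE⟩, hP, hQ⟩ := hg₁
  obtain ⟨⟨ν₁, h1, h2⟩, hP', hQ'⟩ := hg₂
  have hF := ht₁.isOrientation h1 h2 hE
  have hE₂ := q.symm.isOrientation_left hD hF
  obtain ⟨hn1, hn2⟩ := hs₁.not_propagates hD hE hP hQ
  have hne := ht₁.ne
  rw [q.symm.lower_i] at hP' hne
  rw [q.symm.upper_i] at hQ' hne
  have hoff : ∀ x, E₁.Propagates x →
      ¬ (D.Conn x (s₁.lower s₁.i) ∨ D.Conn x (s₁.upper s₁.i)) := by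
    intro x hx
    rw [hs₁.mem]
    rintro (h3 | h3)
    · exact hn1 (hx.of_conn h3)
    · exact hn2 (hx.of_conn h3)
  have hPD := (reconnect_propagates_off hs₁ s₁.free_iff (hoff _ hP')).1 hP'
  have hQD := (reconnect_propagates_off hs₁ s₁.free_iff (hoff _ hQ')).1 hQ'
  have hneD : ¬ D.Conn (s₂.lower s₂.i) (s₂.upper s₂.i) := by
    rw [hs₁.off _ _ (hoff _ hP')]; exact hne
  have hs₂ : s₂.IsReconnect := by
    rcases s₂.trichotomy with ⟨h3, -⟩ | ⟨h3, -⟩ | ⟨h3, -⟩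
    · exact (h3.circle.elim (fun h4 => h4 hPD.isLine) fun h4 => h4 hQD.isLine).elim
    · exact absurd (merge_mono h3 s₂.conn_i) hneD
    · exact h3
  refine ⟨hs₂, ⟨⟨ν, hD, hE₂⟩, hPD, hQD⟩, fun ht₂ => ⟨⟨ν, hE₂, hF⟩, ?_, ?_⟩⟩
  · rw [q.lower_i, reconnect_propagates_off hs₂ s₂.free_iff]
    · exact hP
    · rintro (h3 | h3)
      · exact hoff _ hP' (Or.inl (Conn.symm h3))
      · exact hoff _ hQ' (Or.inl (Conn.symm h3))
  · rw [q.upper_i, reconnect_propagates_off hs₂ s₂.free_iff]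
    · exact hQ
    · rintro (h3 | h3)
      · exact hoff _ hP' (Or.inr (Conn.symm h3))
      · exact hoff _ hQ' (Or.inr (Conn.symm h3))

/-- In `F` the components at a cup replaced by a reconnection are lines. -/
theorem splitOp_eq_zero (q : Square s₁ s₂ t₁ t₂) (ht₂ : t₂.IsReconnect) : s₁.splitOp F = 0 := by
  have h1 : F.IsLine (t₂.upper t₂.i) := IsLine.of_conn ht₂.line_a' t₂.conn_i
  have h2 : F.IsLine (t₂.upper t₂.j) := IsLine.of_conn ht₂.line_b' t₂.conn_j
  rw [← q.splitOp_eq, Surgery.splitOp, turn_of_isLine h1, turn_of_isLine h2, smul_zero, add_zero,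
    smul_zero]

/-! ### Splits in a square -/

/-- Two saddles which lie between the same two components of `D`. -/
def Between (s₁ : Surgery D E₁) (s₂ : Surgery D E₂) : Prop :=
  (D.Conn (s₂.lower s₂.i) (s₁.lower s₁.i) ∧ D.Conn (s₂.upper s₂.i) (s₁.upper s₁.i)) ∨
    (D.Conn (s₂.lower s₂.i) (s₁.upper s₁.i) ∧ D.Conn (s₂.upper s₂.i) (s₁.lower s₁.i))

/-- If one of the two components passes an odd number of times to the left of the other one, then
there are no dots on the latter, and the signs of the two saddles agree. -/
theorem twist_eq_of_between {ν : Fin (h + 1) → Λ.Weight} (hD : D.IsOrientation ν)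
    (h1 : E₁.IsOrientation ν) (h2 : E₂.IsOrientation ν) (hb : Between s₁ s₂)
    (hne : ¬ D.Conn (s₁.lower s₁.i) (s₁.upper s₁.i))
    (hw : leftCount {y | D.Conn (s₁.lower s₁.i) y} (s₁.upper s₁.i) ≠ 0 ∨
      leftCount {y | D.Conn (s₁.upper s₁.i) y} (s₁.lower s₁.i) ≠ 0) :
    twist ν (s₁.upper s₁.j) = twist ν (s₂.upper s₂.j) := by
  rcases hw with hw | hw
  · have hS := saturated_conn (D := D) (s₁.lower s₁.i)
    rw [s₁.twist_eq_of_conn hD h1 hS hne hw (Or.inr (Conn.refl _)),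
      s₂.twist_eq_of_conn hD h2 hS hne hw]
    exact hb.elim (fun h3 => Or.inr h3.2.symm) fun h3 => Or.inl h3.1.symm
  · have hS := saturated_conn (D := D) (s₁.upper s₁.i)
    have hne' : s₁.lower s₁.i ∉ {y | D.Conn (s₁.upper s₁.i) y} := fun h3 => hne (Conn.symm h3)
    rw [s₁.twist_eq_of_conn hD h1 hS hne' hw (Or.inl (Conn.refl _)),
      s₂.twist_eq_of_conn hD h2 hS hne' hw]
    exact hb.elim (fun h3 => Or.inl h3.1.symm) fun h3 => Or.inr h3.2.symm

theorem loop_upper_i (q : Square s₁ s₂ t₁ t₂) (μ : F.Orientation) :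
    loop μ (s₁.upper s₁.i) = loop μ (s₁.lower s₁.i) := by
  rw [← q.upper_i, ← q.lower_i]; exact loop_of_conn μ t₂.conn_i.symm

theorem loop_upper_j (q : Square s₁ s₂ t₁ t₂) (μ : F.Orientation) :
    loop μ (s₁.upper s₁.j) = loop μ (s₁.lower s₁.j) := by
  rw [← q.upper_j, ← q.lower_j]; exact loop_of_conn μ t₂.conn_j.symm

/-- Two lines are reconnected and then a circle splits off, in either order. -/
theorem splitOp_eq_of_reconnect_split (q : Square s₁ s₂ t₁ t₂) (μ₀ : F.Orientation)
    (hs₁ : s₁.IsReconnect) (ht₁ : t₁.IsSplit) (hs₂ : s₂.IsReconnect) (ht₂ : t₂.IsSplit)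
    (hg : s₁.IsGood) : s₂.IsGood ∧ s₁.splitOp F = s₂.splitOp F := by
  obtain ⟨⟨ν, hD, hE⟩, hP, hQ⟩ := hg
  have hF := ht₁.isOrientation μ₀.2 hE
  have hE₂ := q.symm.isOrientation_left hD hF
  have hac := merge_mono ht₁ t₁.conn_i
  rw [q.symm.lower_i, q.symm.upper_i] at hac
  have hneD : ¬ D.Conn (s₂.lower s₂.i) (s₂.upper s₂.i) := hs₂.ne
  have hb : Between s₁ s₂ := by
    have h1 : D.Conn (s₂.lower s₂.i) (s₁.lower s₁.i) ∨ D.Conn (s₂.lower s₂.i) (s₁.upper s₁.i) := by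
      by_contra h1
      exact hneD ((hs₁.off _ _ h1).2 hac)
    have h2 : D.Conn (s₂.upper s₂.i) (s₁.lower s₁.i) ∨ D.Conn (s₂.upper s₂.i) (s₁.upper s₁.i) := by
      by_contra h2
      exact hneD (Conn.symm ((hs₁.off _ _ h2).2 hac.symm))
    rcases h1 with h1 | h1 <;> rcases h2 with h2 | h2
    · exact absurd (h1.trans h2.symm) hneD
    · exact Or.inl ⟨h1, h2⟩
    · exact Or.inr ⟨h1, h2⟩
    · exact absurd (h1.trans h2.symm) hneD
  refine ⟨⟨⟨ν, hD, hE₂⟩, ?_, ?_⟩, ?_⟩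
  · exact hb.elim (fun h3 => hP.of_conn h3.1.symm) fun h3 => hQ.of_conn h3.1.symm
  · exact hb.elim (fun h3 => hQ.of_conn h3.2.symm) fun h3 => hP.of_conn h3.2.symm
  -- One of the two propagating lines lies to the left of the other one.
  have htw : twist ν (s₁.upper s₁.j) = twist ν (s₂.upper s₂.j) := by
    refine twist_eq_of_between hD hE hE₂ hb hs₁.ne ?_
    by_contra! h3
    have h4 := leftCount_add_of_propagates hD hP hQ hs₁.ne
    rw [h3.1, h3.2] at h4
    exact absurd h4 (by decide)
  obtain ⟨μ, rfl⟩ : ∃ μ : F.Orientation, μ.1 = ν := ⟨⟨ν, hF⟩, rfl⟩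
  rw [s₁.splitOp_eq_loop μ hD, s₂.splitOp_eq_loop μ hD, htw]
  congr 1
  -- In `F` there is only one circle through the end points of the two saddles.
  have hline₁ : F.IsLine (s₁.lower s₁.i) ∨ F.IsLine (s₁.lower s₁.j) := by
    have h1 := merge_isLine ht₂ t₂.free_iff'
    rw [q.lower_i, q.lower_j] at h1
    exact h1.1 ((reconnect_isLine hs₂ s₂.free_iff _).2 hs₁.line_a)
  have hline₂ : F.IsLine (s₂.lower s₂.i) ∨ F.IsLine (s₂.lower s₂.j) := by
    have h1 := merge_isLine ht₁ t₁.free_iff'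
    rw [q.symm.lower_i, q.symm.lower_j] at h1
    exact h1.1 ((reconnect_isLine hs₁ s₁.free_iff _).2 hs₂.line_a)
  have hcir₁ : ¬ F.IsLine (s₁.lower s₁.i) ∨ ¬ F.IsLine (s₁.lower s₁.j) := by
    rw [← q.lower_i, ← q.lower_j]; exact ht₂.circle
  have hmeet : ∀ z, E₁.IsLine z → ¬ F.IsLine z →
      F.Conn z (s₂.lower s₂.i) ∨ F.Conn z (s₂.lower s₂.j) := by
    intro z hz hz'
    have h1 := merge_conn_iff (x := z) ht₁
    rw [q.symm.lower_i, q.symm.lower_j] at h1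
    rw [← h1]
    by_contra h2
    rw [← q.symm.lower_i] at h2
    exact hz' ((merge_isLine_off ht₁ t₁.free_iff' h2).1 hz)
  have hsum : ∀ z, ¬ F.IsLine z → F.Conn z (s₂.lower s₂.i) ∨ F.Conn z (s₂.lower s₂.j) →
      loop μ (s₂.upper s₂.j) + loop μ (s₂.upper s₂.i) = loop μ z := by
    intro z hz hz'
    rw [q.symm.loop_upper_i, q.symm.loop_upper_j]
    rcases hz' with h1 | h1
    · have h2 := hline₂.resolve_left ((isLine_congr h1).not.1 hz)
      rw [loop_of_isLine μ h2, zero_add, loop_of_conn μ h1]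
    · have h2 := hline₂.resolve_right ((isLine_congr h1).not.1 hz)
      rw [loop_of_isLine μ h2, add_zero, loop_of_conn μ h1]
  rw [q.loop_upper_i, q.loop_upper_j]
  rcases hcir₁ with h1 | h1
  · rw [hsum _ h1 (hmeet _ hs₁.line_a' h1), loop_of_isLine μ (hline₁.resolve_left h1), zero_add]
  · rw [hsum _ h1 (hmeet _ hs₁.line_b' h1), loop_of_isLine μ (hline₁.resolve_right h1), add_zero]

end Square

/-! ### Merges and splits in a square -/

namespace Square

variable {s₁ : Surgery D E₁} {s₂ : Surgery D E₂} {t₁ : Surgery E₁ F} {t₂ : Surgery E₂ F}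

/-- Two components of `D` are merged by one of the surgeries and split again by the other one.
Either the components of `D` or those of `F` have odd position relative to each other, and this
forces the twisted labels at both saddles to agree. -/
theorem splitOp_eq_of_merge_split (q : Square s₁ s₂ t₁ t₂) (ν₀ : D.Orientation) (μ₀ : F.Orientation)
    (hs₁ : s₁.IsMerge) (ht₁ : t₁.IsSplit) (hs₂ : s₂.IsMerge) (ht₂ : t₂.IsSplit) :
    s₁.splitOp F = s₂.splitOp F := by
  obtain ⟨ν, hE, hF, -⟩ := ht₁.exists_isOrientation μ₀.2
  have hD := hs₁.isOrientation ν₀.2 hE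
  have hE₂ := q.symm.isOrientation_left hD hF
  obtain ⟨μ, rfl⟩ : ∃ μ : F.Orientation, μ.1 = ν := ⟨⟨ν, hF⟩, rfl⟩
  have hneD : ¬ D.Conn (s₂.lower s₂.i) (s₂.upper s₂.i) := hs₂.ne
  have hac := merge_mono ht₁ t₁.conn_i
  rw [q.symm.lower_i, q.symm.upper_i] at hac
  have hb : Between s₁ s₂ := by
    rcases (hs₁.iff _ _).1 hac with h1 | ⟨h1 | h1, h2 | h2⟩
    · exact absurd h1 hneD
    · exact absurd (h1.trans (Conn.symm h2)) hneD
    · exact Or.inl ⟨h1, h2⟩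
    · exact Or.inr ⟨h1, h2⟩
    · exact absurd (h1.trans (Conn.symm h2)) hneD
  -- The components of `F` at the two saddles.
  have hsplit₁ : ∀ x, E₁.Conn x (s₂.lower s₂.i) ↔
      F.Conn x (s₂.lower s₂.i) ∨ F.Conn x (s₂.lower s₂.j) := by
    intro x
    have := merge_conn_iff (x := x) ht₁
    rwa [q.symm.lower_i, q.symm.lower_j] at this
  have hneF : ¬ F.Conn (s₁.lower s₁.i) (s₁.lower s₁.j) := by
    rw [← q.lower_i, ← q.lower_j]; exact ht₂.ne
  have hK : E₁.Conn (s₁.lower s₁.i) (s₂.lower s₂.i) := by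
    refine Conn.symm ?_
    rcases hb with h1 | h1
    · exact merge_mono hs₁ h1.1
    · exact (merge_mono hs₁ h1.1).trans (merge_conn hs₁).symm
  have hmatch : (F.Conn (s₁.lower s₁.i) (s₂.lower s₂.i) ∧ F.Conn (s₁.lower s₁.j) (s₂.lower s₂.j)) ∨
      (F.Conn (s₁.lower s₁.i) (s₂.lower s₂.j) ∧ F.Conn (s₁.lower s₁.j) (s₂.lower s₂.i)) := by
    have h1 := (hsplit₁ _).1 hK
    have h2 := (hsplit₁ _).1 ((merge_mono hs₁ s₁.conn_lower).symm.trans hK)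
    rcases h1 with h1 | h1 <;> rcases h2 with h2 | h2
    · exact absurd (h1.trans h2.symm) hneF
    · exact Or.inl ⟨h1, h2⟩
    · exact Or.inr ⟨h1, h2⟩
    · exact absurd (h1.trans h2.symm) hneF
  have htw : twist μ.1 (s₁.upper s₁.j) = twist μ.1 (s₂.upper s₂.j) := by
    by_cases hw : leftCount {y | D.Conn (s₁.lower s₁.i) y} (s₁.upper s₁.i) ≠ 0 ∨
        leftCount {y | D.Conn (s₁.upper s₁.i) y} (s₁.lower s₁.i) ≠ 0
    · exact twist_eq_of_between hD hE hE₂ hb hs₁.ne hw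
    push Not at hw
    -- Otherwise one of the components of `F` passes an odd number of times to the left of the
    -- other one.
    have key : ∀ (S : Set (Node Λ h)) (x : Node Λ h), F.Saturated S → x ∉ S → leftCount S x ≠ 0 →
        (x = s₁.lower s₁.i ∨ x = s₁.lower s₁.j) →
        twist μ.1 (s₁.upper s₁.j) = twist μ.1 (s₂.upper s₂.j) := by
      intro S x hS hx hwx hx'
      rw [← q.upper_j, ← q.symm.upper_j, t₂.twist_eq_of_conn' hE₂ hF hS hx hwx,
        t₁.twist_eq_of_conn' hE hF hS hx hwx]
      · rw [q.symm.lower_i, q.symm.lower_j]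
        rcases hx' with rfl | rfl
        · exact hmatch.elim (fun h1 => Or.inl h1.1) fun h1 => Or.inr h1.1
        · exact hmatch.elim (fun h1 => Or.inr h1.2) fun h1 => Or.inl h1.2
      · rw [q.lower_i, q.lower_j]
        rcases hx' with rfl | rfl
        · exact Or.inl (Conn.refl _)
        · exact Or.inr (Conn.refl _)
    have hP : leftCount {y | D.Conn (s₁.lower s₁.i) y} (s₁.lower s₁.i) = 0 := by
      rw [← s₁.leftCount_upper_i (s₁.saturatedOff_of_saturated (saturated_conn _)), hw.1]
    have hset : {y | D.Conn (s₁.lower s₁.i) y} ∪ {y | D.Conn (s₁.upper s₁.i) y} =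
        {y | F.Conn (s₁.lower s₁.i) y} ∪ {y | F.Conn (s₁.lower s₁.j) y} := by
      ext y
      change D.Conn _ y ∨ D.Conn _ y ↔ F.Conn _ y ∨ F.Conn _ y
      have h1 : E₁.Conn y (s₁.lower s₁.i) ↔ E₁.Conn y (s₂.lower s₂.i) :=
        ⟨fun h2 => h2.trans hK, fun h2 => h2.trans hK.symm⟩
      have h2 : F.Conn y (s₂.lower s₂.i) ∨ F.Conn y (s₂.lower s₂.j) ↔
          F.Conn y (s₁.lower s₁.i) ∨ F.Conn y (s₁.lower s₁.j) := by
        rcases hmatch with h3 | h3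
        · exact or_congr ⟨fun h4 => h4.trans h3.1.symm, fun h4 => h4.trans h3.1⟩
            ⟨fun h4 => h4.trans h3.2.symm, fun h4 => h4.trans h3.2⟩
        · rw [or_comm]
          exact or_congr ⟨fun h4 => h4.trans h3.1.symm, fun h4 => h4.trans h3.1⟩
            ⟨fun h4 => h4.trans h3.2.symm, fun h4 => h4.trans h3.2⟩
      rw [conn_comm, conn_comm (x := s₁.upper s₁.i), ← merge_conn_iff hs₁, h1, hsplit₁, h2,
        conn_comm, conn_comm (x := y)]
    have hsum : leftCount {y | F.Conn (s₁.lower s₁.i) y} (s₁.lower s₁.i) +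
        leftCount {y | F.Conn (s₁.lower s₁.j) y} (s₁.lower s₁.i) = 0 := by
      have hdisj : ∀ x ∈ {y | F.Conn (s₁.lower s₁.i) y}, x ∉ {y | F.Conn (s₁.lower s₁.j) y} :=
        fun x h1 h2 => hneF (Conn.trans h1 (Conn.symm h2))
      have hdisj' : ∀ x ∈ {y | D.Conn (s₁.lower s₁.i) y}, x ∉ {y | D.Conn (s₁.upper s₁.i) y} :=
        fun x h1 h2 => hs₁.ne (Conn.trans h1 (Conn.symm h2))
      rw [← leftCount_union hdisj, ← hset, leftCount_union hdisj', hP, hw.2, add_zero]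
    by_cases h1 : leftCount {y | F.Conn (s₁.lower s₁.j) y} (s₁.lower s₁.i) = 0
    · refine key {y | F.Conn (s₁.lower s₁.i) y} (s₁.lower s₁.j) (saturated_conn _) hneF ?_
        (Or.inr rfl)
      rw [h1, add_zero] at hsum
      have h2 := t₂.leftCount_lower_j (S := {y | F.Conn (s₁.lower s₁.i) y})
        (t₂.saturatedOff_of_saturated' (saturated_conn _))
      rw [q.lower_i, q.lower_j, hsum, zero_add, ind_of_true (mem_conn_self _)] at h2
      rw [h2]; exact one_ne_zero
    · exact key {y | F.Conn (s₁.lower s₁.j) y} (s₁.lower s₁.i) (saturated_conn _)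
        (fun h2 => hneF (Conn.symm h2)) h1 (Or.inl rfl)
  rw [s₁.splitOp_eq_loop μ hD, s₂.splitOp_eq_loop μ hD, htw, q.loop_upper_i, q.loop_upper_j,
    q.symm.loop_upper_i, q.symm.loop_upper_j]
  congr 1
  rcases hmatch with h1 | h1
  · rw [loop_of_conn μ h1.1, loop_of_conn μ h1.2]
  · rw [loop_of_conn μ h1.1, loop_of_conn μ h1.2, add_comm]

/-- If the component of `D` through both saddles splits into two components which are merged again,
then either the signs of the saddles agree, or the position of the first saddle relative to this
component is odd and that of the second one is even. -/
theorem twist_eq_or (q : Square s₁ s₂ t₁ t₂) {ν : Fin (h + 1) → Λ.Weight} (hD : D.IsOrientation ν)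
    (hE : E₁.IsOrientation ν) (hF : F.IsOrientation ν) (hs₁ : s₁.IsSplit)
    (hm : (E₁.Conn (s₂.lower s₂.i) (s₁.lower s₁.i) ∧ E₁.Conn (s₂.upper s₂.i) (s₁.lower s₁.j)) ∨
      (E₁.Conn (s₂.lower s₂.i) (s₁.lower s₁.j) ∧ E₁.Conn (s₂.upper s₂.i) (s₁.lower s₁.i))) :
    twist ν (s₁.upper s₁.j) = twist ν (s₂.upper s₂.j) ∨
      (leftCount {y | D.Conn (s₁.lower s₁.i) y} (s₁.lower s₁.i) = 1 ∧
        leftCount {y | D.Conn (s₁.lower s₁.i) y} (s₂.lower s₂.i) = 0) := by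
  have hne : ¬ E₁.Conn (s₁.lower s₁.i) (s₁.lower s₁.j) := hs₁.ne
  have hA := saturated_conn (D := E₁) (s₁.lower s₁.i)
  have hB := saturated_conn (D := E₁) (s₁.lower s₁.j)
  have hne' : s₁.lower s₁.i ∉ {y | E₁.Conn (s₁.lower s₁.j) y} := fun h1 => hne (Conn.symm h1)
  by_cases hα : leftCount {y | E₁.Conn (s₁.lower s₁.i) y} (s₁.lower s₁.j) = 0
  swap
  · left
    rw [← q.symm.upper_j, s₁.twist_eq_of_conn' hD hE hA hne hα (Or.inr (Conn.refl _)),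
      t₁.twist_eq_of_conn hE hF hA hne hα]
    rw [q.symm.lower_i, q.symm.upper_i]
    exact hm.elim (fun h1 => Or.inr h1.2.symm) fun h1 => Or.inl h1.1.symm
  by_cases hβ : leftCount {y | E₁.Conn (s₁.lower s₁.j) y} (s₁.lower s₁.i) = 0
  swap
  · left
    rw [← q.symm.upper_j, s₁.twist_eq_of_conn' hD hE hB hne' hβ (Or.inl (Conn.refl _)),
      t₁.twist_eq_of_conn hE hF hB hne' hβ]
    rw [q.symm.lower_i, q.symm.upper_i]
    exact hm.elim (fun h1 => Or.inl h1.1.symm) fun h1 => Or.inr h1.2.symm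
  right
  have hset : {y | D.Conn (s₁.lower s₁.i) y} =
      {y | E₁.Conn (s₁.lower s₁.i) y} ∪ {y | E₁.Conn (s₁.lower s₁.j) y} := by
    ext y
    change D.Conn _ y ↔ E₁.Conn _ y ∨ E₁.Conn _ y
    rw [conn_comm, conn_comm (y := y), conn_comm (y := y), merge_conn_iff hs₁]
  have hdisj : ∀ x ∈ {y | E₁.Conn (s₁.lower s₁.i) y}, x ∉ {y | E₁.Conn (s₁.lower s₁.j) y} :=
    fun x h1 h2 => hne (Conn.trans h1 (Conn.symm h2))
  have hlevel : ∀ {S : Set (Node Λ h)}, E₁.Saturated S →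
      leftCount S (s₂.upper s₂.i) = leftCount S (s₂.lower s₂.i) := by
    intro S hS
    have := t₁.leftCount_upper_i (t₁.saturatedOff_of_saturated hS)
    rwa [q.symm.lower_i, q.symm.upper_i] at this
  have hconst : ∀ x, E₁.Conn x (s₁.lower s₁.j) →
      leftCount {y | E₁.Conn (s₁.lower s₁.i) y} x = 0 := fun x hx =>
    ((leftCount_conn hA hE (x := s₁.lower s₁.j) hne hx.symm).1.symm).trans hα
  have hconst' : ∀ x, E₁.Conn x (s₁.lower s₁.i) →
      leftCount {y | E₁.Conn (s₁.lower s₁.j) y} x = 0 := fun x hx =>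
    ((leftCount_conn hB hE hne' hx.symm).1.symm).trans hβ
  rw [hset, leftCount_union hdisj, leftCount_union hdisj, hβ, add_zero]
  constructor
  · have h1 := s₁.leftCount_lower_j (s₁.saturatedOff_of_saturated' hA)
    rw [hα, ind_of_true (mem_conn_self _)] at h1
    exact (zmod_two_add_eq_zero.1 h1.symm)
  · rcases hm with h1 | h1
    · rw [← hlevel hA, hconst _ h1.2, hconst' _ h1.1, add_zero]
    · rw [hconst _ h1.1, ← hlevel hB, hconst' _ h1.2, add_zero]

/-- A component of `D` is split by one of the surgeries, and the two parts are merged again by the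
other one. The two summands of the split become proportional in `V(F)`. Unless they cancel, the
labels of an orientation of `E₁` and `F` also orient `E₂` and `D`. -/
theorem splitOp_eq_of_split_merge (q : Square s₁ s₂ t₁ t₂) (hs₁ : s₁.IsSplit) (ht₁ : t₁.IsMerge)
    (hs₂ : s₂.IsSplit) (ht₂ : t₂.IsMerge) (ν₁ : E₁.Orientation) (h0 : s₁.splitOp F ≠ 0) :
    Nonempty E₂.Orientation ∧ s₁.splitOp F = s₂.splitOp F := by
  obtain ⟨ν, hE, hF, -⟩ := ht₁.exists_isOrientation ν₁.2
  have hFij : F.Conn (s₁.lower s₁.i) (s₁.lower s₁.j) := by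
    rw [← q.lower_i, ← q.lower_j]; exact merge_mono ht₂ t₂.conn_lower
  have hFi : F.Conn (s₁.upper s₁.i) (s₁.lower s₁.i) := by
    rw [← q.upper_i, ← q.lower_i]; exact t₂.conn_i.symm
  have hFj : F.Conn (s₁.upper s₁.j) (s₁.lower s₁.j) := by
    rw [← q.upper_j, ← q.lower_j]; exact t₂.conn_j.symm
  obtain ⟨μ, rfl⟩ : ∃ μ : F.Orientation, μ.1 = ν := ⟨⟨ν, hF⟩, rfl⟩
  have hcup : lab μ.1 (s₁.upper s₁.j) =
      lab μ.1 (s₁.upper s₁.i) + ind ((D.inner s₁.level).dotted s₁.i = false) := by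
    by_contra hcon
    refine h0 ?_
    rw [Surgery.splitOp, turn_of_conn μ (hFj.trans (hFij.symm.trans hFi.symm)), ← add_smul]
    have h1 : lab μ.1 (s₁.upper s₁.j) + lab μ.1 (s₁.upper s₁.i) =
        ind ((D.inner s₁.level).dotted s₁.i = false) + 1 := by
      revert hcon
      generalize lab μ.1 (s₁.upper s₁.j) = u
      generalize lab μ.1 (s₁.upper s₁.i) = v
      generalize ind ((D.inner s₁.level).dotted s₁.i = false) = w
      revert u v w; decide
    rw [h1, chi_add, chi_one, mul_neg_one, neg_add_cancel, zero_smul, smul_zero]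
  have hE₂ : E₂.IsOrientation μ.1 := by
    refine t₂.isOrientation_of_lab_add hF ?_
    rw [t₂.lab_j hF, t₂.lab_i hF, q.upper_i, q.upper_j, q.dotted₁]
    exact hcup
  have hD := q.isOrientation_source hE hE₂
  refine ⟨⟨⟨μ.1, hE₂⟩⟩, ?_⟩
  have hmatch : ∀ {E₁ E₂ : StackedDiagram Λ h} {s₁ : Surgery D E₁} {s₂ : Surgery D E₂}
      {t₁ : Surgery E₁ F} {t₂ : Surgery E₂ F}, Square s₁ s₂ t₁ t₂ → s₁.IsSplit → t₁.IsMerge →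
      s₂.IsSplit →
      (E₁.Conn (s₂.lower s₂.i) (s₁.lower s₁.i) ∧ E₁.Conn (s₂.upper s₂.i) (s₁.lower s₁.j)) ∨
      (E₁.Conn (s₂.lower s₂.i) (s₁.lower s₁.j) ∧ E₁.Conn (s₂.upper s₂.i) (s₁.lower s₁.i)) := by
    intro E₁ E₂ s₁ s₂ t₁ t₂ q hs₁ ht₁ hs₂
    have hne : ¬ E₁.Conn (s₂.lower s₂.i) (s₂.upper s₂.i) := by
      rw [← q.symm.lower_i, ← q.symm.upper_i]; exact ht₁.ne
    rcases (hs₁.iff _ _).1 (merge_mono hs₂ s₂.conn_i) with h1 | ⟨h1 | h1, h2 | h2⟩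
    · exact absurd h1 hne
    · exact absurd (h1.trans (Conn.symm h2)) hne
    · exact Or.inl ⟨h1, h2⟩
    · exact Or.inr ⟨h1, h2⟩
    · exact absurd (h1.trans (Conn.symm h2)) hne
  have hm := hmatch q hs₁ ht₁ hs₂
  have hm' := hmatch q.symm hs₂ ht₂ hs₁
  have hD12 : D.Conn (s₁.lower s₁.i) (s₂.lower s₂.i) := by
    refine Conn.symm ?_
    rcases hm with h1 | h1
    · exact merge_mono hs₁ h1.1
    · exact (merge_mono hs₁ h1.1).trans s₁.conn_lower.symm
  -- The two exceptional cases of `twist_eq_or`, for the square and for its reflection, exclude each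
  -- other.
  have htw : twist μ.1 (s₁.upper s₁.j) = twist μ.1 (s₂.upper s₂.j) := by
    rcases q.twist_eq_or hD hE hF hs₁ hm with h1 | ⟨h1, -⟩
    · exact h1
    rcases q.symm.twist_eq_or hD hE₂ hF hs₂ hm' with h2 | ⟨-, h2⟩
    · exact h2.symm
    rw [← conn_set_congr hD12, h1] at h2
    exact absurd h2 one_ne_zero
  have hF12 : F.Conn (s₁.lower s₁.i) (s₂.lower s₂.i) := by
    refine Conn.symm ?_
    rcases hm with h1 | h1
    · exact merge_mono ht₁ h1.1
    · exact (merge_mono ht₁ h1.1).trans hFij.symm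
  have hFij₂ : F.Conn (s₂.lower s₂.i) (s₂.lower s₂.j) := by
    rw [← q.symm.lower_i, ← q.symm.lower_j]; exact merge_mono ht₁ t₁.conn_lower
  rw [s₁.splitOp_eq_loop μ hD, s₂.splitOp_eq_loop μ hD, htw, q.loop_upper_i, q.loop_upper_j,
    q.symm.loop_upper_i, q.symm.loop_upper_j, loop_of_conn μ hFij.symm, loop_of_conn μ hFij₂.symm,
    loop_of_conn μ hF12]

/-- An orientation of `F` can be chosen to orient `E₁` and `D` as well, and then it orients `E₂`. -/
theorem nonempty_of_merge_split (q : Square s₁ s₂ t₁ t₂) (ν₀ : D.Orientation) (μ₀ : F.Orientation)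
    (hs₁ : s₁.IsMerge) (ht₁ : t₁.IsSplit) : Nonempty E₂.Orientation := by
  obtain ⟨ν, hE, hF, -⟩ := ht₁.exists_isOrientation μ₀.2
  exact ⟨⟨ν, q.symm.isOrientation_left (hs₁.isOrientation ν₀.2 hE) hF⟩⟩

end Square

/-! ### The positions of the surgeries -/

namespace Surgery

/-- A surgery takes place at any cup which it replaces by rays. -/
theorem eq_of_cup (s : Surgery D E) {l : Fin h} {x y : Λ.Vertex} (hxy : x < y)
    (hD : (D.inner l).partner x = y) (hE : (E.inner l).partner x = x) :
    s.level = l ∧ s.i = x ∧ s.j = y := by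
  obtain rfl : l = s.level := by
    by_contra hl
    rw [s.inner_eq l hl, hD] at hE
    exact hxy.ne' hE
  have hij := s.cup
  by_cases hi : x = s.i
  · subst hi
    exact ⟨rfl, rfl, hij.symm.trans hD⟩
  by_cases hj : x = s.j
  · rw [hj, ← hij, CupDiagram.partner_partner] at hD
    exact absurd hxy (by rw [hj, ← hD]; exact s.lt.not_gt)
  · rw [s.partner_eq x hi hj, hD] at hE
    exact absurd hE hxy.ne'

theorem ray_of_ray (s : Surgery D E) {l : Fin h} {x : Λ.Vertex} (hx : (D.inner l).partner x = x) :
    (E.inner l).partner x = x := by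
  by_cases hl : l = s.level
  · subst hl
    by_cases hi : x = s.i
    · rw [hi]; exact s.ray_i
    by_cases hj : x = s.j
    · rw [hj]; exact s.ray_j
    · rw [s.partner_eq x hi hj, hx]
  · rw [s.inner_eq l hl, hx]

theorem eq_of_position {s t : Surgery D E} (hl : s.level = t.level) (hi : s.i = t.i)
    (hj : s.j = t.j) : s = t := by
  cases s; cases t; cases hl; cases hi; cases hj; rfl

instance : Subsingleton (Surgery D E) :=
  ⟨fun s t => by
    obtain ⟨hl, hi, hj⟩ := t.eq_of_cup s.lt s.cup s.ray_i
    exact (eq_of_position hl hi hj).symm⟩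

/-- The result of a surgery is determined by its position. -/
theorem target_eq (s : Surgery D E₁) (t : Surgery D E₂) (hl : s.level = t.level) (hi : s.i = t.i) :
    E₁ = E₂ := by
  have hj : s.j = t.j := by rw [← s.cup, ← t.cup, hl, hi]
  have hlam : E₁.lam = E₂.lam := s.lam_eq.trans t.lam_eq.symm
  have hmu : E₁.mu = E₂.mu := s.mu_eq.trans t.mu_eq.symm
  have hinner : E₁.inner = E₂.inner := by
    funext l
    by_cases hls : l = t.level
    · subst hls
      have p1 := s.partner_eq
      have p2 := s.dotted_eq
      have p3 := s.ray_i
      have p4 := s.ray_j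
      have p5 := s.undotted_i
      have p6 := s.undotted_j
      rw [hl] at p1 p2 p3 p4 p5 p6
      rw [hi, hj] at p1 p2
      rw [hi] at p3 p5
      rw [hj] at p4 p6
      refine CupDiagram.ext (funext fun k => ?_) (funext fun k => ?_)
      · by_cases h1 : k = t.i
        · rw [h1, p3, t.ray_i]
        by_cases h2 : k = t.j
        · rw [h2, p4, t.ray_j]
        · rw [p1 k h1 h2, t.partner_eq k h1 h2]
      · by_cases h1 : k = t.i
        · rw [h1, p5, t.undotted_i]
        by_cases h2 : k = t.j
        · rw [h2, p6, t.undotted_j]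
        · rw [p2 k h1 h2, t.dotted_eq k h1 h2]
    · rw [s.inner_eq l (hl ▸ hls), t.inner_eq l hls]
  cases E₁; cases E₂; cases hlam; cases hmu; cases hinner; rfl

/-- A surgery does not change the cups at other positions. -/
theorem cup_of_ne (s : Surgery D E₁) (t : Surgery D E₂) (hne : ¬ (s.level = t.level ∧ s.i = t.i)) :
    (E₂.inner s.level).partner s.i = s.j ∧
      (E₂.inner s.level).dotted s.i = (D.inner s.level).dotted s.i := by
  by_cases hl : s.level = t.level
  · have hi : s.i ≠ t.i := fun hi => hne ⟨hl, hi⟩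
    have hj : s.i ≠ t.j := by
      intro hj
      have h1 : s.j = t.i := by
        rw [← s.cup, hl, hj, ← t.cup, CupDiagram.partner_partner]
      have h2 := s.lt
      rw [hj, h1] at h2
      exact t.lt.not_gt h2
    have hc := s.cup
    rw [hl] at hc ⊢
    exact ⟨(t.partner_eq _ hi hj).trans hc, t.dotted_eq _ hi hj⟩
  · rw [t.inner_eq _ hl]
    exact ⟨s.cup, rfl⟩

end Surgery

/-- A cup which is replaced by the first surgery of one path is still present after the first
surgery of the other path, but not in `F`. -/
theorem square_of_ne (s₁ : Surgery D E₁) (s₂ : Surgery D E₂) (t₁ : Surgery E₁ F)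
    (t₂ : Surgery E₂ F) (hne : ¬ (s₁.level = s₂.level ∧ s₁.i = s₂.i)) : Square s₁ s₂ t₁ t₂ := by
  obtain ⟨hc₁, hd₁⟩ := s₁.cup_of_ne s₂ hne
  obtain ⟨hc₂, hd₂⟩ := s₂.cup_of_ne s₁ fun h1 => hne ⟨h1.1.symm, h1.2.symm⟩
  obtain ⟨hl₁, hi₁, hj₁⟩ := t₂.eq_of_cup s₁.lt hc₁ (t₁.ray_of_ray s₁.ray_i)
  obtain ⟨hl₂, hi₂, hj₂⟩ := t₁.eq_of_cup s₂.lt hc₂ (t₂.ray_of_ray s₂.ray_i)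
  refine ⟨hl₁, hi₁, hj₁, ?_, hl₂, hi₂, hj₂, ?_⟩
  · rw [hl₁, hi₁, hd₁]
  · rw [hl₂, hi₂, hd₂]

/-! ### Two surgeries in succession on the anticlockwise orientation -/

section Values

theorem Surgery.splitOp_splitOp (s : Surgery D E) {D' E' : StackedDiagram Λ h}
    (t : Surgery D' E') (F : StackedDiagram Λ h) (v : F.Space) :
    s.splitOp F (t.splitOp F v) = t.splitOp F (s.splitOp F v) := by
  rw [Surgery.splitOp, LinearMap.smul_apply, LinearMap.add_apply, LinearMap.smul_apply,
    ← t.splitOp_comm, ← t.splitOp_comm, ← map_smul, ← map_add, ← map_smul]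
  rfl

variable {s : Surgery D E} {t : Surgery E F}

theorem surg_surg_merge_merge (hs : s.IsMerge) (ht : t.IsMerge) (ν : D.Orientation) :
    t.surg (s.surg (D.basisVec ∅)) = F.basisVec ∅ := by
  obtain ⟨ν', -, hE, -⟩ := hs.exists_isOrientation ν.2
  rw [hs.surg_empty ν, ht.surg_empty ⟨ν', hE⟩]

theorem surg_surg_merge_split (hs : s.IsMerge) (ht : t.IsSplit) (ν : D.Orientation) :
    t.surg (s.surg (D.basisVec ∅)) = t.splitOp F (F.basisVec ∅) := by
  rw [hs.surg_empty ν, ht.surg_empty]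

open Classical in
theorem surg_surg_merge_reconnect (hs : s.IsMerge) (ht : t.IsReconnect) (ν : D.Orientation) :
    t.surg (s.surg (D.basisVec ∅)) = if t.IsGood then F.basisVec ∅ else 0 := by
  obtain ⟨ν', -, hE, -⟩ := hs.exists_isOrientation ν.2
  rw [hs.surg_empty ν, ht.surg_empty ⟨ν', hE⟩]

theorem surg_surg_of_split (hs : s.IsSplit) :
    t.surg (s.surg (D.basisVec ∅)) = s.splitOp F (t.surg (E.basisVec ∅)) := by
  rw [hs.surg_empty, t.surg_splitOp]

theorem surg_surg_split_merge (hs : s.IsSplit) (ht : t.IsMerge) (ν : E.Orientation) :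
    t.surg (s.surg (D.basisVec ∅)) = s.splitOp F (F.basisVec ∅) := by
  rw [surg_surg_of_split hs, ht.surg_empty ν]

theorem surg_surg_split_split (hs : s.IsSplit) (ht : t.IsSplit) :
    t.surg (s.surg (D.basisVec ∅)) = s.splitOp F (t.splitOp F (F.basisVec ∅)) := by
  rw [surg_surg_of_split hs, ht.surg_empty]

open Classical in
theorem surg_surg_split_reconnect (hs : s.IsSplit) (ht : t.IsReconnect) :
    t.surg (s.surg (D.basisVec ∅)) = if t.IsGood then s.splitOp F (F.basisVec ∅) else 0 := by
  rw [surg_surg_of_split hs]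
  rcases isEmpty_or_nonempty E.Orientation with hE | ⟨⟨ν⟩⟩
  · rw [basisVec_of_isEmpty hE, map_zero, map_zero, if_neg]
    rintro ⟨⟨ν, hν, -⟩, -⟩
    exact hE.elim ⟨ν, hν⟩
  · rw [ht.surg_empty ν]
    split_ifs
    · rfl
    · rw [map_zero]

open Classical in
theorem surg_surg_reconnect_merge (hs : s.IsReconnect) (ht : t.IsMerge) (ν : D.Orientation) :
    t.surg (s.surg (D.basisVec ∅)) = if s.IsGood then F.basisVec ∅ else 0 := by
  rw [hs.surg_empty ν]
  split_ifs with hg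
  · obtain ⟨⟨ν', -, hE⟩, -⟩ := hg
    rw [ht.surg_empty ⟨ν', hE⟩]
  · rw [map_zero]

open Classical in
theorem surg_surg_reconnect_split (hs : s.IsReconnect) (ht : t.IsSplit) (ν : D.Orientation) :
    t.surg (s.surg (D.basisVec ∅)) = if s.IsGood then t.splitOp F (F.basisVec ∅) else 0 := by
  rw [hs.surg_empty ν]
  split_ifs with hg
  · rw [ht.surg_empty]
  · rw [map_zero]

open Classical in
theorem surg_surg_reconnect_reconnect (hs : s.IsReconnect) (ht : t.IsReconnect)
    (ν : D.Orientation) :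
    t.surg (s.surg (D.basisVec ∅)) = if s.IsGood ∧ t.IsGood then F.basisVec ∅ else 0 := by
  rw [hs.surg_empty ν]
  by_cases hg : s.IsGood
  · obtain ⟨⟨ν', -, hE⟩, -⟩ := id hg
    rw [if_pos hg, ht.surg_empty ⟨ν', hE⟩]
    simp only [hg, true_and]
  · rw [if_neg hg, map_zero, if_neg fun h1 => hg h1.1]

end Values

/-! ### The case analysis -/

namespace Square

variable {s₁ : Surgery D E₁} {s₂ : Surgery D E₂} {t₁ : Surgery E₁ F} {t₂ : Surgery E₂ F}

/-- The two ways around a square agree on the anticlockwise orientation of `D` if one of them does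
not vanish on it. -/
theorem surg_surg_empty_of_ne_zero (q : Square s₁ s₂ t₁ t₂) (ν₀ : D.Orientation)
    (μ₀ : F.Orientation) (h0 : t₁.surg (s₁.surg (D.basisVec ∅)) ≠ 0) :
    t₁.surg (s₁.surg (D.basisVec ∅)) = t₂.surg (s₂.surg (D.basisVec ∅)) := by
  classical
  have hop₁ := q.splitOp_eq F
  have hop₂ := q.symm.splitOp_eq F
  rcases s₁.trichotomy with ⟨hs₁, n₁⟩ | ⟨hs₁, n₁⟩ | ⟨hs₁, n₁⟩ <;>
  rcases t₁.trichotomy with ⟨ht₁, n₂⟩ | ⟨ht₁, n₂⟩ | ⟨ht₁, n₂⟩ <;>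
  rcases s₂.trichotomy with ⟨hs₂, n₃⟩ | ⟨hs₂, n₃⟩ | ⟨hs₂, n₃⟩ <;>
  rcases t₂.trichotomy with ⟨ht₂, n₄⟩ | ⟨ht₂, n₄⟩ | ⟨ht₂, n₄⟩ <;>
  -- the total change of the number of components is the same on both ways
  try (exfalso; omega)
  · rw [surg_surg_merge_merge hs₁ ht₁ ν₀, surg_surg_merge_merge hs₂ ht₂ ν₀]
  · rw [surg_surg_merge_split hs₁ ht₁ ν₀, surg_surg_merge_split hs₂ ht₂ ν₀, hop₁, hop₂,
      q.splitOp_eq_of_merge_split ν₀ μ₀ hs₁ ht₁ hs₂ ht₂]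
  · obtain ⟨ν₂⟩ := q.nonempty_of_merge_split ν₀ μ₀ hs₁ ht₁
    rw [surg_surg_merge_split hs₁ ht₁ ν₀, surg_surg_split_merge hs₂ ht₂ ν₂, hop₂]
  · exact (q.not_merge_split hs₁ ht₁ hs₂).elim
  · have hg : t₁.IsGood ↔ t₂.IsGood := ⟨q.isGood_of_merge_reconnect ν₀ hs₁ ht₁ hs₂,
      q.symm.isGood_of_merge_reconnect ν₀ hs₂ ht₂ hs₁⟩
    rw [surg_surg_merge_reconnect hs₁ ht₁ ν₀, surg_surg_merge_reconnect hs₂ ht₂ ν₀]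
    simp only [hg]
  · rw [surg_surg_merge_reconnect hs₁ ht₁ ν₀, surg_surg_reconnect_merge hs₂ ht₂ ν₀]
    simp only [q.isGood_iff_of_merge ν₀ hs₁ hs₂ ht₂]
  · obtain ⟨ν₁⟩ := q.symm.nonempty_of_merge_split ν₀ μ₀ hs₂ ht₂
    rw [surg_surg_split_merge hs₁ ht₁ ν₁, surg_surg_merge_split hs₂ ht₂ ν₀, hop₁]
  · rcases isEmpty_or_nonempty E₁.Orientation with hE | ⟨⟨ν₁⟩⟩
    · rw [surg_surg_of_split hs₁, basisVec_of_isEmpty hE, map_zero, map_zero] at h0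
      exact absurd rfl h0
    rw [surg_surg_split_merge hs₁ ht₁ ν₁] at h0 ⊢
    obtain ⟨⟨ν₂⟩, heq⟩ := q.splitOp_eq_of_split_merge hs₁ ht₁ hs₂ ht₂ ν₁ fun h1 => h0 <| by
      rw [h1, LinearMap.zero_apply]
    rw [surg_surg_split_merge hs₂ ht₂ ν₂, heq]
  · rw [surg_surg_of_split hs₁, q.splitOp_eq_zero ht₂] at h0
    exact absurd rfl h0
  · rw [surg_surg_split_split hs₁ ht₁, surg_surg_split_split hs₂ ht₂, hop₁, hop₂,
      Surgery.splitOp_splitOp]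
  · exact (q.not_split_reconnect ht₁ hs₂ ht₂).elim
  · rw [surg_surg_split_reconnect hs₁ ht₁, surg_surg_reconnect_split hs₂ ht₂ ν₀, hop₁]
    simp only [q.isGood_iff_of_split μ₀ hs₁ ht₁ ht₂]
  · rw [surg_surg_reconnect_merge hs₁ ht₁ ν₀, surg_surg_merge_reconnect hs₂ ht₂ ν₀]
    simp only [q.symm.isGood_iff_of_merge ν₀ hs₂ hs₁ ht₁]
  · exact (q.not_reconnect_merge hs₁ ht₁ hs₂).elim
  · rw [surg_surg_reconnect_split hs₁ ht₁ ν₀, surg_surg_split_reconnect hs₂ ht₂, hop₂]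
    simp only [q.symm.isGood_iff_of_split μ₀ hs₂ ht₂ ht₁]
  · rw [surg_surg_reconnect_split hs₁ ht₁ ν₀] at h0 ⊢
    obtain ⟨hg, -⟩ := ite_ne_right_iff.1 h0
    obtain ⟨hg₂, heq⟩ := q.splitOp_eq_of_reconnect_split μ₀ hs₁ ht₁ hs₂ ht₂ hg
    rw [surg_surg_reconnect_split hs₂ ht₂ ν₀, if_pos hg, if_pos hg₂, hop₁, hop₂, heq]
  · exact (q.symm.not_merge_split hs₂ ht₂ hs₁).elim
  · rw [surg_surg_reconnect_reconnect hs₁ ht₁ ν₀] at h0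
    obtain ⟨⟨hg₁, hg₂⟩, -⟩ := ite_ne_right_iff.1 h0
    have := numComponents_eq_of_reconnect
      (q.isGood_of_reconnect_reconnect hs₁ ht₁ hg₁ hg₂).1
    omega
  · rw [surg_surg_reconnect_reconnect hs₁ ht₁ ν₀] at h0 ⊢
    obtain ⟨⟨hg₁, hg₂⟩, -⟩ := ite_ne_right_iff.1 h0
    obtain ⟨-, hg₃, hg₄⟩ := q.isGood_of_reconnect_reconnect hs₁ ht₁ hg₁ hg₂
    rw [surg_surg_reconnect_reconnect hs₂ ht₂ ν₀, if_pos ⟨hg₁, hg₂⟩, if_pos ⟨hg₃, hg₄ ht₂⟩]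

theorem surg_comp_surg (q : Square s₁ s₂ t₁ t₂) :
    t₁.surg ∘ₗ s₁.surg = t₂.surg ∘ₗ s₂.surg := by
  rcases isEmpty_or_nonempty D.Orientation with hD | ⟨⟨ν₀⟩⟩
  · exact Subsingleton.elim _ _
  rcases isEmpty_or_nonempty F.Orientation with hF | ⟨⟨μ₀⟩⟩
  · exact LinearMap.ext fun v => Subsingleton.elim _ _
  refine lhom_ext_turn ?_ fun x v hv => ?_
  · simp only [LinearMap.comp_apply]
    by_cases h1 : t₁.surg (s₁.surg (D.basisVec ∅)) = 0
    · by_cases h2 : t₂.surg (s₂.surg (D.basisVec ∅)) = 0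
      · rw [h1, h2]
      · exact (q.symm.surg_surg_empty_of_ne_zero ν₀ μ₀ h2).symm
    · exact q.surg_surg_empty_of_ne_zero ν₀ μ₀ h1
  · simp only [LinearMap.comp_apply, Surgery.surg_turn] at hv ⊢
    rw [hv]

end Square

end StackedDiagram

end TypeDKhovanov

theorem theorem5p20 (Λ : TypeDKhovanov.Block) (h : ℕ)
    (D E₁ E₂ F : TypeDKhovanov.StackedDiagram Λ h)
    (s₁ : TypeDKhovanov.StackedDiagram.Surgery D E₁)
    (s₂ : TypeDKhovanov.StackedDiagram.Surgery D E₂)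
    (t₁ : TypeDKhovanov.StackedDiagram.Surgery E₁ F)
    (t₂ : TypeDKhovanov.StackedDiagram.Surgery E₂ F) :
    t₁.surg ∘ₗ s₁.surg = t₂.surg ∘ₗ s₂.surg := by
  by_cases hpos : s₁.level = s₂.level ∧ s₁.i = s₂.i
  · obtain rfl := s₁.target_eq s₂ hpos.1 hpos.2
    rw [Subsingleton.elim s₁ s₂, Subsingleton.elim t₁ t₂]
  · exact (TypeDKhovanov.StackedDiagram.square_of_ne s₁ s₂ t₁ t₂ hpos).surg_comp_surg
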